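/- Let $\mathbb K$ be a field of characteristic zero, let $n,d\ge 1$, and write $\delta(v)=vM+v'$ for row vectors $v\in\mathbb K(X)^n$, $T[M]=(TM+T')T^{-1}$ for invertible $T$, and $P=\Delta^n(e_1)$ for the $n\times n$ matrix with rows $e_1,\delta(e_1),\dots,\delta^{n-1}(e_1)$. The Abramov–Zima algorithm works on the system $Y'=MY$ by elementary pivot operations (gauge transformations $B\mapsto E[B]$ by elementary matrices $E$). Step 1 introduces new unknowns $Z=UY$, one by one, with $Z_1=Y_1$ and $Z_i$ a combination of the not yet replaced unknowns among $Y_2,\dots,Y_n$, until $Z'=\beta Z$ with $\beta$ lower triangular augmented by ones on its upper diagonal (it may stop early, with fewer than $n$ new unknowns); Step 2 eliminates the new unknowns $Z_i$, $i\ge2$, by lower triangular pivot operations of product $L$, so as to obtain, when Step 1 has introduced $n$ unknowns, $W=LZ$ with $W_1=Y_1$ and $W'=CW$ with $C$ companion (ones on the upper diagonal, arbitrary last row, zeros elsewhere). A property of polynomial matrices $M\in\mathcal M_n(\mathbb K[X])$ with entries of degree at most $d$ is *generic* if it holds outside the zero set of some nonzero polynomial over $\mathbb K$ in the $n^2(d+1)$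 coefficients of $M$. Rational functions are represented densely (coefficient lists of numerator and denominator, in lowest terms, with monic denominator); the degree of a rational function is the maximum of the degrees of its numerator and denominator, and that of a matrix the maximum over its entries. The complexity of the algorithm is the number of operations in $\mathbb K$ (arithmetic operations, zero tests and loads of integer constants) used when all its operations on rational functions are carried out by an arithmetic of $\mathbb K(X)$, that is, by a family of arithmetic computation trees over $\mathbb K$, one for each operation ($+,-,\times,/$, $\frac{d}{dX}$) and each size of the operands (and zero tests of rational functions, each counted as one operation). **Theorem.** There are a correct arithmetic of $\mathbb K(X)$ and absolute constants $c,k\in\mathbb N$ (all independent of $\mathbb K,n,d$) such that for all $n,d\ge1$ the following holds for generic $M$ of dimension $n$ and degree $d$: 1. The algorithm introduces $n$ unknowns and uncouples $Y'=MY$ into one scalar equation of order $n$: $P$ is invertible and the computed matrix $C=P[M]$ is companion. 2. $U$ is upper triangular with first row $e_1$ and $\beta=U[M]$ is lower triangular augmented by ones on its upper diagonal; $L$ is lower triangular with ones on its diagonal and $C=L[\beta]$. 3. $P=LU$, and $\deg L,\ \deg U\le c\,n^2d$. 4. The complexity is at most $c\,n^5d\,\log^k(nd+2)$; that is, it is $\tilde{\mathcal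 O}(n^5d)$. -/

import Mathlib

open Polynomial

universe u

noncomputable section

namespace AZ

/-! ## Arithmetic complexity over a base field -/

/-- The arithmetic operations of the base field. -/
inductive FieldOp
  | add
  | sub
  | mul
  | div

/-- The value of a base field operation. (A tree may test a divisor before it divides, so the
convention `x / 0 = 0` only matters for the definition to be total.) -/
def FieldOp.eval {K : Type u} [Field K] : FieldOp → K → K → K
  | .add, x, y => x + y
  | .sub, x, y => x - y
  | .mul, x, y => x * y
  | .div, x, y => x / y

/-- Arithmetic computation trees. A tree runs on a memory, which is a list of elements of the base
field, initially the input; it sees these elements only through the operations below.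
* `out p q` halts, with the values at the positions in `p` and in `q` as its two output lists;
* `const c next` appends the constant `c` to the memory;
* `op o i j next` appends the result of the operation `o` on the values at positions `i` and `j`;
* `test i z nz` continues with `z` if the value at position `i` is zero and with `nz` otherwise. -/
inductive ArithTree
  | out (p q : List ℕ)
  | const (c : ℤ) (next : ArithTree)
  | op (o : FieldOp) (i j : ℕ) (next : ArithTree)
  | test (i : ℕ) (z nz : ArithTree)

/-- The value stored at position `i`. -/
def fetch {K : Type u} [Field K] (mem : List K) (i : ℕ) : K := mem.getD i 0

open Classical in
/-- The two output lists of a computation tree on a given memory. -/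
def ArithTree.result {K : Type u} [Field K] : ArithTree → List K → List K × List K
  | .out p q, mem => (p.map (fetch mem), q.map (fetch mem))
  | .const c next, mem => next.result (mem ++ [(c : K)])
  | .op o i j next, mem => next.result (mem ++ [o.eval (fetch mem i) (fetch mem j)])
  | .test i z nz, mem => if fetch mem i = 0 then z.result mem else nz.result mem

open Classical in
/-- The number of operations in the base field (arithmetic operations, zero tests and loads of
constants) that a computation tree executes on a given memory. -/
def ArithTree.cost {K : Type u} [Field K] : ArithTree → List K → ℕ
  | .out _ _, _ => 0
  | .const c next, mem => next.cost (mem ++ [(c : K)]) + 1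
  | .op o i j next, mem => next.cost (mem ++ [o.eval (fetch mem i) (fetch mem j)]) + 1
  | .test i z nz, mem => (if fetch mem i = 0 then z.cost mem else nz.cost mem) + 1

/-! ## Rational functions and their dense representation -/

/-- The derivative `d/dX` of a rational function. -/
def ratDeriv {K : Type u} [Field K] (f : RatFunc K) : RatFunc K :=
  algebraMap K[X] (RatFunc K) (derivative f.num * f.denom - f.num * derivative f.denom) /
    algebraMap K[X] (RatFunc K) (f.denom ^ 2)

/-- The operations on rational functions that uncoupling algorithms use. -/
inductive RatOp
  | add
  | sub
  | mul
  | div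
  | deriv

/-- The value of an operation on rational functions; differentiation ignores the second operand. -/
def RatOp.eval {K : Type u} [Field K] : RatOp → RatFunc K → RatFunc K → RatFunc K
  | .add, f, g => f + g
  | .sub, f, g => f - g
  | .mul, f, g => f * g
  | .div, f, g => f / g
  | .deriv, f, _ => ratDeriv f

/-- The dense representation of a rational function in lowest terms with monic denominator: the
list of the coefficients of its numerator and that of its denominator. -/
def dense {K : Type u} [Field K] (f : RatFunc K) : List K × List K :=
  (f.num.coeffList, f.denom.coeffList)

/-- The lengths of the two lists of the dense representation. -/
def denseSize {K : Type u} [Field K] (f : RatFunc K) : ℕ × ℕ :=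
  ((dense f).1.length, (dense f).2.length)

/-- The memory that holds the dense representations of two operands. -/
def operands {K : Type u} [Field K] (f g : RatFunc K) : List K :=
  (dense f).1 ++ (dense f).2 ++ (dense g).1 ++ (dense g).2

/-- An arithmetic of rational functions in terms of base field operations: for each operation and
for each size of the two operands, a computation tree. -/
def RatArith : Type := RatOp → ℕ × ℕ → ℕ × ℕ → ArithTree

/-- The arithmetic computes correctly over the field `K`, from dense representations to dense
representations. -/
def RatArith.Correct (A : RatArith) (K : Type u) [Field K] : Prop :=
  ∀ (o : RatOp) (f g : RatFunc K),
    (A o (denseSize f) (denseSize g)).result (operands f g) = dense (o.eval f g)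

/-- A step of an algorithm that computes with rational functions. -/
inductive Step (K : Type u) [Field K]
  | arith (o : RatOp) (f g : RatFunc K)
  | zeroTest (f : RatFunc K)

/-- The number of base field operations that a step takes under the given arithmetic. (A zero test
only has to inspect the numerator of a dense representation.) -/
def RatArith.stepCost (A : RatArith) {K : Type u} [Field K] : Step K → ℕ
  | .arith o f g => (A o (denseSize f) (denseSize g)).cost (operands f g)
  | .zeroTest _ => 1

/-- A computation with rational functions: its value, together with the list of all the
steps that it has executed. -/
structure Traced (K : Type u) [Field K] (α : Type u) : Type u where
  val : α
  trace : List (Step K)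

instance {K : Type u} [Field K] : Monad (Traced K) where
  pure a := ⟨a, []⟩
  bind x f := ⟨(f x.val).val, x.trace ++ (f x.val).trace⟩

/-- The number of base field operations of a computation under the given arithmetic. -/
def Traced.cost {K : Type u} [Field K] {α : Type u} (x : Traced K α) (A : RatArith) : ℕ :=
  (x.trace.map A.stepCost).sum

/-- Perform one operation. -/
def exec {K : Type u} [Field K] (o : RatOp) (f g : RatFunc K) : Traced K (RatFunc K) :=
  ⟨o.eval f g, [.arith o f g]⟩

open Classical in
/-- Perform one zero test. -/
def isZero {K : Type u} [Field K] (f : RatFunc K) : Traced K (ULift.{u} Bool) :=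
  ⟨⟨decide (f = 0)⟩, [.zeroTest f]⟩

/-! ## Gauge transformations -/

/-- Square matrices of rational functions. -/
abbrev Mat (n : ℕ) (K : Type u) [Field K] : Type u := Matrix (Fin n) (Fin n) (RatFunc K)

/-- The gauge transformation `T[M] = (T M + T') T⁻¹` (meaningful for invertible `T`). -/
def gauge {n : ℕ} {K : Type u} [Field K] (T M : Mat n K) : Mat n K :=
  (T * M + T.map ratDeriv) * T⁻¹

/-- The operator `δ(v) = v M + v'` on row vectors. -/
def delta {n : ℕ} {K : Type u} [Field K] (M : Mat n K) (v : Fin n → RatFunc K) :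
    Fin n → RatFunc K :=
  Matrix.vecMul v M + fun j => ratDeriv (v j)

/-- The matrix `Δⁿ(v)` with rows `v, δ(v), …, δⁿ⁻¹(v)`. -/
def krylov {n : ℕ} {K : Type u} [Field K] (M : Mat n K) (v : Fin n → RatFunc K) : Mat n K :=
  Matrix.of fun i => (delta M)^[(i : ℕ)] v

/-- Companion matrices: ones on the upper diagonal, an arbitrary last row, zeros elsewhere. -/
def IsCompanion {n : ℕ} {K : Type u} [Field K] (C : Mat n K) : Prop :=
  ∀ i j : Fin n, (i : ℕ) + 1 < n → C i j = if (j : ℕ) = i + 1 then 1 else 0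

/-- Lower triangular matrices augmented by ones on the upper diagonal. -/
def IsAugmentedLower {n : ℕ} {K : Type u} [Field K] (B : Mat n K) : Prop :=
  ∀ i j : Fin n, i < j → B i j = if (j : ℕ) = i + 1 then 1 else 0

/-- The change of unknowns `W = T Y` turns the system `Y' = M Y` into a system `W' = C W` with a
companion matrix `C`, that is, into one scalar differential equation. -/
def Uncouples {n : ℕ} {K : Type u} [Field K] (T M C : Mat n K) : Prop :=
  IsUnit T.det ∧ gauge T M = C ∧ IsCompanion C

/-- The degree of a rational function: the maximum of those of its numerator and denominator. -/
def ratDegree {K : Type u} [Field K] (f : RatFunc K) : ℕ :=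
  max f.num.natDegree f.denom.natDegree

/-- The degree of a matrix: the maximum of the degrees of its coefficients. -/
def matDegree {n : ℕ} {K : Type u} [Field K] (A : Mat n K) : ℕ :=
  Finset.univ.sup fun i => Finset.univ.sup fun j => ratDegree (A i j)

/-! ## The Abramov–Zima algorithm -/

/-- Replace one coefficient of a matrix. -/
def setEntry {n : ℕ} {K : Type u} [Field K] (B : Mat n K) (i j : Fin n) (x : RatFunc K) :
    Mat n K :=
  B.updateRow i (Function.update (B i) j x)

/-- Add `t` times row `j` to row `i`, coefficient by coefficient. -/
def addRow {n : ℕ} {K : Type u} [Field K] (B : Mat n K) (i j : Fin n) (t : RatFunc K) :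
    Traced K (Mat n K) :=
  (List.finRange n).foldlM (fun B c => do
    let x ← exec .mul t (B j c)
    let y ← exec .add (B i c) x
    return setEntry B i c y) B

/-- Subtract column `i` times `t` from column `j`, coefficient by coefficient. -/
def subCol {n : ℕ} {K : Type u} [Field K] (B : Mat n K) (i j : Fin n) (t : RatFunc K) :
    Traced K (Mat n K) :=
  (List.finRange n).foldlM (fun B r => do
    let x ← exec .mul (B r i) t
    let y ← exec .sub (B r j) x
    return setEntry B r j y) B

/-- Multiply row `i` by `p`. -/
def scaleRow {n : ℕ} {K : Type u} [Field K] (B : Mat n K) (i : Fin n) (p : RatFunc K) :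
    Traced K (Mat n K) :=
  (List.finRange n).foldlM (fun B c => do
    let x ← exec .mul p (B i c)
    return setEntry B i c x) B

/-- Divide column `i` by `p`. -/
def divCol {n : ℕ} {K : Type u} [Field K] (B : Mat n K) (i : Fin n) (p : RatFunc K) :
    Traced K (Mat n K) :=
  (List.finRange n).foldlM (fun B r => do
    let x ← exec .div (B r i) p
    return setEntry B r i x) B

/-- Intermediate data: the matrix `sys` of the current system, the matrix `trans` of the change of
unknowns that led to it, and the number `len` of new unknowns introduced so far. -/
structure State (n : ℕ) (K : Type u) [Field K] : Type u where
  sys : Mat n K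
  trans : Mat n K
  len : ℕ

/-- The pivot operation `(B, T) ↦ (E[B], E T)` for the matrix `E` that differs from the identity by
the coefficient `t` at `(i, j)`, where `i ≠ j`. -/
def pivotAdd {n : ℕ} {K : Type u} [Field K] (s : State n K) (i j : Fin n) (t : RatFunc K) :
    Traced K (State n K) := do
  let B ← addRow s.sys i j t
  let B ← subCol B i j t
  let t' ← exec .deriv t 0
  let b ← exec .add (B i j) t'
  let T ← addRow s.trans i j t
  return ⟨setEntry B i j b, T, s.len⟩

/-- The pivot operation `(B, T) ↦ (E[B], E T)` for the diagonal matrix `E` that differs from the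
identity by the coefficient `p ≠ 0` at `(i, i)`. -/
def pivotScale {n : ℕ} {K : Type u} [Field K] (s : State n K) (i : Fin n) (p : RatFunc K) :
    Traced K (State n K) := do
  let B ← scaleRow s.sys i p
  let p' ← exec .deriv p 0
  let b ← exec .add (B i i) p'
  let B ← divCol (setEntry B i i b) i p
  let T ← scaleRow s.trans i p
  return ⟨B, T, s.len⟩

/-- The pivot operation `(B, T) ↦ (E[B], E T)` for the permutation matrix `E` that exchanges the
unknowns `i` and `j`. -/
def pivotSwap {n : ℕ} {K : Type u} [Field K] (s : State n K) (i j : Fin n) : State n K :=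
  ⟨s.sys.submatrix (Equiv.swap i j) (Equiv.swap i j), s.trans.submatrix (Equiv.swap i j) id, s.len⟩

/-- The first index `j` in the given list such that the coefficient of `B` at `(i, j)` is not
zero. -/
def findPivot {n : ℕ} {K : Type u} [Field K] (B : Mat n K) (i : Fin n) :
    List (Fin n) → Traced K (ULift.{u} (Option (Fin n)))
  | [] => pure ⟨none⟩
  | j :: js => do
    if (← isZero (B i j)).down then findPivot B i js else pure ⟨some j⟩

/-- One iteration of the first step. The first `i + 1` unknowns of the current system are the new
unknowns `Z` up to index `i`. Unless it only involves new unknowns, the right-hand side of the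
equation for the derivative of the last one is a combination of new unknowns plus a nonzero
combination of remaining unknowns. The latter combination becomes the next new unknown, in the place
of the first remaining unknown that occurs in it. -/
def introduce {n : ℕ} {K : Type u} [Field K] (s : State n K) (i : Fin n) :
    Traced K (State n K) :=
  if h : (i : ℕ) + 1 < n then
    if s.len = i + 1 then do
      let next : Fin n := ⟨i + 1, h⟩
      match (← findPivot s.sys i ((List.finRange n).filter (i < ·))).down with
      | none => return s
      | some r =>
        let s := pivotSwap s next r
        let s ← pivotScale s next (s.sys i next)
        let s ← ((List.finRange n).filter (next < ·)).foldlM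
          (fun s j => pivotAdd s next j (s.sys i j)) s
        return ⟨s.sys, s.trans, s.len + 1⟩
    else return s
  else return s

/-- Step 1: starting from the first unknown, introduce new unknowns `Z = U Y`, one by one, such that
the derivative of each is a combination of the preceding ones, itself and the next one. -/
def stepOne {n : ℕ} {K : Type u} [Field K] (M : Mat n K) : Traced K (State n K) :=
  (List.finRange n).foldlM introduce ⟨M, 1, 1⟩

/-- One iteration of the second step: pivot operations cancel the coefficients of row `i` up to
the diagonal, by means of the coefficient one to the right of the diagonal. -/
def eliminate {n : ℕ} {K : Type u} [Field K] (s : State n K) (i : Fin n) :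
    Traced K (State n K) :=
  if h : (i : ℕ) + 1 < n then
    if (i : ℕ) + 1 < s.len then
      ((List.finRange n).filter (· ≤ i)).foldlM
        (fun s j => pivotAdd s ⟨i + 1, h⟩ j (s.sys i j)) s
    else return s
  else return s

/-- Step 2: replace the new unknowns other than the first one by the derivatives of the first
one. -/
def stepTwo {n : ℕ} {K : Type u} [Field K] (B : Mat n K) (len : ℕ) : Traced K (State n K) :=
  (List.finRange n).foldlM eliminate ⟨B, 1, len⟩

/-- The output: the order `len` of the scalar equation for the first unknown, the matrices `U` and
`L` of the changes of unknowns of the two steps, the matrix `β` of the system after the first step,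
and the matrix `C` of the system after the second one. -/
structure Output (n : ℕ) (K : Type u) [Field K] : Type u where
  len : ℕ
  U : Mat n K
  β : Mat n K
  L : Mat n K
  C : Mat n K

/-- The Abramov–Zima algorithm for the partial uncoupling of the system `Y' = M Y`. -/
def abramovZima {n : ℕ} {K : Type u} [Field K] (M : Mat n K) : Traced K (Output n K) := do
  let s ← stepOne M
  let t ← stepTwo s.sys s.len
  return ⟨s.len, s.trans, s.sys, t.trans, t.sys⟩

/-! ## Generic polynomial matrices -/

/-- A property of points in `K^σ` is generic if it holds outside the zero set of a nonzero
polynomial. -/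
def IsGeneric {σ K : Type*} [Field K] (property : (σ → K) → Prop) : Prop :=
  ∃ F : MvPolynomial σ K, F ≠ 0 ∧ ∀ x : σ → K, MvPolynomial.eval x F ≠ 0 → property x

/-- The matrix of polynomials of degree at most `d` with the given coefficients. -/
def polyMatrix {n d : ℕ} {K : Type u} [Field K] (m : Fin n × Fin n × Fin (d + 1) → K) : Mat n K :=
  Matrix.of fun i j =>
    algebraMap K[X] (RatFunc K) (∑ k : Fin (d + 1), C (m (i, j, k)) * X ^ (k : ℕ))

end AZ

end

/-! There are two independent halves: an arithmetic of K(X) of quasi-linear complexity, and a proof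
that generically all rational functions met by the algorithm have degree O(n²d). The second point is
the heart: bounding degrees operation by operation would let them grow exponentially, so every
intermediate matrix is instead described in closed form.

Indices start at 0. Let P_a (`krylovBasis`) have the rows e, δ(e), …, δ^{a-1}(e), where e is the
first unit vector, followed by the unit vectors of index ≥ a; its determinant is the leading
principal minor of P of order a. For the shift matrix all P_a are the identity, so that outside a
hypersurface all P_a are invertible (`isGeneric_det_krylovBasis_ne_zero`). Let K_a be the span of
the first a iterates, and u_a (`auxVec`) the projection of δ^a(e) along K_a onto the span of the
unit vectors of index ≥ a. Then δ(u_a) ≡ u_{a+1} modulo K_{a+1} (`delta_auxVec_sub_mem`), which is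
the rule by which Step 1 forms its next unknown. Hence U has the rows u_a. The diagonal entries of U
are quotients of consecutive minors (`auxVec_diag_ne_zero`), so the first candidate pivot never
vanishes and no exchange takes place. Step 2 turns u_a back into δ^a(e) by adding multiples of the
earlier iterates, one coordinate at a time. Thus all intermediate changes of unknowns are explicit
(`auxBasis`, `mixedBasis`), and P = LU.

Iterates are polynomial vectors of degree at most nd, and Cramer's rule for P_a gives coordinates of
degree O(n²d) over one common denominator (`VecDegLE.coord`). A row x of a current system satisfies
xT = δ(T_r), with T the current change of unknowns. As T is adapted to the flag K_0 ⊂ K_1 ⊂ …, a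
suitable coordinate of this identity contains only one or two entries of x; so each entry is a short
expression in quantities of degree O(n²d) (`ratDegree_le_of_vecMul_auxBasis`,
`ratDegree_le_of_vecMul_mixedBasis`). There are at most 22n³ operations, whence n³ · n²d = n⁵d up to
logarithms.

For the arithmetic, polynomials are multiplied as in Schönhage and Strassen: cut into about √N
pieces and multiply cyclically over K[X]/(X^{2^p}+1), where X is a root of unity, so that no roots
of unity of K are needed (`exists_multiplies`). Fractions are reduced by the division steps of
Bernstein and Yang. These look at low coefficients only, so the transition matrix of many steps is
found by divide and conquer (`spec_jump`). One of its rows annihilates the given pair of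
polynomials, and its determinant is a constant times a power of X, so that row is the reduced
fraction up to powers of X and scaling (`num_denom_of_transition`). The trees are generated without
reference to K, which makes the arithmetic and its constants uniform in the field. -/

namespace AZ

set_option linter.unusedSectionVars false

/-! ## Programs that generate computation trees -/

/-- A program that generates a computation tree, in continuation passing style: it is given the
length of the memory, and its results are positions in the memory and control data. -/
def Code (α : Type) : Type := ℕ → (ℕ → α → ArithTree) → ArithTree

instance : Monad Code where
  pure a := fun len k => k len a
  bind x f := fun len k => x len fun len' a => f a len' k

namespace Code

/-- Load a constant. -/
def const (c : ℤ) : Code ℕ := fun len k => .const c (k (len + 1) len)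

/-- Perform an operation of the base field. -/
def op (o : FieldOp) (i j : ℕ) : Code ℕ := fun len k => .op o i j (k (len + 1) len)

/-- Perform a zero test, the result of which is available as control data. -/
def test (i : ℕ) : Code Bool := fun len k => .test i (k len true) (k len false)

variable {K : Type u} [Field K] {α β : Type}

/-- On the memory `mem` the program executes at most `T` operations, extends the memory and
establishes the postcondition `Q`. -/
def Spec (c : Code α) (mem : List K) (T : ℕ) (Q : α → List K → Prop) : Prop :=
  ∃ (a : α) (ext : List K) (t : ℕ), t ≤ T ∧ Q a (mem ++ ext) ∧
    ∀ k : ℕ → α → ArithTree,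
      (c mem.length k).result mem = (k (mem ++ ext).length a).result (mem ++ ext) ∧
      (c mem.length k).cost mem = (k (mem ++ ext).length a).cost (mem ++ ext) + t

theorem Spec.pure {a : α} {mem : List K} {Q : α → List K → Prop} (T : ℕ) (h : Q a mem) :
    Spec (pure a : Code α) mem T Q :=
  ⟨a, [], 0, Nat.zero_le _, by simpa using h, fun k => by simp [Pure.pure]⟩

theorem Spec.bind {c : Code α} {f : α → Code β} {mem : List K} {T₁ T₂ : ℕ}
    {Q : α → List K → Prop} {R : β → List K → Prop} (hc : Spec c mem T₁ Q)
    (hf : ∀ a ext, Q a (mem ++ ext) → Spec (f a) (mem ++ ext) T₂ R) :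
    Spec (c >>= f) mem (T₁ + T₂) R := by
  obtain ⟨a, ext, t, ht, hQ, h⟩ := hc
  obtain ⟨b, ext', t', ht', hR, h'⟩ := hf a ext hQ
  refine ⟨b, ext ++ ext', t + t', by omega, by simpa using hR, fun k => ?_⟩
  have h1 := h fun len a => f a len k
  have h2 := h' k
  rw [← List.append_assoc]
  exact ⟨h1.1.trans h2.1, h1.2.trans (by rw [h2.2]; omega)⟩

theorem Spec.mono {c : Code α} {mem : List K} {T T' : ℕ} {Q Q' : α → List K → Prop}
    (h : Spec c mem T Q) (hT : T ≤ T') (hQ : ∀ a ext, Q a (mem ++ ext) → Q' a (mem ++ ext)) :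
    Spec c mem T' Q' := by
  obtain ⟨a, ext, t, ht, hQ', h⟩ := h
  exact ⟨a, ext, t, by omega, hQ _ _ hQ', h⟩

theorem Spec.le {c : Code α} {mem : List K} {T T' : ℕ} {Q : α → List K → Prop}
    (h : Spec c mem T Q) (hT : T ≤ T') : Spec c mem T' Q :=
  h.mono hT fun _ _ h => h

/-- The value `v` is stored at position `i`. -/
def Has (mem : List K) (i : ℕ) (v : K) : Prop := mem[i]? = some v

/-- Memory only grows, so a position keeps its value for the rest of a program; every earlier fact
is transported in this way. -/
theorem Has.append {mem : List K} {i : ℕ} {v : K} (h : Has mem i v) (ext : List K) :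
    Has (mem ++ ext) i v := by
  unfold Has at *
  rw [List.getElem?_append_left]
  · exact h
  · by_contra hlt
    rw [List.getElem?_eq_none (by omega)] at h
    cases h

theorem Has.fetch {mem : List K} {i : ℕ} {v : K} (h : Has mem i v) : fetch mem i = v := by
  unfold Has at h
  simp [AZ.fetch, List.getD, h]

theorem has_length (mem : List K) (v : K) : Has (mem ++ [v]) mem.length v := by
  simp [Has]

theorem spec_const (mem : List K) (c : ℤ) :
    Spec (const c) mem 1 fun i mem' => Has mem' i (c : K) :=
  ⟨mem.length, [(c : K)], 1, le_rfl, has_length _ _, fun k => by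
    simp [Code.const, ArithTree.result, ArithTree.cost]⟩

theorem spec_op {mem : List K} {i j : ℕ} {x y : K} (o : FieldOp) (hx : Has mem i x)
    (hy : Has mem j y) : Spec (op o i j) mem 1 fun r mem' => Has mem' r (o.eval x y) :=
  ⟨mem.length, [o.eval x y], 1, le_rfl, has_length _ _, fun k => by
    simp [Code.op, ArithTree.result, ArithTree.cost, hx.fetch, hy.fetch]⟩

open Classical in
theorem spec_test {mem : List K} {i : ℕ} {x : K} (hx : Has mem i x) :
    Spec (test i) mem 1 fun b _ => b = decide (x = 0) :=
  ⟨decide (x = 0), [], 1, le_rfl, rfl, fun k => by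
    by_cases h : x = 0 <;> simp [Code.test, ArithTree.result, ArithTree.cost, hx.fetch, h]⟩

/-- The first `N` positions of the array `r` hold the values of `v`. -/
def Arr (mem : List K) (N : ℕ) (r : ℕ → ℕ) (v : ℕ → K) : Prop := ∀ i < N, Has mem (r i) (v i)

theorem Arr.append {mem : List K} {N : ℕ} {r : ℕ → ℕ} {v : ℕ → K} (h : Arr mem N r v)
    (ext : List K) : Arr (mem ++ ext) N r v := fun i hi => (h i hi).append ext

theorem Arr.mono {mem : List K} {N N' : ℕ} {r : ℕ → ℕ} {v : ℕ → K} (h : Arr mem N r v)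
    (hN : N' ≤ N) : Arr mem N' r v := fun i hi => h i (by omega)

/-- Run programs for the indices `0, …, N - 1` and collect the results. -/
def array {α : Type} [Inhabited α] : (N : ℕ) → (ℕ → Code α) → Code (ℕ → α)
  | 0, _ => Pure.pure fun _ => default
  | N + 1, f => do
    let r ← array N f
    let x ← f N
    return Function.update r N x

theorem spec_array [Inhabited α] {f : ℕ → Code α} {mem : List K} {t : ℕ}
    {Q : ℕ → α → List K → Prop} (N : ℕ)
    (hf : ∀ i < N, ∀ ext, Spec (f i) (mem ++ ext) t (Q i))
    (hQ : ∀ i a mem' ext, Q i a mem' → Q i a (mem' ++ ext)) :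
    Spec (array N f) mem (N * t) fun r mem' => ∀ i < N, Q i (r i) mem' := by
  induction N with
  | zero => exact Spec.pure _ (by simp)
  | succ N ih =>
    rw [Nat.succ_mul]
    refine Spec.bind (ih fun i hi => hf i (by omega)) fun r ext hr => ?_
    refine (Spec.bind (T₂ := 0) (hf N (by omega) ext) fun x ext' hx => Spec.pure 0
      (Q := fun (r : ℕ → α) mem' => ∀ i < N + 1, Q i (r i) mem') ?_).le (by omega)
    intro i hi
    rcases Nat.lt_succ_iff_lt_or_eq.mp hi with h | rfl
    · rw [Function.update_of_ne (by omega)]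
      exact hQ _ _ _ _ (hr i h)
    · simpa using hx

theorem spec_arr {f : ℕ → Code ℕ} {mem : List K} {t N : ℕ} {v : ℕ → K}
    (hf : ∀ i < N, ∀ ext, Spec (f i) (mem ++ ext) t fun r mem' => Has mem' r (v i)) :
    Spec (array N f) mem (N * t) fun r mem' => Arr mem' N r v :=
  spec_array N (Q := fun i r mem' => Has mem' r (v i)) hf fun _ _ _ ext h => h.append ext

/-- Sum up the values that the programs for the indices `0, …, N - 1` compute. -/
def sum : (N : ℕ) → (ℕ → Code ℕ) → Code ℕ
  | 0, _ => const 0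
  | N + 1, f => do
    let s ← sum N f
    let x ← f N
    op .add s x

theorem spec_sum {f : ℕ → Code ℕ} {mem : List K} {t N : ℕ} {v : ℕ → K}
    (hf : ∀ i < N, ∀ ext, Spec (f i) (mem ++ ext) t fun r mem' => Has mem' r (v i)) :
    Spec (sum N f) mem (N * (t + 1) + 1) fun r mem' => Has mem' r (∑ i ∈ Finset.range N, v i) := by
  induction N with
  | zero => exact (spec_const mem 0).mono (by omega) fun _ _ h => by simpa using h
  | succ N ih =>
    refine (Spec.bind (ih fun i hi => hf i (by omega)) fun r ext hr =>
      Spec.bind (hf N (by omega) ext) fun x ext' hx =>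
        spec_op .add (hr.append ext') hx).mono (by ring_nf; omega) fun r _ h => ?_
    rw [Finset.sum_range_succ]
    exact h

/-- The negative of a value. -/
def neg (i : ℕ) : Code ℕ := do
  let z ← const 0
  op .sub z i

theorem spec_neg {mem : List K} {i : ℕ} {x : K} (hx : Has mem i x) :
    Spec (neg i) mem 2 fun r mem' => Has mem' r (-x) :=
  (Spec.bind (spec_const mem 0) fun _ ext hz => spec_op .sub hz (hx.append ext)).mono le_rfl
    fun r _ h => by simpa [FieldOp.eval] using h

/-- An operation on arrays, coefficient by coefficient. -/
def zip (o : FieldOp) (N : ℕ) (r s : ℕ → ℕ) : Code (ℕ → ℕ) := array N fun i => op o (r i) (s i)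

theorem spec_zip {mem : List K} {N : ℕ} {r s : ℕ → ℕ} {v w : ℕ → K} (o : FieldOp)
    (hv : Arr mem N r v) (hw : Arr mem N s w) :
    Spec (zip o N r s) mem N fun q mem' => Arr mem' N q fun i => o.eval (v i) (w i) :=
  (spec_arr (t := 1) (v := fun i => o.eval (v i) (w i)) fun i hi ext =>
    spec_op o ((hv i hi).append ext) ((hw i hi).append ext)).le (by omega)

end Code

end AZ

namespace AZ

/-! ## Polynomials with given coefficients -/

section Pol

variable {R : Type*} [CommRing R]

/-- The polynomial with the coefficients `v 0, …, v (N - 1)`. -/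
noncomputable def pol (N : ℕ) (v : ℕ → R) : R[X] := ∑ i ∈ Finset.range N, C (v i) * X ^ i

theorem pol_coeff (N : ℕ) (v : ℕ → R) (i : ℕ) : (pol N v).coeff i = if i < N then v i else 0 := by
  simp [pol, Polynomial.finsetSum_coeff, coeff_C_mul, coeff_X_pow]

theorem degree_pol_lt (N : ℕ) (v : ℕ → R) : (pol N v).degree < (N : ℕ) := by
  rw [degree_lt_iff_coeff_zero]
  intro i hi
  rw [pol_coeff, if_neg (by exact_mod_cast not_lt.mpr hi)]

theorem pol_coeff_self {p : R[X]} {N : ℕ} (hp : p.degree < N) : pol N p.coeff = p := by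
  ext i
  rw [pol_coeff]
  split_ifs with h
  · rfl
  · exact (degree_lt_iff_coeff_zero _ _ |>.mp hp i (by omega)).symm

theorem pol_congr {N : ℕ} {v w : ℕ → R} (h : ∀ i < N, v i = w i) : pol N v = pol N w :=
  Finset.sum_congr rfl fun i hi => by rw [h i (Finset.mem_range.mp hi)]

theorem pol_add_length (m n : ℕ) (v : ℕ → R) :
    pol (m + n) v = pol m v + X ^ m * pol n fun i => v (i + m) := by
  simp only [pol, Finset.sum_range_add, Finset.mul_sum]
  congr 1
  refine Finset.sum_congr rfl fun i _ => ?_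
  rw [add_comm i m, pow_add]
  ring

theorem pol_add (N : ℕ) (v w : ℕ → R) : (pol N fun i => v i + w i) = pol N v + pol N w := by
  simp [pol, add_mul, Finset.sum_add_distrib]

theorem pol_sub (N : ℕ) (v w : ℕ → R) : (pol N fun i => v i - w i) = pol N v - pol N w := by
  simp [pol, sub_mul, Finset.sum_sub_distrib]

theorem pol_neg (N : ℕ) (v : ℕ → R) : (pol N fun i => -v i) = -pol N v := by
  simp [pol]

theorem pol_const_mul (N : ℕ) (c : R) (v : ℕ → R) : (pol N fun i => c * v i) = C c * pol N v := by
  simp [pol, Finset.mul_sum, mul_assoc]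

theorem degree_mul_lt_of_lt [IsDomain R] {a b : R[X]} {m n : ℕ} (ha : a.degree < (m : ℕ))
    (hb : b.degree < (n : ℕ)) : (a * b).degree < ((m + n : ℕ) : WithBot ℕ) := by
  rcases eq_or_ne a 0 with h | h
  · rw [h, zero_mul, degree_zero]; exact WithBot.bot_lt_coe _
  rcases eq_or_ne b 0 with h' | h'
  · rw [h', mul_zero, degree_zero]; exact WithBot.bot_lt_coe _
  rw [degree_mul, degree_eq_natDegree h, degree_eq_natDegree h'] at *
  norm_cast at *
  omega

theorem pol_map {S : Type*} [CommRing S] (f : R →+* S) (N : ℕ) (v : ℕ → R) :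
    (pol N v).map f = pol N fun i => f (v i) := by
  simp [pol, Polynomial.map_sum]

/-- Multiplication by X^e moves the top e coefficients past X^(e+m) ≡ -1, so they reappear at the
bottom with the opposite sign. A product with a power of the root of unity therefore needs no
multiplication in the field. -/
theorem pol_rotate (e m : ℕ) (v : ℕ → R) :
    (pol (e + m) fun i => if i < e then -v (i + m) else v (i - e)) +
      (X ^ (e + m) + 1) * (pol e fun i => v (i + m)) = X ^ e * pol (e + m) v := by
  have h1 : (pol e fun i => if i < e then -v (i + m) else v (i - e)) =
      -pol e fun i => v (i + m) := by
    rw [← pol_neg]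
    exact pol_congr fun i hi => if_pos hi
  have h2 : (pol m fun i => if i + e < e then -v (i + e + m) else v (i + e - e)) = pol m v :=
    pol_congr fun i _ => by simp
  rw [pol_add_length e m, h1, h2, add_comm e m, pol_add_length m e]
  ring

end Pol

namespace Code

/-! ## Arithmetic modulo `X ^ 2 ^ p + 1` -/

section Negacyclic

variable {K : Type u} [Field K]

/-- The ring `K[X] / (X ^ 2 ^ p + 1)`. -/
abbrev Nega (K : Type u) [Field K] (p : ℕ) : Type u := AdjoinRoot (X ^ 2 ^ p + 1 : K[X])

/-- The class of `X`, a root of unity. -/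
noncomputable abbrev xi (K : Type u) [Field K] (p : ℕ) : Nega K p := AdjoinRoot.root _

theorem xi_pow (p : ℕ) : xi K p ^ 2 ^ p = -1 := by
  have h := AdjoinRoot.mk_self (f := (X ^ 2 ^ p + 1 : K[X]))
  rw [map_add, map_pow, AdjoinRoot.mk_X, map_one] at h
  exact eq_neg_of_add_eq_zero_left h

/-- The array `r` of length `2 ^ p` represents the element `s`. -/
def SRep (p : ℕ) (mem : List K) (r : ℕ → ℕ) (s : Nega K p) : Prop :=
  ∃ v : ℕ → K, Arr mem (2 ^ p) r v ∧ AdjoinRoot.mk _ (pol (2 ^ p) v) = s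

theorem SRep.append {p : ℕ} {mem : List K} {r : ℕ → ℕ} {s : Nega K p} (h : SRep p mem r s)
    (ext : List K) : SRep p (mem ++ ext) r s :=
  let ⟨v, hv, hs⟩ := h
  ⟨v, hv.append ext, hs⟩

theorem spec_add_nega {p : ℕ} {mem : List K} {r₁ r₂ : ℕ → ℕ} {s₁ s₂ : Nega K p}
    (h₁ : SRep p mem r₁ s₁) (h₂ : SRep p mem r₂ s₂) :
    Spec (zip .add (2 ^ p) r₁ r₂) mem (2 ^ p) fun r mem' => SRep p mem' r (s₁ + s₂) := by
  obtain ⟨v, hv, rfl⟩ := h₁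
  obtain ⟨w, hw, rfl⟩ := h₂
  exact (spec_zip .add hv hw).mono le_rfl fun r ext h => ⟨_, h, by simp [FieldOp.eval, pol_add]⟩

theorem spec_sub_nega {p : ℕ} {mem : List K} {r₁ r₂ : ℕ → ℕ} {s₁ s₂ : Nega K p}
    (h₁ : SRep p mem r₁ s₁) (h₂ : SRep p mem r₂ s₂) :
    Spec (zip .sub (2 ^ p) r₁ r₂) mem (2 ^ p) fun r mem' => SRep p mem' r (s₁ - s₂) := by
  obtain ⟨v, hv, rfl⟩ := h₁
  obtain ⟨w, hw, rfl⟩ := h₂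
  exact (spec_zip .sub hv hw).mono le_rfl fun r ext h => ⟨_, h, by simp [FieldOp.eval, pol_sub]⟩

/-- Multiplication by the power `xi ^ e`, where `e ≤ 2 ^ p`. -/
def shift (p e : ℕ) (r : ℕ → ℕ) : Code (ℕ → ℕ) :=
  array (2 ^ p) fun i => if i < e then neg (r (i + (2 ^ p - e))) else pure (r (i - e))

theorem spec_shift {p e : ℕ} (he : e ≤ 2 ^ p) {mem : List K} {r : ℕ → ℕ} {s : Nega K p}
    (h : SRep p mem r s) :
    Spec (shift p e r) mem (2 ^ p * 2) fun q mem' => SRep p mem' q (xi K p ^ e * s) := by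
  obtain ⟨v, hv, rfl⟩ := h
  refine (spec_arr (t := 2) (v := fun i => if i < e then -v (i + (2 ^ p - e)) else v (i - e))
    fun i hi ext => ?_).mono le_rfl fun q ext hq => ⟨_, hq, ?_⟩
  · split_ifs with hie
    · exact spec_neg ((hv _ (by omega)).append ext)
    · exact Spec.pure _ ((hv _ (by omega)).append ext)
  · obtain ⟨m, hm⟩ := Nat.exists_eq_add_of_le he
    have h := pol_rotate e m v
    rw [← hm, show m = 2 ^ p - e by omega] at h
    have h' := congrArg (AdjoinRoot.mk (X ^ 2 ^ p + 1 : K[X])) h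
    rw [map_add, map_mul, AdjoinRoot.mk_self, zero_mul, add_zero, map_mul, map_pow,
      AdjoinRoot.mk_X] at h'
    exact h'

/-- Division by two. -/
def half (p : ℕ) (r : ℕ → ℕ) : Code (ℕ → ℕ) := do
  let c ← const 2
  array (2 ^ p) fun i => op .div (r i) c

theorem spec_half {p : ℕ} {mem : List K} {r : ℕ → ℕ} {s : Nega K p} (h : SRep p mem r s) :
    Spec (half p r) mem (1 + 2 ^ p) fun q mem' =>
      SRep p mem' q (algebraMap K (Nega K p) 2⁻¹ * s) := by
  obtain ⟨v, hv, rfl⟩ := h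
  refine (Spec.bind (spec_const mem 2) fun c ext hc => spec_arr (t := 1) (v := fun i => 2⁻¹ * v i)
    fun i hi ext' => ?_).mono (by omega) fun q ext hq => ⟨_, hq, ?_⟩
  · refine (spec_op .div (((hv i hi).append ext).append ext') (hc.append ext')).mono le_rfl
      fun _ _ h => ?_
    simpa [FieldOp.eval, div_eq_inv_mul] using h
  · rw [pol_const_mul, map_mul, AdjoinRoot.mk_C]
    rfl

end Negacyclic

end Code

end AZ

namespace AZ

namespace Code

/-! ## Fast multiplication -/

/-- The program multiplies polynomials of degree less than `2 ^ k` over any field of characteristic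
zero with at most `T` operations. -/
def Multiplies (k T : ℕ) (mul : (ℕ → ℕ) → (ℕ → ℕ) → Code (ℕ → ℕ)) : Prop :=
  ∀ (K : Type u) [Field K] [CharZero K] (mem : List K) (r s : ℕ → ℕ) (a b : K[X]),
    a.degree < (2 ^ k : ℕ) → b.degree < (2 ^ k : ℕ) →
    Arr mem (2 ^ k) r a.coeff → Arr mem (2 ^ k) s b.coeff →
    Spec (mul r s) mem T fun q mem' => Arr mem' (2 ^ (k + 1)) q (a * b).coeff

/-- Multiplication in `K[X] / (X ^ 2 ^ p + 1)`. -/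
def negaMul (mul : (ℕ → ℕ) → (ℕ → ℕ) → Code (ℕ → ℕ)) (p : ℕ) (r s : ℕ → ℕ) : Code (ℕ → ℕ) := do
  let q ← mul r s
  zip .sub (2 ^ p) q fun i => q (i + 2 ^ p)

/-- Because X^(2^p) ≡ -1, reduction of a product subtracts its upper half from its lower half. -/
theorem spec_negaMul {mul : (ℕ → ℕ) → (ℕ → ℕ) → Code (ℕ → ℕ)} {p T : ℕ}
    (hmul : Multiplies.{u} p T mul) {K : Type u} [Field K] [CharZero K] {mem : List K}
    {r s : ℕ → ℕ} {x y : Nega K p} (hx : SRep p mem r x) (hy : SRep p mem s y) :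
    Spec (negaMul mul p r s) mem (T + 2 ^ p) fun q mem' => SRep p mem' q (x * y) := by
  obtain ⟨v, hv, rfl⟩ := hx
  obtain ⟨w, hw, rfl⟩ := hy
  set a := pol (2 ^ p) v with ha
  set b := pol (2 ^ p) w with hb
  have hda : a.degree < (2 ^ p : ℕ) := degree_pol_lt _ _
  have hdb : b.degree < (2 ^ p : ℕ) := degree_pol_lt _ _
  refine Spec.bind (hmul K mem r s a b hda hdb
    (fun i hi => by rw [ha, pol_coeff, if_pos hi]; exact hv i hi)
    (fun i hi => by rw [hb, pol_coeff, if_pos hi]; exact hw i hi)) fun q ext hq => ?_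
  have h2 : 2 ^ (p + 1) = 2 ^ p + 2 ^ p := by ring
  rw [h2] at hq
  refine (spec_zip .sub (hq.mono (Nat.le_add_right _ _))
    (w := fun i => (a * b).coeff (i + 2 ^ p)) fun i hi => hq (i + 2 ^ p) (by omega)).mono le_rfl
    fun q' ext' hq' => ⟨_, hq', ?_⟩
  have hab := degree_mul_lt_of_lt hda hdb
  rw [← map_mul, AdjoinRoot.mk_eq_mk]
  simp only [FieldOp.eval, pol_sub]
  refine ⟨-pol (2 ^ p) fun i => (a * b).coeff (i + 2 ^ p), ?_⟩
  have h := pol_coeff_self hab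
  rw [pol_add_length] at h
  linear_combination h

/-- The coefficientwise combinations `x j ± xi ^ e * x (j + h)`. -/
def twist (o : FieldOp) (p e h : ℕ) (x : ℕ → ℕ → ℕ) : Code (ℕ → ℕ → ℕ) :=
  array h fun j => do
    let t ← shift p e (x (j + h))
    zip o (2 ^ p) (x j) t

/-- A sequence of elements of `K[X] / (X ^ 2 ^ p + 1)` is represented by a sequence of arrays. -/
def SArr {K : Type u} [Field K] (p : ℕ) (mem : List K) (h : ℕ) (x : ℕ → ℕ → ℕ)
    (a : ℕ → Nega K p) : Prop := ∀ j < h, SRep p mem (x j) (a j)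

section Twist

variable {K : Type u} [Field K]

theorem SArr.append {p h : ℕ} {mem : List K} {x : ℕ → ℕ → ℕ} {a : ℕ → Nega K p}
    (hx : SArr p mem h x a) (ext : List K) : SArr p (mem ++ ext) h x a :=
  fun j hj => (hx j hj).append ext

theorem spec_sarray {p h t : ℕ} {mem : List K} {f : ℕ → Code (ℕ → ℕ)} {a : ℕ → Nega K p}
    (hf : ∀ j < h, ∀ ext, Spec (f j) (mem ++ ext) t fun r mem' => SRep p mem' r (a j)) :
    Spec (array h f) mem (h * t) fun x mem' => SArr p mem' h x a :=
  spec_array h (Q := fun j r mem' => SRep p mem' r (a j)) hf fun _ _ _ ext h => h.append ext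

theorem spec_twist_add {p e h : ℕ} (he : e ≤ 2 ^ p) {mem : List K} {x : ℕ → ℕ → ℕ}
    {a : ℕ → Nega K p} (hx : SArr p mem (h + h) x a) :
    Spec (twist .add p e h x) mem (h * (2 ^ p * 3)) fun y mem' =>
      SArr p mem' h y fun j => a j + xi K p ^ e * a (j + h) :=
  spec_sarray fun j hj ext =>
    (Spec.bind (spec_shift he ((hx (j + h) (by omega)).append ext)) fun _ ext' ht =>
      spec_add_nega (((hx j (by omega)).append ext).append ext') ht).le (by omega)

theorem spec_twist_sub {p e h : ℕ} (he : e ≤ 2 ^ p) {mem : List K} {x : ℕ → ℕ → ℕ}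
    {a : ℕ → Nega K p} (hx : SArr p mem (h + h) x a) :
    Spec (twist .sub p e h x) mem (h * (2 ^ p * 3)) fun y mem' =>
      SArr p mem' h y fun j => a j - xi K p ^ e * a (j + h) :=
  spec_sarray fun j hj ext =>
    (Spec.bind (spec_shift he ((hx (j + h) (by omega)).append ext)) fun _ ext' ht =>
      spec_sub_nega (((hx j (by omega)).append ext).append ext') ht).le (by omega)

end Twist

/-- The result of a multiplication modulo `Z ^ (2 * h) - w ^ 2`, from the results modulo `Z ^ h - w`
and `Z ^ h + w`, where `w = xi ^ e`. -/
def join (p e h : ℕ) (c₁ c₂ : ℕ → ℕ → ℕ) : Code (ℕ → ℕ → ℕ) := do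
  let lo ← array h fun j => do
    let t ← zip .add (2 ^ p) (c₁ j) (c₂ j)
    half p t
  let hi ← array h fun j => do
    let t ← zip .sub (2 ^ p) (c₂ j) (c₁ j)
    let t ← shift p (2 ^ p - e) t
    half p t
  return fun j => if j < h then lo j else hi (j - h)

theorem spec_join {K : Type u} [Field K] {p e h : ℕ} {mem : List K} {x y : ℕ → ℕ → ℕ}
    {c d : ℕ → Nega K p} (hx : SArr p mem h x c) (hy : SArr p mem h y d) :
    Spec (join p e h x y) mem (8 * (h * 2 ^ p)) fun z mem' =>
      SArr p mem' (h + h) z fun j =>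
        if j < h then algebraMap K (Nega K p) 2⁻¹ * (c j + d j)
        else algebraMap K (Nega K p) 2⁻¹ * (xi K p ^ (2 ^ p - e) * (d (j - h) - c (j - h))) := by
  have hp : 1 ≤ 2 ^ p := Nat.one_le_two_pow
  apply Spec.le
  case h =>
    apply Spec.bind
    · exact (spec_sarray fun j hj e1 => Spec.bind
        (spec_add_nega ((hx j hj).append e1) ((hy j hj).append e1)) fun _ e2 h1 =>
          spec_half h1)
    intro lo e1 hlo
    apply Spec.bind
    · exact (spec_sarray fun j hj e2 => Spec.bind
        (spec_sub_nega (((hy j hj).append e1).append e2) (((hx j hj).append e1).append e2))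
          fun _ e3 h1 => Spec.bind (spec_shift (Nat.sub_le _ e) h1) fun _ e4 h2 => spec_half h2)
    intro hi e2 hhi
    refine Spec.pure 0 fun j hj => ?_
    dsimp only
    split_ifs with hjh
    · exact (hlo j hjh).append e2
    · exact hhi (j - h) (by omega)
  case hT => nlinarith

/-- Multiplication of polynomials over `K[X] / (X ^ 2 ^ p + 1)` modulo `Z ^ 2 ^ s - xi ^ e`. -/
def cyclicMul (mul : (ℕ → ℕ) → (ℕ → ℕ) → Code (ℕ → ℕ)) (p : ℕ) :
    (s e : ℕ) → (ℕ → ℕ → ℕ) → (ℕ → ℕ → ℕ) → Code (ℕ → ℕ → ℕ)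
  | 0, _, x, y => do
    let r ← negaMul mul p (x 0) (y 0)
    return fun _ => r
  | s + 1, e, x, y => do
    let x₁ ← twist .add p (e / 2) (2 ^ s) x
    let y₁ ← twist .add p (e / 2) (2 ^ s) y
    let x₂ ← twist .sub p (e / 2) (2 ^ s) x
    let y₂ ← twist .sub p (e / 2) (2 ^ s) y
    let c₁ ← cyclicMul mul p s (e / 2) x₁ y₁
    let c₂ ← cyclicMul mul p s (e / 2 + 2 ^ p) x₂ y₂
    join p (e / 2) (2 ^ s) c₁ c₂

/-- Chinese remaindering for z² - w² = (z - w)(z + w), with z = Z^(2^s) and w a power of `xi`: the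
interpolant is (C₁ + C₂)/2 + z(C₁ - C₂)/(2w). Here u = 1/2 and 1/w = -w', which explains the order
of `C₂ - C₁`. -/
theorem dvd_of_dvd_twisted {R : Type*} [CommRing R] (A₀ A₁ B₀ B₁ C₁ C₂ z w w' u : R)
    (hw : w * w' = -1) (hu : 2 * u = 1) (h₁ : z - w ∣ (A₀ + w * A₁) * (B₀ + w * B₁) - C₁)
    (h₂ : z + w ∣ (A₀ - w * A₁) * (B₀ - w * B₁) - C₂) :
    z * z - w * w ∣ (A₀ + z * A₁) * (B₀ + z * B₁) -
      (u * (C₁ + C₂) + z * (u * (w' * (C₂ - C₁)))) := by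
  obtain ⟨q₁, h₁⟩ := h₁
  obtain ⟨q₂, h₂⟩ := h₂
  have e₁ : (A₀ + z * A₁) * (B₀ + z * B₁) - C₁ =
      (z - w) * (q₁ + A₁ * (B₀ + z * B₁) + (A₀ + w * A₁) * B₁) := by linear_combination h₁
  have e₂ : (A₀ + z * A₁) * (B₀ + z * B₁) - C₂ =
      (z + w) * (q₂ + A₁ * (B₀ + z * B₁) + (A₀ - w * A₁) * B₁) := by linear_combination h₂
  refine ⟨-(u * w' * (q₁ + A₁ * (B₀ + z * B₁) + (A₀ + w * A₁) * B₁)) +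
    u * w' * (q₂ + A₁ * (B₀ + z * B₁) + (A₀ - w * A₁) * B₁), ?_⟩
  -- The weights u(1 - w'z) = -uw'(z + w) and u(1 + w'z) = uw'(z - w) sum to 2u = 1 and each
  -- supplies the factor that its equation lacks.
  linear_combination (u * (1 - w' * z)) * e₁ + (u * (1 + w' * z)) * e₂ -
    ((A₀ + z * A₁) * (B₀ + z * B₁)) * hu +
    u * ((z - w) * (q₁ + A₁ * (B₀ + z * B₁) + (A₀ + w * A₁) * B₁) +
      (z + w) * (q₂ + A₁ * (B₀ + z * B₁) + (A₀ - w * A₁) * B₁)) * hw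

theorem two_mul_algebraMap_half {K : Type u} [Field K] [CharZero K] (p : ℕ) :
    (2 : Nega K p) * algebraMap K (Nega K p) 2⁻¹ = 1 := by
  rw [← map_ofNat (algebraMap K (Nega K p)) 2, ← map_mul, mul_inv_cancel₀ two_ne_zero, map_one]

/-- Recursion along Z^(2^(s+1)) - xi^e = (Z^(2^s) - xi^(e/2)) (Z^(2^s) + xi^(e/2)), where -xi^(e/2)
= xi^(e/2 + 2^p). The divisibility of e keeps the square roots of all s levels among the powers of
`xi`. With h the half length, a level costs four twists of 3h·2^p and a join of 8h·2^p operations,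
that is 10·2h·2^p, whence the term 10s. -/
theorem spec_cyclicMul {mul : (ℕ → ℕ) → (ℕ → ℕ) → Code (ℕ → ℕ)} {p T : ℕ}
    (hmul : Multiplies.{u} p T mul) {K : Type u} [Field K] [CharZero K] (s : ℕ) :
    ∀ (e : ℕ) (mem : List K) (x y : ℕ → ℕ → ℕ) (a b : ℕ → Nega K p),
    s ≤ p + 1 → 2 ^ s ∣ e → e < 2 ^ (p + 1) →
    SArr p mem (2 ^ s) x a → SArr p mem (2 ^ s) y b →
    Spec (cyclicMul mul p s e x y) mem (2 ^ s * (T + 2 ^ p + 10 * s * 2 ^ p)) fun z mem' =>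
      ∃ c : ℕ → Nega K p, SArr p mem' (2 ^ s) z c ∧
        (X ^ 2 ^ s - C (xi K p ^ e)) ∣ pol (2 ^ s) a * pol (2 ^ s) b - pol (2 ^ s) c := by
  induction s with
  | zero =>
    intro e mem x y a b _ _ _ hx hy
    apply Spec.le
    case h =>
      apply Spec.bind
      · exact spec_negaMul hmul (hx 0 (by simp)) (hy 0 (by simp))
      intro r ext hr
      exact Spec.pure 0 ⟨fun _ => a 0 * b 0, fun _ _ => hr, by simp [pol]⟩
    case hT => simp
  | succ s ih =>
    intro e mem x y a b hs he hep hx hy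
    have h2 : 2 ^ (s + 1) = 2 ^ s + 2 ^ s := by ring
    have h2p : 2 ^ (p + 1) = 2 ^ p + 2 ^ p := by ring
    rw [h2] at hx hy
    obtain ⟨f, rfl⟩ := he
    have hf : 2 ^ (s + 1) * f / 2 = 2 ^ s * f := by
      rw [pow_succ, mul_assoc, mul_comm 2 f, ← mul_assoc, Nat.mul_div_cancel _ two_pos]
    have hsp : 2 ^ s ∣ 2 ^ p := pow_dvd_pow 2 (by omega)
    have hff : 2 ^ (s + 1) * f = 2 ^ s * f + 2 ^ s * f := by rw [h2]; ring
    have hep' : 2 ^ s * f < 2 ^ p := by omega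
    unfold cyclicMul
    rw [hf]
    apply Spec.le
    case h =>
      apply Spec.bind
      · exact spec_twist_add hep'.le hx
      intro x₁ e1 hx1
      apply Spec.bind
      · exact spec_twist_add hep'.le (hy.append e1)
      intro y₁ e2 hy1
      apply Spec.bind
      · exact spec_twist_sub hep'.le ((hx.append e1).append e2)
      intro x₂ e3 hx2
      apply Spec.bind
      · exact spec_twist_sub hep'.le (((hy.append e1).append e2).append e3)
      intro y₂ e4 hy2
      apply Spec.bind
      · exact (ih (2 ^ s * f) _ x₁ y₁ _ _ (by omega) (Dvd.intro _ rfl) (by omega)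
          (((hx1.append e2).append e3).append e4) ((hy1.append e3).append e4))
      intro c₁ e5 hc1
      apply Spec.bind
      · exact (ih (2 ^ s * f + 2 ^ p) _ x₂ y₂ _ _ (by omega)
          (Dvd.dvd.add (Dvd.intro _ rfl) hsp) (by omega)
          ((hx2.append e4).append e5) (hy2.append e5))
      intro c₂ e6 hc2
      obtain ⟨c, hc, hdc⟩ := hc1
      obtain ⟨d, hd, hdd⟩ := hc2
      refine (spec_join (e := 2 ^ s * f) (hc.append e6) hd).mono le_rfl fun z e7 hz =>
        ⟨_, h2 ▸ hz, ?_⟩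
      have hw : xi K p ^ (2 ^ s * f) * xi K p ^ (2 ^ p - 2 ^ s * f) = -1 := by
        rw [← pow_add, Nat.add_sub_cancel' hep'.le, xi_pow]
      have hw' : C (xi K p ^ (2 ^ s * f)) * C (xi K p ^ (2 ^ p - 2 ^ s * f)) = -1 := by
        rw [← C_mul, hw, C_neg, C_1]
      have hu : 2 * C (algebraMap K (Nega K p) 2⁻¹) = 1 := by
        rw [← C_ofNat, ← C_mul, two_mul_algebraMap_half, C_1]
      rw [pow_add, xi_pow, mul_neg_one, C_neg, sub_neg_eq_add] at hdd
      rw [pol_add, pol_add, pol_const_mul, pol_const_mul] at hdc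
      rw [pol_sub, pol_sub, pol_const_mul, pol_const_mul] at hdd
      have key := dvd_of_dvd_twisted _ _ _ _ _ _ _ _ _ _ hw' hu hdc hdd
      have hlo : (pol (2 ^ s) fun j => if j < 2 ^ s then
          algebraMap K (Nega K p) 2⁻¹ * (c j + d j) else
          algebraMap K (Nega K p) 2⁻¹ * (xi K p ^ (2 ^ p - 2 ^ s * f) *
            (d (j - 2 ^ s) - c (j - 2 ^ s)))) =
          C (algebraMap K (Nega K p) 2⁻¹) * (pol (2 ^ s) c + pol (2 ^ s) d) := by
        rw [← pol_add, ← pol_const_mul]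
        exact pol_congr fun j hj => if_pos hj
      have hhi : (pol (2 ^ s) fun j => if j + 2 ^ s < 2 ^ s then
          algebraMap K (Nega K p) 2⁻¹ * (c (j + 2 ^ s) + d (j + 2 ^ s)) else
          algebraMap K (Nega K p) 2⁻¹ * (xi K p ^ (2 ^ p - 2 ^ s * f) *
            (d (j + 2 ^ s - 2 ^ s) - c (j + 2 ^ s - 2 ^ s)))) =
          C (algebraMap K (Nega K p) 2⁻¹) * (C (xi K p ^ (2 ^ p - 2 ^ s * f)) *
            (pol (2 ^ s) d - pol (2 ^ s) c)) := by
        rw [← pol_sub, ← pol_const_mul, ← pol_const_mul]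
        exact pol_congr fun j hj => by simp
      rw [hff, h2, pol_add_length, pol_add_length, pol_add_length, hlo, hhi, pow_add, pow_add, C_mul]
      exact key
    case hT =>
      rw [h2]
      nlinarith [Nat.zero_le (2 ^ s * 2 ^ p)]

end Code

end AZ

/-! ### The recursion of fast multiplication: cutting into pieces and evaluating back -/

namespace AZ

theorem coeff_mul_eq_sum_range {R : Type*} [CommRing R] {a : R[X]} {N : ℕ} (ha : a.degree < (N : ℕ))
    (b : R[X]) (l : ℕ) : (a * b).coeff l =
      ∑ i ∈ Finset.range N, if i ≤ l then a.coeff i * b.coeff (l - i) else 0 := by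
  rw [coeff_mul, Finset.Nat.sum_antidiagonal_eq_sum_range_succ (fun i j => a.coeff i * b.coeff j)]
  have h1 : ∑ i ∈ Finset.range (l + 1), a.coeff i * b.coeff (l - i) =
      ∑ i ∈ Finset.range (l + 1 + N), if i ≤ l then a.coeff i * b.coeff (l - i) else 0 := by
    rw [Finset.sum_range_add _ (l + 1) N]
    rw [Finset.sum_eq_zero (s := Finset.range N) fun i _ => if_neg (by omega), add_zero]
    exact Finset.sum_congr rfl fun i hi => (if_pos (by rw [Finset.mem_range] at hi; omega)).symm
  rw [h1, add_comm (l + 1) N, Finset.sum_range_add _ N (l + 1), add_eq_left]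
  refine Finset.sum_eq_zero fun i _ => ?_
  rw [(degree_lt_iff_coeff_zero _ _).mp ha (N + i) (by omega)]
  simp

/-- The coefficients of the value at `X ^ m` of a polynomial with coefficients of degree less than
`2 * m`. -/
theorem coeff_eval_X_pow {R : Type*} [CommRing R] {m N : ℕ} (hm : 0 < m) (D : R[X][X])
    (hD : D.degree < (N : ℕ)) (hc : ∀ j, (D.coeff j).degree < ((m + m : ℕ) : WithBot ℕ)) (l : ℕ) :
    (D.eval (X ^ m)).coeff l = (D.coeff (l / m)).coeff (l % m) +
      if l < m then 0 else (D.coeff (l / m - 1)).coeff (l % m + m) := by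
  have hl := Nat.div_add_mod l m
  have hlm := Nat.mod_lt l hm
  set t := l / m with ht
  set e := l % m with he
  have hz : ∀ j i, m + m ≤ i → (D.coeff j).coeff i = 0 := fun j i hi =>
    (degree_lt_iff_coeff_zero _ _).mp (hc j) i hi
  have hN : D.natDegree < N + t + 1 := by
    rcases eq_or_ne D 0 with h | h
    · simp [h]
    · rw [degree_eq_natDegree h] at hD
      norm_cast at hD
      exact hD.trans_le (by rw [add_assoc]; exact Nat.le_add_right _ _)
  rw [eval_eq_sum_range' hN, finsetSum_coeff]
  simp only [← pow_mul, coeff_mul_X_pow']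
  -- Only the coefficients of index l/m and l/m - 1 contribute to X^l: later ones start above l, and
  -- earlier ones, being shorter than 2m, end below it.
  have hzero : ∀ c, c ≠ t → c + 1 ≠ t →
      (if m * c ≤ l then (D.coeff c).coeff (l - m * c) else 0) = 0 := by
    intro c h1 h2
    split_ifs with h
    · apply hz
      have h3 : c < t + 1 := by
        by_contra h4
        have := Nat.mul_le_mul_left m (not_lt.mp h4)
        rw [mul_add] at this
        omega
      have h4 : c + 2 ≤ t := by omega
      have := Nat.mul_le_mul_left m h4
      rw [mul_add] at this
      omega
    · rfl
  split_ifs with h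
  · have ht0 : t = 0 := by rw [ht]; exact Nat.div_eq_of_lt h
    rw [Finset.sum_eq_single t]
    · rw [if_pos (by omega), add_zero]
      congr 1
      omega
    · exact fun c _ hc => hzero c hc (by omega)
    · intro hn
      exact absurd (Finset.mem_range.mpr (by omega)) hn
  · obtain ⟨t', ht'⟩ : ∃ t', t = t' + 1 := by
      refine Nat.exists_eq_succ_of_ne_zero fun h0 => ?_
      rw [h0] at hl
      omega
    have hmt : m * t = m * t' + m := by rw [ht']; ring
    rw [Finset.sum_eq_add_of_mem t t' (Finset.mem_range.mpr (by omega)) (Finset.mem_range.mpr (by omega)) (by omega)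
      fun c _ hc => hzero c hc.1 (by omega), if_pos (by omega), if_pos (by omega)]
    congr 2
    · omega
    · rw [ht']; rfl
    · omega

namespace Code

/-- Schoolbook multiplication. -/
def schoolMul (k : ℕ) (r s : ℕ → ℕ) : Code (ℕ → ℕ) :=
  array (2 ^ (k + 1)) fun l => sum (2 ^ k) fun i =>
    if i ≤ l ∧ l - i < 2 ^ k then op .mul (r i) (s (l - i)) else const 0

theorem multiplies_schoolMul (k : ℕ) :
    Multiplies.{u} k (2 ^ (k + 1) * (2 ^ k * 2 + 1)) (schoolMul k) := by
  intro K _ _ mem r s a b ha hb hr hs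
  refine spec_arr fun l _ ext => ?_
  rw [coeff_mul_eq_sum_range ha]
  refine spec_sum fun i hi ext' => ?_
  by_cases hil : i ≤ l
  · by_cases h : l - i < 2 ^ k
    · rw [if_pos ⟨hil, h⟩, if_pos hil]
      exact spec_op .mul (((hr i hi).append ext).append ext') (((hs _ h).append ext).append ext')
    · rw [if_neg (by tauto), if_pos hil, (degree_lt_iff_coeff_zero _ _).mp hb _ (not_lt.mp h),
        mul_zero]
      simpa using spec_const (mem ++ ext ++ ext') 0
  · rw [if_neg (by tauto), if_neg hil]
    simpa using spec_const (mem ++ ext ++ ext') 0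

/-- Cut an array into `h` pieces of length `m`; the position `z` holds zero. -/
def split (m h z : ℕ) (r : ℕ → ℕ) (j i : ℕ) : ℕ := if j < h ∧ i < m then r (j * m + i) else z

/-- Multiplication of polynomials of degree less than `2 ^ (p + s)` via cyclic multiplication over
`K[X] / (X ^ 2 ^ (p + 1) + 1)`. -/
def recMul (mul : (ℕ → ℕ) → (ℕ → ℕ) → Code (ℕ → ℕ)) (p s : ℕ) (x y : ℕ → ℕ) : Code (ℕ → ℕ) := do
  let z ← const 0
  let c ← cyclicMul mul (p + 1) (s + 1) 0 (split (2 ^ p) (2 ^ s) z x) (split (2 ^ p) (2 ^ s) z y)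
  array (2 ^ (p + s + 1)) fun l =>
    -- There is no preceding piece here, and the truncated index l / 2^p - 1 = 0 would wrongly add
    -- the upper half of piece 0.
    if l < 2 ^ p then pure (c (l / 2 ^ p) (l % 2 ^ p))
    else op .add (c (l / 2 ^ p) (l % 2 ^ p)) (c (l / 2 ^ p - 1) (l % 2 ^ p + 2 ^ p))

/-- The polynomial in two variables that belongs to the pieces of length `m` of a polynomial. -/
noncomputable def pieces {K : Type u} [Field K] (m h : ℕ) (a : K[X]) : K[X][X] :=
  pol h fun j => pol m fun i => a.coeff (j * m + i)

section Pieces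

variable {K : Type u} [Field K]

theorem eval_pieces {m h : ℕ} {a : K[X]} (ha : a.degree < ((h * m : ℕ) : WithBot ℕ)) :
    (pieces m h a).eval (X ^ m) = a := by
  have : ∀ h, (pieces m h a).eval (X ^ m) = pol (h * m) a.coeff := by
    intro h
    induction h with
    | zero => simp [pieces, pol]
    | succ h ih =>
      rw [Nat.succ_mul, pol_add_length, ← ih, pieces, pieces, pol, Finset.sum_range_succ, ← pol]
      simp only [eval_add, eval_mul, eval_C, eval_pow, eval_X, ← pow_mul, mul_comm m h]
      rw [mul_comm (pol m _)]
      simp only [add_comm]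
  rw [this, pol_coeff_self ha]

theorem degree_coeff_pieces_lt (m h : ℕ) (a : K[X]) (j : ℕ) :
    ((pieces m h a).coeff j).degree < (m : ℕ) := by
  rw [pieces, pol_coeff]
  split_ifs
  · exact degree_pol_lt _ _
  · rw [degree_zero]; exact WithBot.bot_lt_coe _

theorem degree_coeff_mul_pieces_lt (m h : ℕ) (a b : K[X]) (j : ℕ) :
    ((pieces m h a * pieces m h b).coeff j).degree < ((m + m : ℕ) : WithBot ℕ) := by
  rw [coeff_mul, ← mem_degreeLT]
  refine Submodule.sum_mem _ fun i _ => ?_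
  rw [mem_degreeLT]
  exact degree_mul_lt_of_lt (degree_coeff_pieces_lt _ _ _ _) (degree_coeff_pieces_lt _ _ _ _)

theorem sArr_split {p s : ℕ} {mem : List K} {x : ℕ → ℕ} {z : ℕ} {a : K[X]}
    (hx : Arr mem (2 ^ (p + s)) x a.coeff) (hz : Has mem z 0) :
    SArr (p + 1) mem (2 ^ (s + 1)) (split (2 ^ p) (2 ^ s) z x)
      fun j => AdjoinRoot.mk _ ((pieces (2 ^ p) (2 ^ s) a).coeff j) := by
  intro j hj
  refine ⟨fun i => ((pieces (2 ^ p) (2 ^ s) a).coeff j).coeff i, fun i hi => ?_, ?_⟩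
  · rw [pieces, pol_coeff, split]
    dsimp only
    by_cases hj : j < 2 ^ s
    · rw [if_pos hj, pol_coeff]
      by_cases hi : i < 2 ^ p
      · rw [if_pos ⟨hj, hi⟩, if_pos hi]
        refine hx _ ?_
        calc j * 2 ^ p + i < (j + 1) * 2 ^ p := by rw [Nat.succ_mul]; omega
          _ ≤ 2 ^ s * 2 ^ p := Nat.mul_le_mul_right _ hj
          _ = 2 ^ (p + s) := by rw [← pow_add, add_comm]
      · rw [if_neg (by tauto), if_neg hi]
        exact hz
    · rw [if_neg (by tauto), if_neg hj]
      simpa using hz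
  · rw [pol_coeff_self]
    refine (degree_coeff_pieces_lt _ _ _ _).trans ?_
    exact_mod_cast Nat.pow_lt_pow_right (by norm_num) (Nat.lt_succ_self p)

instance (p : ℕ) : Nontrivial (Nega K p) :=
  AdjoinRoot.nontrivial _ (by
    rw [show (X ^ 2 ^ p + 1 : K[X]) = X ^ 2 ^ p + C 1 by simp, degree_X_pow_add_C (by positivity)]
    simp)

theorem eq_of_mk_eq {p : ℕ} {a b : K[X]} (ha : a.degree < (2 ^ p : ℕ)) (hb : b.degree < (2 ^ p : ℕ))
    (h : AdjoinRoot.mk (X ^ 2 ^ p + 1 : K[X]) a = AdjoinRoot.mk _ b) : a = b := by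
  rw [AdjoinRoot.mk_eq_mk] at h
  by_contra hne
  refine Monic.not_dvd_of_degree_lt ?_ (sub_ne_zero.mpr hne) ?_ h
  · simpa using monic_X_pow_add_C (1 : K) (n := 2 ^ p) (by positivity)
  · rw [show (X ^ 2 ^ p + 1 : K[X]) = X ^ 2 ^ p + C 1 by simp, degree_X_pow_add_C (by positivity)]
    exact (degree_sub_le _ _).trans_lt (max_lt ha hb)

end Pieces

/-- Neither reduction loses information: the product of the pieces has degree less than 2^(s+1) in
Z, and its coefficients have degree less than 2^(p+1) in X, so it can be read off modulo Z^(2^(s+1))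
- 1 and X^(2^(p+1)) + 1. The root of unity X has order dividing 2^(p+2), which allows s + 1 halvings
as long as s ≤ p + 1. -/
theorem multiplies_recMul {mul : (ℕ → ℕ) → (ℕ → ℕ) → Code (ℕ → ℕ)} {p s T : ℕ} (hs : s ≤ p + 1)
    (hmul : Multiplies.{u} (p + 1) T mul) :
    Multiplies.{u} (p + s)
      (2 ^ (s + 1) * (T + 2 ^ (p + 1) + 10 * (s + 1) * 2 ^ (p + 1)) + 2 ^ (p + s + 1) + 1)
      (recMul mul p s) := by
  intro K _ _ mem x y a b ha hb hx hy
  have hhm : 2 ^ s * 2 ^ p = 2 ^ (p + s) := by rw [← pow_add, add_comm]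
  have h2p : 2 ^ (p + 1) = 2 ^ p + 2 ^ p := by ring
  have h2s : 2 ^ (s + 1) = 2 ^ s + 2 ^ s := by ring
  have hs0 : 0 < 2 ^ s := by positivity
  set A := pieces (2 ^ p) (2 ^ s) a with hA
  set B := pieces (2 ^ p) (2 ^ s) b with hB
  have hAB : (A * B).degree < (2 ^ (s + 1) : ℕ) := by
    rw [h2s]
    exact degree_mul_lt_of_lt (degree_pol_lt _ _) (degree_pol_lt _ _)
  have hABc : ∀ j, ((A * B).coeff j).degree < (2 ^ (p + 1) : ℕ) := by
    rw [h2p]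
    exact degree_coeff_mul_pieces_lt _ _ _ _
  apply Spec.le
  case h =>
    apply Spec.bind
    · exact spec_const _ 0
    intro z e1 hz
    rw [Int.cast_zero] at hz
    apply Spec.bind
    · exact spec_cyclicMul hmul (s + 1) 0 _ _ _ _ _ (by omega) (dvd_zero _) (by positivity)
        (sArr_split (hx.append e1) hz) (sArr_split (hy.append e1) hz)
    rintro c e2 ⟨v, hv, hdvd⟩
    refine spec_arr (t := 1) fun l hl e3 => ?_
    have hc : ∀ j < 2 ^ (s + 1), Arr (mem ++ e1 ++ e2) (2 ^ (p + 1)) (c j)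
        ((A * B).coeff j).coeff := by
      have hAd : A.degree < (2 ^ (s + 1) : ℕ) :=
        (degree_pol_lt _ _).trans (by exact_mod_cast (by omega))
      have hBd : B.degree < (2 ^ (s + 1) : ℕ) :=
        (degree_pol_lt _ _).trans (by exact_mod_cast (by omega))
      rw [← pol_map, ← pol_map, pol_coeff_self hAd, pol_coeff_self hBd, ← Polynomial.map_mul,
        pow_zero] at hdvd
      have heq : (A * B).map (AdjoinRoot.mk _) = pol (2 ^ (s + 1)) v := by
        by_contra hne
        refine Monic.not_dvd_of_degree_lt (monic_X_pow_sub_C 1 (by positivity))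
          (sub_ne_zero.mpr hne) ?_ hdvd
        rw [degree_X_pow_sub_C (by positivity)]
        exact (degree_sub_le _ _).trans_lt
          (max_lt (degree_map_le.trans_lt hAB) (degree_pol_lt _ _))
      intro j hj
      obtain ⟨w, hw, hwv⟩ := hv j hj
      have h1 := congrArg (fun q => q.coeff j) heq
      simp only [coeff_map, pol_coeff, if_pos hj] at h1
      have h2 := eq_of_mk_eq (degree_pol_lt _ _) (hABc j) (hwv.trans h1.symm)
      intro i hi
      rw [← h2, pol_coeff, if_pos hi]
      exact hw i hi
    have hab : (A * B).eval (X ^ 2 ^ p) = a * b := by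
      rw [eval_mul, eval_pieces (by rwa [hhm]), eval_pieces (by rwa [hhm])]
    have hpos : 0 < 2 ^ p := by positivity
    rw [← hab, coeff_eval_X_pow hpos _ hAB (by rw [← h2p]; exact hABc)]
    have hlj : l / 2 ^ p < 2 ^ (s + 1) := by
      rw [Nat.div_lt_iff_lt_mul hpos, ← pow_add]
      rwa [show s + 1 + p = p + s + 1 by omega]
    have hlm := Nat.mod_lt l hpos
    have hlow := hc _ hlj (l % 2 ^ p) (by omega)
    split_ifs with h
    · rw [add_zero]
      exact Spec.pure _ (hlow.append e3)
    · exact spec_op .add (hlow.append e3) ((hc _ (by omega) _ (by omega)).append e3)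
  case hT =>
    omega

end Code

end AZ

/-! ### The cost of fast multiplication -/

namespace AZ

namespace Code

theorem Multiplies.le {k T T' : ℕ} {mul : (ℕ → ℕ) → (ℕ → ℕ) → Code (ℕ → ℕ)}
    (h : Multiplies.{u} k T mul) (hT : T ≤ T') : Multiplies.{u} k T' mul :=
  fun K _ _ mem r s a b ha hb hr hs => (h K mem r s a b ha hb hr hs).le hT

/-- The recursion replaces 2^k by 2^(s+1)·2^(p+1) = 4·2^k while the logarithm is roughly halved. For
k ≥ 11 one has (2(p+2))² ≤ 2(k+1)², hence 8(p+2)⁶ ≤ (k+1)⁶: the sixth power absorbs the factor 4 and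
leaves half of the budget for the terms of lower order. -/
theorem recMul_cost_le {A k p s : ℕ} (hA : 400 ≤ A) (hk : 11 ≤ k) (hps : p + s = k)
    (hp : 2 * p ≤ k + 1) :
    2 ^ (s + 1) * (A * 2 ^ (p + 1) * (p + 1 + 1) ^ 6 + 2 ^ (p + 1) +
      10 * (s + 1) * 2 ^ (p + 1)) + 2 ^ (p + s + 1) + 1 ≤ A * 2 ^ k * (k + 1) ^ 6 := by
  have h2 : 2 ^ (s + 1) * 2 ^ (p + 1) = 4 * 2 ^ k := by
    rw [← hps, pow_succ, pow_succ, pow_add]; ring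
  have h1 : 1 ≤ 2 ^ k := Nat.one_le_two_pow
  have hv : (2 * (p + 2)) ^ 2 ≤ 2 * (k + 1) ^ 2 := by
    calc (2 * (p + 2)) ^ 2 ≤ (k + 5) ^ 2 := Nat.pow_le_pow_left (by omega) _
      _ ≤ 2 * (k + 1) ^ 2 := by nlinarith
  have hv3 : 4 * (p + 2) ^ 6 * 2 ≤ (k + 1) ^ 6 := by
    have := Nat.pow_le_pow_left hv 3
    have e1 : ((2 * (p + 2)) ^ 2) ^ 3 = 64 * (p + 2) ^ 6 := by ring
    have e2 : (2 * (k + 1) ^ 2) ^ 3 = 8 * (k + 1) ^ 6 := by ring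
    rw [e1, e2] at this
    omega
  have hk6 : 20 * k + 50 ≤ 100 * (k + 1) ^ 6 := by
    have : k + 1 ≤ (k + 1) ^ 6 := Nat.le_self_pow (by norm_num) _
    omega
  calc _ = 2 ^ (s + 1) * 2 ^ (p + 1) * (A * (p + 2) ^ 6 + 1 + 10 * (s + 1)) +
        2 * 2 ^ k + 1 := by rw [hps]; ring
    _ ≤ 2 ^ k * (A * (4 * (p + 2) ^ 6) + (20 * k + 50) * 1) + 2 ^ k * (20 * k + 50) := by
        rw [h2]; nlinarith
    _ ≤ 2 ^ k * (A * (4 * (p + 2) ^ 6) + 100 * (k + 1) ^ 6) + 2 ^ k * (100 * (k + 1) ^ 6) := by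
        rw [mul_one]
        gcongr
    _ = 2 ^ k * (A * (4 * (p + 2) ^ 6) + 200 * (k + 1) ^ 6) := by ring
    _ ≤ 2 ^ k * (A * (k + 1) ^ 6) := by
        have e1 := Nat.mul_le_mul_left A hv3
        have e2 := Nat.mul_le_mul_right ((k + 1) ^ 6) hA
        refine Nat.mul_le_mul_left _ ?_
        linarith
    _ = _ := by ring

/-- Schoolbook multiplication serves as long as k ≤ 10, where its cost per 2^k is at most 2(2·2^10 +
1) = 4098 < 5000; beyond that the recursion goes from k to (k+1)/2 + 1. -/
theorem exists_multiplies (k : ℕ) : ∃ mul : (ℕ → ℕ) → (ℕ → ℕ) → Code (ℕ → ℕ),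
    Multiplies.{u} k (5000 * 2 ^ k * (k + 1) ^ 6) mul := by
  induction k using Nat.strong_induction_on with
  | _ k ih =>
    rcases lt_or_ge k 11 with hk | hk
    · refine ⟨schoolMul k, (multiplies_schoolMul k).le ?_⟩
      have h1 : 2 ^ k ≤ 2 ^ 10 := Nat.pow_le_pow_right two_pos (by omega)
      have h2 : 1 ≤ (k + 1) ^ 6 := Nat.one_le_pow _ _ (by omega)
      calc 2 ^ (k + 1) * (2 ^ k * 2 + 1) = 2 ^ k * (2 * (2 ^ k * 2 + 1)) := by ring
        _ ≤ 2 ^ k * 5000 := Nat.mul_le_mul_left _ (by omega)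
        _ = 5000 * 2 ^ k * 1 := by ring
        _ ≤ _ := Nat.mul_le_mul_left _ h2
    · obtain ⟨mul, hmul⟩ := ih ((k + 1) / 2 + 1) (by omega)
      have hps : (k + 1) / 2 + k / 2 = k := by omega
      have h := multiplies_recMul (p := (k + 1) / 2) (s := k / 2) (by omega) hmul
      refine ⟨recMul mul ((k + 1) / 2) (k / 2), ?_⟩
      have h' := h.le (recMul_cost_le (by norm_num) hk hps (by omega))
      rwa [hps] at h'

end Code

end AZ

namespace AZ

/-! ## Division steps -/

section DivSteps

variable {K : Type u} [Field K]

open Classical in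
/-- One division step on a triple `(δ, f, g)`. -/
noncomputable def divStep (s : ℤ × K[X] × K[X]) : ℤ × K[X] × K[X] :=
  if 0 < s.1 ∧ s.2.2.coeff 0 ≠ 0 then
    (1 - s.1, s.2.2, (C (s.2.2.coeff 0) * s.2.1 - C (s.2.1.coeff 0) * s.2.2).divX)
  else
    (1 + s.1, s.2.1, (C (s.2.1.coeff 0) * s.2.2 - C (s.2.2.coeff 0) * s.2.1).divX)

open Classical in
/-- `X` times the transition matrix of a division step. -/
noncomputable def stepMatrix (s : ℤ × K[X] × K[X]) : Matrix (Fin 2) (Fin 2) K[X] :=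
  if 0 < s.1 ∧ s.2.2.coeff 0 ≠ 0 then
    !![0, X; C (s.2.2.coeff 0), C (-s.2.1.coeff 0)]
  else
    !![X, 0; C (-s.2.2.coeff 0), C (s.2.1.coeff 0)]

/-- `X ^ n` times the transition matrix of `n` division steps. -/
noncomputable def transition : ℕ → ℤ × K[X] × K[X] → Matrix (Fin 2) (Fin 2) K[X]
  | 0, _ => 1
  | n + 1, s => transition n (divStep s) * stepMatrix s

theorem transition_add (m n : ℕ) (s : ℤ × K[X] × K[X]) :
    transition (m + n) s = transition n (divStep^[m] s) * transition m s := by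
  induction m generalizing s with
  | zero => simp [transition]
  | succ m ih =>
    rw [Nat.succ_add, transition, ih, transition, Function.iterate_succ_apply, Matrix.mul_assoc]

theorem X_mul_divX_of_coeff_zero {p : K[X]} (h : p.coeff 0 = 0) : X * p.divX = p := by
  have := X_mul_divX_add p
  rwa [h, C_0, add_zero] at this

theorem stepMatrix_mulVec (s : ℤ × K[X] × K[X]) :
    (stepMatrix s).mulVec ![s.2.1, s.2.2] =
      (X : K[X]) • ![(divStep s).2.1, (divStep s).2.2] := by
  unfold stepMatrix divStep
  split_ifs with h
  · have := X_mul_divX_of_coeff_zero (K := K)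
      (p := C (s.2.2.coeff 0) * s.2.1 - C (s.2.1.coeff 0) * s.2.2) (by simp; ring)
    ext i : 1
    fin_cases i
    · simp [Matrix.mulVec, dotProduct, Fin.sum_univ_two]
    · simp only [Matrix.mulVec, dotProduct, Fin.sum_univ_two]
      simp [this]
      ring
  · have := X_mul_divX_of_coeff_zero (K := K)
      (p := C (s.2.1.coeff 0) * s.2.2 - C (s.2.2.coeff 0) * s.2.1) (by simp; ring)
    ext i : 1
    fin_cases i
    · simp [Matrix.mulVec, dotProduct, Fin.sum_univ_two]
    · simp only [Matrix.mulVec, dotProduct, Fin.sum_univ_two]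
      simp [this]
      ring

theorem transition_mulVec (n : ℕ) (s : ℤ × K[X] × K[X]) :
    (transition n s).mulVec ![s.2.1, s.2.2] =
      (X ^ n : K[X]) • ![(divStep^[n] s).2.1, (divStep^[n] s).2.2] := by
  induction n generalizing s with
  | zero => simp [transition]
  | succ n ih =>
    rw [transition, ← Matrix.mulVec_mulVec, stepMatrix_mulVec, Matrix.mulVec_smul, ih,
      Function.iterate_succ_apply, smul_smul, pow_succ']

theorem natDegree_stepMatrix_le (s : ℤ × K[X] × K[X]) (i j : Fin 2) :
    (stepMatrix s i j).natDegree ≤ 1 := by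
  unfold stepMatrix
  split_ifs <;> fin_cases i <;> fin_cases j <;> simp

theorem natDegree_transition_le (n : ℕ) (s : ℤ × K[X] × K[X]) (i j : Fin 2) :
    (transition n s i j).natDegree ≤ n := by
  induction n generalizing s i j with
  | zero => fin_cases i <;> fin_cases j <;> simp [transition]
  | succ n ih =>
    rw [transition, Matrix.mul_apply]
    refine natDegree_sum_le_of_forall_le _ _ fun k _ => natDegree_mul_le.trans ?_
    exact Nat.add_le_add (ih _ _ _) (natDegree_stepMatrix_le _ _ _)

theorem divStep_coeff_zero {s : ℤ × K[X] × K[X]} (h : s.2.1.coeff 0 ≠ 0) :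
    (divStep s).2.1.coeff 0 ≠ 0 := by
  unfold divStep
  split_ifs with h'
  · exact h'.2
  · exact h

theorem iterate_divStep_coeff_zero {s : ℤ × K[X] × K[X]} (h : s.2.1.coeff 0 ≠ 0) (n : ℕ) :
    (divStep^[n] s).2.1.coeff 0 ≠ 0 := by
  induction n generalizing s with
  | zero => exact h
  | succ n ih => exact ih (divStep_coeff_zero h)

theorem det_stepMatrix {s : ℤ × K[X] × K[X]} (h : s.2.1.coeff 0 ≠ 0) :
    ∃ c : K, c ≠ 0 ∧ (stepMatrix s).det = C c * X := by
  unfold stepMatrix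
  split_ifs with h'
  · exact ⟨-s.2.2.coeff 0, neg_ne_zero.mpr h'.2, by simp [Matrix.det_fin_two]⟩
  · exact ⟨s.2.1.coeff 0, h, by simp [Matrix.det_fin_two]⟩

/-- Each step contributes a unit times X, since the constant coefficient of f stays nonzero. So the
entries of a row of the transition matrix can only share powers of X. -/
theorem det_transition {s : ℤ × K[X] × K[X]} (h : s.2.1.coeff 0 ≠ 0) (n : ℕ) :
    ∃ c : K, c ≠ 0 ∧ (transition n s).det = C c * X ^ n := by
  induction n generalizing s with
  | zero => exact ⟨1, one_ne_zero, by simp [transition]⟩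
  | succ n ih =>
    obtain ⟨c, hc, hdet⟩ := ih (divStep_coeff_zero h)
    obtain ⟨c', hc', hdet'⟩ := det_stepMatrix h
    refine ⟨c * c', mul_ne_zero hc hc', ?_⟩
    rw [transition, Matrix.det_mul, hdet, hdet', C_mul]
    ring

/-- The degrees of `f` and of `g` are at most `(m + δ) / 2` and `(m - δ) / 2`. -/
def DegreesLE (m : ℤ) (s : ℤ × K[X] × K[X]) : Prop :=
  (∀ i : ℕ, m + s.1 < 2 * i → s.2.1.coeff i = 0) ∧ ∀ i : ℕ, m - s.1 < 2 * i → s.2.2.coeff i = 0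

/-- An exchange replaces δ by 1 - δ, which turns the bound for g into the one for f; in either case
the division by X lowers the bound for the new g. The quantity m thus decreases by one per step,
whatever the branch. -/
theorem DegreesLE.divStep {m : ℤ} {s : ℤ × K[X] × K[X]} (h : DegreesLE m s) :
    DegreesLE (m - 1) (divStep s) := by
  obtain ⟨hf, hg⟩ := h
  unfold AZ.divStep
  split_ifs with h'
  · refine ⟨fun i hi => hg i (by simp at hi; omega), fun i hi => ?_⟩
    simp only at hi
    simp only [coeff_divX, coeff_sub, coeff_C_mul]
    rw [hf (i + 1) (by push_cast; omega), hg (i + 1) (by push_cast; omega)]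
    simp
  · refine ⟨fun i hi => hf i (by simp at hi; omega), fun i hi => ?_⟩
    simp only at hi
    simp only [coeff_divX, coeff_sub, coeff_C_mul]
    rw [hg (i + 1) (by push_cast; omega)]
    -- Without an exchange, either g(0) = 0, so that f does not enter the new g, or δ ≤ 0, so that
    -- the bound for f is not above that for g.
    by_cases hd : 0 < s.1
    · rw [show s.2.2.coeff 0 = 0 by by_contra h0; exact h' ⟨hd, h0⟩]
      simp
    · rw [hf (i + 1) (by push_cast; omega)]
      simp

theorem DegreesLE.iterate {m : ℤ} {s : ℤ × K[X] × K[X]} (h : DegreesLE m s) (n : ℕ) :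
    DegreesLE (m - n) (AZ.divStep^[n] s) := by
  induction n generalizing s m with
  | zero => simpa using h
  | succ n ih =>
    have := ih h.divStep
    rw [Function.iterate_succ_apply]
    push_cast
    rwa [show m - (n + 1 : ℤ) = m - 1 - n by ring]

/-- Initially m = 2N - 1, so m = -1 after 2N steps. As f(0) ≠ 0 persists, m + δ ≥ 0 and hence δ > 0;
then m - δ < 0, and the bound on g admits no coefficient at all. -/
theorem iterate_divStep_eq_zero {N : ℕ} {f g : K[X]} (hf : f.degree < (N : ℕ))
    (hg : g.degree < (N : ℕ)) (h0 : f.coeff 0 ≠ 0) :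
    (divStep^[2 * N] (1, f, g)).2.2 = 0 := by
  have hd : DegreesLE (2 * N - 1 : ℤ) (1, f, g) :=
    ⟨fun i hi => (degree_lt_iff_coeff_zero _ _).mp hf i (by simp at hi; omega),
      fun i hi => (degree_lt_iff_coeff_zero _ _).mp hg i (by simp at hi; omega)⟩
  have h := hd.iterate (2 * N)
  have h1 := iterate_divStep_coeff_zero (s := ((1 : ℤ), f, g)) h0 (2 * N)
  have h2 : 0 < (divStep^[2 * N] (1, f, g)).1 := by
    by_contra hneg
    refine h1 (h.1 0 ?_)
    push_cast
    omega
  ext i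
  rw [coeff_zero]
  refine h.2 i ?_
  push_cast
  omega

end DivSteps

/-! ## Reduction to lowest terms -/

section Lowest

variable {K : Type u} [Field K]

/-- By the Bézout relation, the greatest common divisor of A and B divides a power of X; a nonzero
constant coefficient of A or of B makes it prime to X, so it is a unit. -/
theorem isCoprime_of_X_pow {A B u v : K[X]} {w n : ℕ} {c : K} (hc : c ≠ 0)
    (h : u * (X ^ w * A) + v * (X ^ w * B) = C c * X ^ n)
    (h0 : A.coeff 0 ≠ 0 ∨ B.coeff 0 ≠ 0) : IsCoprime A B := by
  have hX : ∀ p : K[X], p.coeff 0 ≠ 0 → IsCoprime p X := by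
    intro p hp
    refine ((Polynomial.prime_X (R := K)).irreducible.coprime_iff_not_dvd.mpr ?_).symm
    rwa [X_dvd_iff]
  classical
  rw [← EuclideanDomain.gcd_isUnit_iff]
  set d := EuclideanDomain.gcd A B with hd
  have hdA : d ∣ A := EuclideanDomain.gcd_dvd_left _ _
  have hdB : d ∣ B := EuclideanDomain.gcd_dvd_right _ _
  have hdX : d ∣ X ^ n := by
    have h1 : d ∣ C c * X ^ n := by
      rw [← h]
      exact dvd_add ((hdA.mul_left _).mul_left _) ((hdB.mul_left _).mul_left _)
    have h2 := h1.mul_left (C c⁻¹)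
    rwa [← mul_assoc, ← C_mul, inv_mul_cancel₀ hc, C_1, one_mul] at h2
  have hdc : IsCoprime d (X ^ n) := by
    refine IsCoprime.pow_right ?_
    rcases h0 with h0 | h0
    · exact (hX A h0).of_isCoprime_of_dvd_left hdA
    · exact (hX B h0).of_isCoprime_of_dvd_left hdB
  exact hdc.isUnit_of_dvd' dvd_rfl hdX

theorem num_denom_of_isCoprime {A B : K[X]} (h : IsCoprime A B) (hB : B.Monic) :
    (algebraMap K[X] (RatFunc K) A / algebraMap K[X] (RatFunc K) B).num = A ∧
      (algebraMap K[X] (RatFunc K) A / algebraMap K[X] (RatFunc K) B).denom = B := by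
  set x := algebraMap K[X] (RatFunc K) A / algebraMap K[X] (RatFunc K) B with hx
  have e : x.num * B = A * x.denom := (RatFunc.num_mul_eq_mul_denom_iff hB.ne_zero).mpr hx
  have h1 : B ∣ x.denom := h.symm.dvd_of_dvd_mul_left (Dvd.intro_left _ e)
  have h2 : x.denom ∣ B := RatFunc.denom_div_dvd A B
  have h3 : x.denom = B :=
    eq_of_monic_of_associated (RatFunc.monic_denom x) hB (associated_of_dvd_dvd h2 h1)
  rw [h3] at e
  exact ⟨mul_right_cancel₀ hB.ne_zero e, h3⟩

end Lowest

end AZ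

/-! ### Divide and conquer for transition matrices -/

namespace AZ

namespace Code

/-- The coefficients from `X ^ off` on of a sum of two products. -/
def dot (mul : (ℕ → ℕ) → (ℕ → ℕ) → Code (ℕ → ℕ)) (off N : ℕ) (r₁ s₁ r₂ s₂ : ℕ → ℕ) :
    Code (ℕ → ℕ) := do
  let x ← mul r₁ s₁
  let y ← mul r₂ s₂
  array N fun i => op .add (x (i + off)) (y (i + off))

section

variable {mul : (ℕ → ℕ) → (ℕ → ℕ) → Code (ℕ → ℕ)} {k T : ℕ} {K : Type u} [Field K] [CharZero K]

theorem spec_dot (hmul : Multiplies.{u} k T mul) {off N : ℕ} (hN : N + off ≤ 2 ^ (k + 1))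
    {mem : List K} {r₁ s₁ r₂ s₂ : ℕ → ℕ} {a₁ b₁ a₂ b₂ : K[X]} (ha₁ : a₁.degree < (2 ^ k : ℕ))
    (hb₁ : b₁.degree < (2 ^ k : ℕ)) (ha₂ : a₂.degree < (2 ^ k : ℕ)) (hb₂ : b₂.degree < (2 ^ k : ℕ))
    (hr₁ : Arr mem (2 ^ k) r₁ a₁.coeff) (hs₁ : Arr mem (2 ^ k) s₁ b₁.coeff)
    (hr₂ : Arr mem (2 ^ k) r₂ a₂.coeff) (hs₂ : Arr mem (2 ^ k) s₂ b₂.coeff) :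
    Spec (dot mul off N r₁ s₁ r₂ s₂) mem (T + (T + N)) fun q mem' =>
      Arr mem' N q fun i => (a₁ * b₁ + a₂ * b₂).coeff (i + off) := by
  apply Spec.bind
  · exact hmul K mem r₁ s₁ a₁ b₁ ha₁ hb₁ hr₁ hs₁
  intro x e1 hx
  apply Spec.bind
  · exact hmul K _ r₂ s₂ a₂ b₂ ha₂ hb₂ (hr₂.append e1) (hs₂.append e1)
  intro y e2 hy
  refine (spec_arr (t := 1) (v := fun i => (a₁ * b₁ + a₂ * b₂).coeff (i + off))
    fun i hi e3 => ?_).le (by omega)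
  rw [coeff_add]
  exact spec_op .add (((hx _ (by omega)).append e2).append e3) ((hy _ (by omega)).append e3)

end

/-- The matrix of arrays represents a matrix of polynomials. -/
def MatArr {K : Type u} [Field K] (mem : List K) (N : ℕ) (P : Fin 2 → Fin 2 → ℕ → ℕ)
    (A : Matrix (Fin 2) (Fin 2) K[X]) : Prop := ∀ i j, Arr mem N (P i j) (A i j).coeff

theorem MatArr.append {K : Type u} [Field K] {mem : List K} {N : ℕ} {P : Fin 2 → Fin 2 → ℕ → ℕ}
    {A : Matrix (Fin 2) (Fin 2) K[X]} (h : MatArr mem N P A) (ext : List K) :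
    MatArr (mem ++ ext) N P A := fun i j => (h i j).append ext

/-- The array with the value at `r` at the index `j` and the value at `z` elsewhere. -/
def single (j r z : ℕ) (i : ℕ) : ℕ := if i = j then r else z

/-- Test whether a division step with parameter `δ` has to exchange the two polynomials, the second
one of which has its constant coefficient at position `i`. -/
def keepsOrder (δ : ℤ) (i : ℕ) : Code Bool := if 0 < δ then test i else pure true

/-- The transition matrix of one division step. -/
def jumpBase (δ : ℤ) (rf rg : ℕ → ℕ) : Code (ℤ × (Fin 2 → Fin 2 → ℕ → ℕ)) := do
  let z ← const 0
  let one ← const 1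
  let b ← keepsOrder δ (rg 0)
  if b then
    let c ← neg (rg 0)
    return (1 + δ, ![![single 1 one z, fun _ => z], ![single 0 c z, single 0 (rf 0) z]])
  else
    let c ← neg (rf 0)
    return (1 - δ, ![![fun _ => z, single 1 one z], ![single 0 (rg 0) z, single 0 c z]])

/-- The transition matrix of `2 ^ k` division steps. -/
def jump (mul : ℕ → (ℕ → ℕ) → (ℕ → ℕ) → Code (ℕ → ℕ)) :
    ℕ → ℤ → (ℕ → ℕ) → (ℕ → ℕ) → Code (ℤ × (Fin 2 → Fin 2 → ℕ → ℕ))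
  | 0, δ, rf, rg => jumpBase δ rf rg
  | k + 1, δ, rf, rg => do
    let P ← jump mul k δ rf rg
    let f ← dot (mul (k + 1)) (2 ^ k) (2 ^ k) (P.2 0 0) rf (P.2 0 1) rg
    let g ← dot (mul (k + 1)) (2 ^ k) (2 ^ k) (P.2 1 0) rf (P.2 1 1) rg
    let Q ← jump mul k P.1 f g
    let R ← array 2 fun i => array 2 fun j =>
      dot (mul (k + 1)) 0 (2 ^ (k + 2)) (Q.2 (Fin.ofNat 2 i) 0) (P.2 0 (Fin.ofNat 2 j))
        (Q.2 (Fin.ofNat 2 i) 1) (P.2 1 (Fin.ofNat 2 j))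
    return (Q.1, fun i j => R i j)

section

variable {K : Type u} [Field K]

theorem arr_single {mem : List K} {z r j : ℕ} {c : K} (hz : Has mem z 0) (hr : Has mem r c) (N : ℕ)
    {p : K[X]} (hp : ∀ i, p.coeff i = if i = j then c else 0) :
    Arr mem N (single j r z) p.coeff := by
  intro i _
  rw [hp, single]
  split_ifs
  · exact hr
  · exact hz

theorem spec_jumpBase (δ : ℤ) {mem : List K} {rf rg : ℕ → ℕ} {F G : K[X]}
    (hf : Has mem (rf 0) (F.coeff 0)) (hg : Has mem (rg 0) (G.coeff 0)) :
    Spec (jumpBase δ rf rg) mem 5 fun P mem' => P.1 = (divStep (δ, F, G)).1 ∧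
      MatArr mem' 2 P.2 (stepMatrix (δ, F, G)) := by
  classical
  apply Spec.le
  case h =>
    apply Spec.bind
    · exact spec_const _ 0
    intro z e1 hz
    apply Spec.bind
    · exact spec_const _ 1
    intro one e2 hone
    replace hz := hz.append e2
    rw [Int.cast_zero] at hz
    rw [Int.cast_one] at hone
    apply Spec.bind (T₁ := 1)
      (Q := fun b _ => b = decide (¬ (0 < δ ∧ G.coeff 0 ≠ 0)))
    · unfold keepsOrder
      split_ifs with hδ
      · exact (spec_test ((hg.append e1).append e2)).mono le_rfl fun b _ hb => by
          simp [hb, hδ]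
      · exact Spec.pure 1 (by simp [hδ])
    intro b e3 hb
    replace hz := hz.append e3
    replace hone := hone.append e3
    have hf' := ((hf.append e1).append e2).append e3
    have hg' := ((hg.append e1).append e2).append e3
    by_cases h : 0 < δ ∧ G.coeff 0 ≠ 0
    · rw [if_neg (by simp [hb, h])]
      apply Spec.bind
      · exact spec_neg hf'
      intro c e4 hc
      refine Spec.pure 0 ⟨by simp [divStep, h], ?_⟩
      have hz' := hz.append e4
      have hone' := hone.append e4
      have hg'' := hg'.append e4
      rw [stepMatrix, if_pos h]
      intro i j
      fin_cases i <;> fin_cases j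
      · exact fun i _ => by simpa using hz'
      · exact arr_single hz' hone' _ (by simp [coeff_X, eq_comm])
      · exact arr_single hz' hg'' _ (by simp [coeff_C])
      · exact arr_single hz' hc _ (by simp only [Matrix.of_apply]; intro i; exact coeff_C)
    · rw [if_pos (by rw [hb]; exact decide_eq_true h)]
      apply Spec.bind
      · exact spec_neg hg'
      intro c e4 hc
      refine Spec.pure 0 ⟨by simp only [divStep, if_neg h], ?_⟩
      have hz' := hz.append e4
      have hone' := hone.append e4
      have hf'' := hf'.append e4
      rw [stepMatrix, if_neg h]
      intro i j
      fin_cases i <;> fin_cases j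
      · exact arr_single hz' hone' _ (by simp [coeff_X, eq_comm])
      · exact fun i _ => by simpa using hz'
      · exact arr_single hz' hc _ (by simp only [Matrix.of_apply]; intro i; exact coeff_C)
      · exact arr_single hz' hf'' _ (by simp [coeff_C])
  case hT => norm_num

end

/-- The first 2^k steps depend only on the lowest 2^k coefficients of F and G. The next half of the
steps needs the coefficients of M·(F, G) from X^(2^k) up to X^(2^(k+1)), which are still determined
by the lowest 2^(k+1) coefficients. A level performs 4 products for the new pair and 8 for the
product of the two matrices, which is the 12 in the bound. -/
theorem spec_jump {mul : ℕ → (ℕ → ℕ) → (ℕ → ℕ) → Code (ℕ → ℕ)} {A : ℕ}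
    (hmul : ∀ k, Multiplies.{u} k (A * 2 ^ k * (k + 1) ^ 6) (mul k)) {K : Type u} [Field K]
    [CharZero K] (k : ℕ) : ∀ (δ : ℤ) (mem : List K) (rf rg : ℕ → ℕ) (F G : K[X]),
    Arr mem (2 ^ k) rf F.coeff → Arr mem (2 ^ k) rg G.coeff →
    Spec (jump mul k δ rf rg) mem (2 ^ k * (5 + k * (12 * A + 10) * (k + 1) ^ 6)) fun P mem' =>
      P.1 = (divStep^[2 ^ k] (δ, F, G)).1 ∧
        MatArr mem' (2 ^ (k + 1)) P.2 (transition (2 ^ k) (δ, F, G)) := by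
  induction k with
  | zero =>
    intro δ mem rf rg F G hf hg
    refine (spec_jumpBase δ (hf 0 (by simp)) (hg 0 (by simp))).mono (by simp) fun P ext h => ?_
    simpa [transition] using h
  | succ k ih =>
    intro δ mem rf rg F G hf hg
    have h2 : 2 ^ (k + 1) = 2 ^ k + 2 ^ k := by ring
    have h2' : 2 ^ (k + 1 + 1) = 2 ^ (k + 1) + 2 ^ (k + 1) := by ring
    have hpos : 0 < 2 ^ k := by positivity
    set s : ℤ × K[X] × K[X] := (δ, F, G) with hs
    set s' := divStep^[2 ^ k] s with hs'
    have hdeg : ∀ s : ℤ × K[X] × K[X], ∀ i j,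
        (transition (2 ^ k) s i j).degree < (2 ^ (k + 1) : ℕ) := fun s i j =>
      degree_le_natDegree.trans_lt (by
        have := natDegree_transition_le (2 ^ k) s i j
        exact_mod_cast (by omega))
    have hpolF : Arr mem (2 ^ (k + 1)) rf (pol (2 ^ (k + 1)) F.coeff).coeff := fun i hi => by
      rw [pol_coeff, if_pos hi]; exact hf i hi
    have hpolG : Arr mem (2 ^ (k + 1)) rg (pol (2 ^ (k + 1)) G.coeff).coeff := fun i hi => by
      rw [pol_coeff, if_pos hi]; exact hg i hi
    -- Only the lowest 2^(k+1) coefficients of F and G are in memory; truncating them does not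
    -- affect the coefficients of a product that are read.
    have hlow : ∀ (a p : K[X]), ∀ i < 2 ^ (k + 1),
        (a * pol (2 ^ (k + 1)) p.coeff).coeff i = (a * p).coeff i := by
      intro a p i hi
      rw [coeff_mul, coeff_mul]
      refine Finset.sum_congr rfl fun x hx => ?_
      rw [Finset.HasAntidiagonal.mem_antidiagonal] at hx
      rw [pol_coeff, if_pos (by omega)]
    have hvec := transition_mulVec (2 ^ k) s
    have hrow : ∀ i : Fin 2, transition (2 ^ k) s i 0 * F + transition (2 ^ k) s i 1 * G =
        X ^ 2 ^ k * (![s'.2.1, s'.2.2] i) := fun i => by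
      have := congrFun hvec i
      simpa [Matrix.mulVec, dotProduct, Fin.sum_univ_two] using this
    have hcoef : ∀ i : Fin 2, ∀ l < 2 ^ k,
        (transition (2 ^ k) s i 0 * pol (2 ^ (k + 1)) F.coeff +
          transition (2 ^ k) s i 1 * pol (2 ^ (k + 1)) G.coeff).coeff (l + 2 ^ k) =
          (![s'.2.1, s'.2.2] i).coeff l := by
      intro i l hl
      rw [coeff_add, hlow _ _ _ (by omega), hlow _ _ _ (by omega), ← coeff_add, hrow,
        coeff_X_pow_mul]
    apply Spec.le
    case h =>
      apply Spec.bind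
      · exact ih δ mem rf rg F G (hf.mono (by omega)) (hg.mono (by omega))
      rintro ⟨δ', P⟩ e1 ⟨hδ', hP⟩
      dsimp only at hδ' hP ⊢
      apply Spec.bind
      · exact spec_dot (hmul (k + 1)) (by omega) (hdeg s 0 0) (degree_pol_lt _ _) (hdeg s 0 1)
          (degree_pol_lt _ _) (hP 0 0) (hpolF.append e1) (hP 0 1) (hpolG.append e1)
      intro f e2 hf'
      apply Spec.bind
      · exact spec_dot (hmul (k + 1)) (by omega) (hdeg s 1 0) (degree_pol_lt _ _) (hdeg s 1 1)
          (degree_pol_lt _ _) (hP.append e2 1 0) ((hpolF.append e1).append e2) (hP.append e2 1 1)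
          ((hpolG.append e1).append e2)
      intro g e3 hg'
      apply Spec.bind
      · refine ih δ' _ f g s'.2.1 s'.2.2 (fun i hi => ?_) (fun i hi => ?_)
        · have := (hf' i hi).append e3
          dsimp only at this
          rwa [hcoef 0 i hi] at this
        · have := hg' i hi
          dsimp only at this
          rwa [hcoef 1 i hi] at this
      rintro ⟨δ'', Q⟩ e4 ⟨hδ'', hQ⟩
      rw [hδ', show ((divStep^[2 ^ k] (δ, F, G)).1, s'.2.1, s'.2.2) = s' from rfl] at hδ'' hQ
      dsimp only at hδ'' hQ ⊢
      have hP' := ((hP.append e2).append e3).append e4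
      have htr : transition (2 ^ (k + 1)) s = transition (2 ^ k) s' * transition (2 ^ k) s := by
        rw [h2, transition_add]
      apply Spec.bind
      · refine spec_array 2 (t := 2 * (A * 2 ^ (k + 1) * (k + 1 + 1) ^ 6 +
            (A * 2 ^ (k + 1) * (k + 1 + 1) ^ 6 + 2 ^ (k + 2)))) (Q := fun i (r : ℕ → ℕ → ℕ) mem' => ∀ j < 2,
          Arr mem' (2 ^ (k + 2)) (r j)
            (transition (2 ^ (k + 1)) s (Fin.ofNat 2 i) (Fin.ofNat 2 j)).coeff)
          (fun i _ e5 => ?_) fun i a mem' ext h j hj => (h j hj).append ext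
        refine spec_array 2 (Q := fun j (r : ℕ → ℕ) mem' =>
          Arr mem' (2 ^ (k + 2)) r
            (transition (2 ^ (k + 1)) s (Fin.ofNat 2 i) (Fin.ofNat 2 j)).coeff)
          (fun j _ e6 => ?_) fun j a mem' ext h => h.append ext
        refine (spec_dot (hmul (k + 1)) (off := 0) (N := 2 ^ (k + 2)) le_rfl (hdeg s' _ 0)
          (hdeg s 0 _) (hdeg s' _ 1) (hdeg s 1 _) ((hQ.append e5).append e6 _ 0)
          ((hP'.append e5).append e6 0 _) ((hQ.append e5).append e6 _ 1)
          ((hP'.append e5).append e6 1 _)).mono le_rfl fun r ext hr => ?_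
        rw [htr, Matrix.mul_apply, Fin.sum_univ_two]
        exact hr
      intro R e5 hR
      refine Spec.pure 0 ⟨?_, fun i j => ?_⟩
      · rw [h2, Function.iterate_add_apply]
        exact hδ''
      · have := hR i i.2 j j.2
        rwa [Fin.ofNat_eq_cast, Fin.ofNat_eq_cast, Fin.cast_val_eq_self, Fin.cast_val_eq_self]
          at this
    case hT =>
      have e : (k + 1) ^ 6 ≤ (k + 1 + 1) ^ 6 := Nat.pow_le_pow_left (by omega) 6
      have e1 : 1 ≤ (k + 1 + 1) ^ 6 := Nat.one_le_pow _ _ (by omega)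
      set B := (k + 1 + 1) ^ 6 with hB
      have e4 : 2 ^ (k + 2) = 4 * 2 ^ k := by ring
      have e5 : 2 ^ (k + 1) = 2 * 2 ^ k := by ring
      calc _ = 2 ^ k * (2 * (5 + k * (12 * A + 10) * (k + 1) ^ 6) + 24 * (A * B) + 18 * 1) := by
            rw [e4, e5]; ring
        _ ≤ 2 ^ k * (2 * (5 + k * (12 * A + 10) * B) + 24 * (A * B) + 18 * B) := by gcongr
        _ ≤ 2 ^ k * (2 * (5 + (k + 1) * (12 * A + 10) * B)) := by
            refine Nat.mul_le_mul_left _ ?_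
            nlinarith
        _ = _ := by rw [e5]; ring

end Code

end AZ

/-! ### Reduced fractions from transition matrices -/

namespace AZ

section Lowest

variable {K : Type u} [Field K]

theorem transition_row_one {N : ℕ} {a f : K[X]} (ha : a.degree < (N : ℕ))
    (hf : f.degree < (N : ℕ)) (h0 : f.coeff 0 ≠ 0) :
    transition (2 * N) (1, f, a) 1 0 * f + transition (2 * N) (1, f, a) 1 1 * a = 0 := by
  have := congrFun (transition_mulVec (2 * N) ((1 : ℤ), f, a)) 1
  simpa [Matrix.mulVec, dotProduct, Fin.sum_univ_two, iterate_divStep_eq_zero hf ha h0] using this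

/-- If this entry vanished, the row relation and f ≠ 0 would make the whole row vanish, against the
nonzero determinant. -/
theorem transition_one_one_ne_zero {N : ℕ} {a f : K[X]} (ha : a.degree < (N : ℕ))
    (hf : f.degree < (N : ℕ)) (h0 : f.coeff 0 ≠ 0) : transition (2 * N) (1, f, a) 1 1 ≠ 0 := by
  intro h
  have hrow := transition_row_one ha hf h0
  obtain ⟨c, hc, hdet⟩ := det_transition (s := ((1 : ℤ), f, a)) h0 (2 * N)
  have hf0 : f ≠ 0 := fun h => h0 (by simp [h])
  rw [h, zero_mul, add_zero] at hrow
  rw [Matrix.det_fin_two, h, (mul_eq_zero.mp hrow).resolve_right hf0] at hdet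
  simp [hc] at hdet

/-- The reduced fraction in terms of the transition matrix of sufficiently many division steps. -/
theorem num_denom_of_transition {N v w : ℕ} {a f A B : K[X]} (ha : a.degree < (N : ℕ))
    (hf : f.degree < (N : ℕ)) (h0 : f.coeff 0 ≠ 0)
    (hA : transition (2 * N) (1, f, a) 1 0 = X ^ w * A)
    (hB : X ^ v * transition (2 * N) (1, f, a) 1 1 = X ^ w * B)
    (hAB : A.coeff 0 ≠ 0 ∨ B.coeff 0 ≠ 0) :
    let x := algebraMap K[X] (RatFunc K) a / algebraMap K[X] (RatFunc K) (X ^ v * f)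
    B ≠ 0 ∧ x.num = C (-B.leadingCoeff)⁻¹ * A ∧ x.denom = C B.leadingCoeff⁻¹ * B := by
  intro x
  set M := transition (2 * N) (1, f, a) with hM
  have hrow := transition_row_one ha hf h0
  rw [← hM] at hrow
  obtain ⟨c, hc, hdet⟩ := det_transition (s := ((1 : ℤ), f, a)) h0 (2 * N)
  rw [← hM, Matrix.det_fin_two] at hdet
  have hf0 : f ≠ 0 := fun h => h0 (by simp [h])
  have hM11 : M 1 1 ≠ 0 := transition_one_one_ne_zero ha hf h0
  have hXw : (X ^ w : K[X]) ≠ 0 := pow_ne_zero _ X_ne_zero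
  have hXv : (X ^ v : K[X]) ≠ 0 := pow_ne_zero _ X_ne_zero
  have hB0 : B ≠ 0 := by
    rintro rfl
    rw [mul_zero] at hB
    exact mul_ne_zero hXv hM11 hB
  have hlc : B.leadingCoeff ≠ 0 := leadingCoeff_ne_zero.mpr hB0
  have hcop : IsCoprime A B := by
    -- The Bézout relation is the expansion of the determinant along the second row, multiplied by
    -- X^v.
    refine isCoprime_of_X_pow (u := -(X ^ v * M 0 1)) (v := M 0 0) (w := w) (n := 2 * N + v) hc ?_ hAB
    rw [← hA, ← hB, pow_add]
    linear_combination X ^ v * hdet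
  -- The second row annihilates (f, a), so a/f = -M₁₀/M₁₁; this is where the sign of the numerator
  -- comes from.
  have hfrac : a * B = -(A * (X ^ v * f)) := by
    refine mul_left_cancel₀ hXw ?_
    linear_combination X ^ v * hrow - a * hB - X ^ v * f * hA
  have hmonic : (C B.leadingCoeff⁻¹ * B).Monic := by
    rw [mul_comm]
    exact monic_mul_leadingCoeff_inv hB0
  have hcop' : IsCoprime (C (-B.leadingCoeff)⁻¹ * A) (C B.leadingCoeff⁻¹ * B) :=
    (isCoprime_mul_unit_left_left (isUnit_C.mpr (inv_ne_zero (neg_ne_zero.mpr hlc)).isUnit) _ _).mpr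
      ((isCoprime_mul_unit_left_right (isUnit_C.mpr (inv_ne_zero hlc).isUnit) _ _).mpr hcop)
  have hx : x = algebraMap K[X] (RatFunc K) (C (-B.leadingCoeff)⁻¹ * A) /
      algebraMap K[X] (RatFunc K) (C B.leadingCoeff⁻¹ * B) := by
    rw [div_eq_div_iff (RatFunc.algebraMap_ne_zero (mul_ne_zero hXv hf0))
      (RatFunc.algebraMap_ne_zero hmonic.ne_zero), ← map_mul, ← map_mul]
    congr 1
    rw [inv_neg, C_neg]
    linear_combination C B.leadingCoeff⁻¹ * hfrac
  have := num_denom_of_isCoprime hcop' hmonic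
  rw [← hx] at this
  exact ⟨hB0, this⟩

/-- The coefficient list of a polynomial from an array of coefficients with `e` leading zeros
and `w` trailing coefficients to be dropped. -/
theorem coeffList_eq_of_array {p : K[X]} {M e w : ℕ} {c : K} (hc : c ≠ 0)
    (hp : (X ^ w * p).degree < ((M : ℕ) : WithBot ℕ)) (he : e ≤ M) (hz : ∀ l < e, (X ^ w * p).coeff (M - 1 - l) = 0)
    (hnz : e < M → (X ^ w * p).coeff (M - 1 - e) ≠ 0) :
    (C c * p).coeffList =
      (List.range (M - e - w)).map fun i => c * (X ^ w * p).coeff (M - 1 - e - i) := by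
  rcases eq_or_ne p 0 with rfl | hp0
  -- For the zero polynomial all M coefficients count as leading zeros, and the truncated length M -
  -- e - w gives the empty list.
  · have : e = M := by
      by_contra h
      exact hnz (by omega) (by simp)
    simp [this]
  · have hq0 : X ^ w * p ≠ 0 := mul_ne_zero (pow_ne_zero _ X_ne_zero) hp0
    have heM : e < M := by
      by_contra h
      refine hq0 ?_
      ext i
      rcases lt_or_ge i M with hi | hi
      · have := hz (M - 1 - i) (by omega)
        rwa [show M - 1 - (M - 1 - i) = i by omega] at this
      · exact (degree_lt_iff_coeff_zero _ _).mp hp i hi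
    have hdeg : (X ^ w * p).natDegree = M - 1 - e := by
      refine natDegree_eq_of_le_of_coeff_ne_zero ?_ (hnz heM)
      rw [natDegree_le_iff_coeff_eq_zero]
      intro i hi
      rcases lt_or_ge i M with hi' | hi'
      · have := hz (M - 1 - i) (by omega)
        rwa [show M - 1 - (M - 1 - i) = i by omega] at this
      · exact (degree_lt_iff_coeff_zero _ _).mp hp i hi'
    have hdp : p.natDegree + w = M - 1 - e := by
      rw [← hdeg, natDegree_mul (pow_ne_zero _ X_ne_zero) hp0, natDegree_X_pow, add_comm]
    have hlen : (C c * p).degree.succ = M - e - w := by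
      rw [degree_C_mul hc, withBotSucc_degree_eq_natDegree_add_one hp0]
      omega
    rw [coeffList, hlen]
    refine List.ext_getElem (by simp) fun i h1 h2 => ?_
    simp only [List.length_map, List.length_reverse, List.length_range] at h1
    simp only [List.getElem_map, List.getElem_reverse, List.length_range, List.getElem_range,
      coeff_C_mul]
    rw [show M - 1 - e - i = (M - e - w - 1 - i) + w by omega, coeff_X_pow_mul]

end Lowest

namespace Code

/-- The first index among `i, …, i + n - 1` that passes a test, or `i + n` if there is none. -/
def search (p : ℕ → Code Bool) : ℕ → ℕ → Code ℕ
  | 0, i => pure i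
  | n + 1, i => do
    let b ← p i
    if b then pure i else search p n (i + 1)

/-- Test whether a value is not zero. -/
def nonzero (r : ℕ) : Code Bool := do
  let b ← test r
  return !b

/-- The coefficient lists of two polynomials without their leading zeros, after division by a common
power of the variable as well as by the leading coefficient of the second one; the first one changes
its sign. -/
def finish (M : ℕ) (ra rb : ℕ → ℕ) : Code (List ℕ × List ℕ) := do
  let w ← search (fun i => do
    let b ← nonzero (ra i)
    let c ← nonzero (rb i)
    return b || c) M 0
  let p ← search (fun i => nonzero (ra (M - 1 - i))) M 0
  let q ← search (fun i => nonzero (rb (M - 1 - i))) M 0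
  let c ← neg (rb (M - 1 - q))
  let A ← array M fun i => op .div (ra i) c
  let B ← array M fun i => op .div (rb i) (rb (M - 1 - q))
  return ((List.range (M - p - w)).map fun i => A (M - 1 - p - i),
    (List.range (M - q - w)).map fun i => B (M - 1 - q - i))

/-- The array of the coefficients of a polynomial multiplied by `X ^ v`. -/
def shiftUp (v z : ℕ) (r : ℕ → ℕ) (i : ℕ) : ℕ := if i < v then z else r (i - v)

/-- The first `N` elements of an array, extended by zeros. -/
def pad (N z : ℕ) (r : ℕ → ℕ) (i : ℕ) : ℕ := if i < N then r i else z

/-- Reduce a fraction to lowest terms, where the numerator and the denominator have degree less than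
`2 ^ k`. -/
def reduce (mul : ℕ → (ℕ → ℕ) → (ℕ → ℕ) → Code (ℕ → ℕ)) (k : ℕ) (ra rb : ℕ → ℕ) :
    Code (List ℕ × List ℕ) := do
  let z ← const 0
  let v ← search (fun i => nonzero (rb i)) (2 ^ k) 0
  let P ← jump mul (k + 1) 1 (fun i => pad (2 ^ k) z rb (i + v)) (pad (2 ^ k) z ra)
  finish (2 ^ (k + 2)) (P.2 1 0) (shiftUp v z (P.2 1 1))

section

variable {K : Type u} [Field K]

theorem spec_search {p : ℕ → Code Bool} {good : ℕ → Prop} {t : ℕ} (n : ℕ) :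
    ∀ (i : ℕ) (mem : List K),
    (∀ j, i ≤ j → j < i + n → ∀ ext, Spec (p j) (mem ++ ext) t fun b _ => b = true ↔ good j) →
    Spec (search p n i) mem (n * t) fun j _ =>
      i ≤ j ∧ j ≤ i + n ∧ (∀ l, i ≤ l → l < j → ¬ good l) ∧ (j < i + n → good j) := by
  induction n with
  | zero =>
    exact fun i mem _ => Spec.pure _ ⟨le_rfl, le_rfl, fun l h h' => absurd h' (by omega),
      fun h => absurd h (by omega)⟩
  | succ n ih =>
    intro i mem hp
    rw [show (n + 1) * t = t + n * t by ring]
    apply Spec.bind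
    · have := hp i le_rfl (by omega) []
      rwa [List.append_nil] at this
    intro b e1 hb
    by_cases hg : good i
    · rw [if_pos (hb.mpr hg)]
      exact Spec.pure _ ⟨le_rfl, by omega, fun l h h' => absurd h' (by omega), fun _ => hg⟩
    · rw [if_neg (fun h => hg (hb.mp h))]
      refine (ih (i + 1) _ fun j h1 h2 ext => ?_).mono le_rfl fun j ext h => ?_
      · rw [List.append_assoc]
        exact hp j (by omega) (by omega) _
      · obtain ⟨h1, h2, h3, h4⟩ := h
        refine ⟨by omega, by omega, fun l hl hl' => ?_, fun h => h4 (by omega)⟩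
        rcases eq_or_lt_of_le hl with rfl | hl
        · exact hg
        · exact h3 l hl hl'

theorem spec_nonzero {mem : List K} {r : ℕ} {x : K} (hx : Has mem r x) :
    Spec (nonzero r) mem 1 fun b _ => b = true ↔ x ≠ 0 := by
  classical
  apply Spec.bind (T₂ := 0)
  · exact spec_test hx
  intro b e1 hb
  exact Spec.pure 0 (by simp [hb])

end

/-- The index w is the first at which one of the two arrays is nonzero, while p and q count zeros
from the top. Since b ≠ 0, neither w nor q runs off the end and M > 0, so the 6M + 2 operations are
at most 8M. -/
theorem spec_finish {K : Type u} [Field K] {M : ℕ} {mem : List K} {ra rb : ℕ → ℕ} {a b : K[X]}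
    (hb0 : b ≠ 0) (ha : a.degree < (M : ℕ)) (hb : b.degree < (M : ℕ)) (hra : Arr mem M ra a.coeff)
    (hrb : Arr mem M rb b.coeff) :
    Spec (finish M ra rb) mem (8 * M) fun o mem' => ∃ (w : ℕ) (A B : K[X]),
      a = X ^ w * A ∧ b = X ^ w * B ∧ (A.coeff 0 ≠ 0 ∨ B.coeff 0 ≠ 0) ∧
      o.1.map (fetch mem') = (C (-B.leadingCoeff)⁻¹ * A).coeffList ∧
      o.2.map (fetch mem') = (C B.leadingCoeff⁻¹ * B).coeffList := by
  have hM : 0 < M := by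
    by_contra h
    refine hb0 ?_
    ext i
    exact (degree_lt_iff_coeff_zero _ _).mp hb i (by omega)
  apply Spec.le
  case h =>
    apply Spec.bind
    · refine spec_search (good := fun i => a.coeff i ≠ 0 ∨ b.coeff i ≠ 0) (t := 2) M 0 _
        fun j _ hj ext => ?_
      apply Spec.bind (T₁ := 1) (T₂ := 1)
      · exact spec_nonzero ((hra j (by omega)).append ext)
      intro x e1 hx
      apply Spec.bind (T₁ := 1) (T₂ := 0)
      · exact spec_nonzero (((hrb j (by omega)).append ext).append e1)
      intro y e2 hy
      exact Spec.pure 0 (by rw [Bool.or_eq_true, hx, hy])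
    rintro w e1 ⟨_, hw1, hw2, hw3⟩
    apply Spec.bind
    · exact spec_search (good := fun i => a.coeff (M - 1 - i) ≠ 0) (t := 1) M 0 _
        fun j _ hj ext => spec_nonzero (((hra _ (by omega)).append e1).append ext)
    rintro p e2 ⟨_, hp1, hp2, hp3⟩
    apply Spec.bind
    · exact spec_search (good := fun i => b.coeff (M - 1 - i) ≠ 0) (t := 1) M 0 _
        fun j _ hj ext => spec_nonzero ((((hrb _ (by omega)).append e1).append e2).append ext)
    rintro q e3 ⟨_, hq1, hq2, hq3⟩
    have hra' := ((hra.append e1).append e2).append e3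
    have hrb' := ((hrb.append e1).append e2).append e3
    have hwM : w < M := by
      by_contra h
      refine hb0 ?_
      ext i
      rcases lt_or_ge i M with hi | hi
      · have := hw2 i (Nat.zero_le _) (by omega)
        push Not at this
        exact this.2
      · exact (degree_lt_iff_coeff_zero _ _).mp hb i hi
    have hzero : ∀ d < w, a.coeff d = 0 ∧ b.coeff d = 0 := fun d hd => by
      have := hw2 d (Nat.zero_le _) hd
      push Not at this
      exact this
    obtain ⟨A, rfl⟩ := X_pow_dvd_iff.mpr fun d hd => (hzero d hd).1
    obtain ⟨B, rfl⟩ := X_pow_dvd_iff.mpr fun d hd => (hzero d hd).2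
    have hAB : A.coeff 0 ≠ 0 ∨ B.coeff 0 ≠ 0 := by
      have e : ∀ p : K[X], (X ^ w * p).coeff w = p.coeff 0 := fun p => by
        simpa using coeff_X_pow_mul p w 0
      simpa only [e] using hw3 (by omega)
    have hB0 : B ≠ 0 := by
      rintro rfl
      simp at hb0
    have hqM : q < M := by
      by_contra h
      refine hb0 ?_
      ext i
      rcases lt_or_ge i M with hi | hi
      · have := not_not.mp (hq2 (M - 1 - i) (by omega) (by omega))
        rwa [show M - 1 - (M - 1 - i) = i by omega] at this
      · exact (degree_lt_iff_coeff_zero _ _).mp hb i hi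
    have hlc : (X ^ w * B).coeff (M - 1 - q) = B.leadingCoeff := by
      have hdeg : (X ^ w * B).natDegree = M - 1 - q := by
        refine natDegree_eq_of_le_of_coeff_ne_zero ?_ (hq3 (by omega))
        rw [natDegree_le_iff_coeff_eq_zero]
        intro i hi
        rcases lt_or_ge i M with hi' | hi'
        · have := not_not.mp (hq2 (M - 1 - i) (by omega) (by omega))
          rwa [show M - 1 - (M - 1 - i) = i by omega] at this
        · exact (degree_lt_iff_coeff_zero _ _).mp hb i hi'
      rw [← hdeg, coeff_natDegree]
      simp
    have hlc0 : B.leadingCoeff ≠ 0 := leadingCoeff_ne_zero.mpr hB0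
    have hrl := hrb' (M - 1 - q) (by omega)
    rw [hlc] at hrl
    apply Spec.bind
    · exact spec_neg hrl
    intro c e4 hc
    apply Spec.bind
    · exact spec_arr (t := 1) (v := fun i => (-B.leadingCoeff)⁻¹ * (X ^ w * A).coeff i)
        fun i hi e5 => (spec_op .div (((hra' i hi).append e4).append e5) (hc.append e5)).mono le_rfl
          fun r _ h => by simpa only [FieldOp.eval, div_eq_inv_mul] using h
    intro rA e5 hA
    apply Spec.bind
    · exact spec_arr (t := 1) (v := fun i => B.leadingCoeff⁻¹ * (X ^ w * B).coeff i)
        fun i hi e6 => (spec_op .div ((((hrb' i hi).append e4).append e5).append e6)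
          (((hrl.append e4).append e5).append e6)).mono le_rfl
          fun r _ h => by simpa only [FieldOp.eval, div_eq_inv_mul] using h
    intro rB e6 hB
    refine Spec.pure 0 ⟨w, A, B, rfl, rfl, hAB, ?_, ?_⟩
    · rw [coeffList_eq_of_array (inv_ne_zero (neg_ne_zero.mpr hlc0)) ha (by omega)
        (fun l hl => not_not.mp (hp2 l (Nat.zero_le _) hl)) fun h => hp3 (by omega), List.map_map]
      exact List.map_congr_left fun i hi => ((hA _ (by omega)).append e6).fetch
    · rw [coeffList_eq_of_array (inv_ne_zero hlc0) hb (by omega)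
        (fun l hl => not_not.mp (hq2 l (Nat.zero_le _) hl)) fun h => hq3 (by omega), List.map_map]
      exact List.map_congr_left fun i hi => (hB _ (by omega)).fetch
  case hT => omega

theorem arr_pad {K : Type u} [Field K] {N z : ℕ} {mem : List K} {r : ℕ → ℕ} {p : K[X]}
    (hr : Arr mem N r p.coeff) (hz : Has mem z 0) (hp : p.degree < (N : ℕ)) (N' : ℕ) :
    Arr mem N' (pad N z r) p.coeff := by
  intro i _
  unfold pad
  split_ifs with h
  · exact hr i h
  · rw [(degree_lt_iff_coeff_zero _ _).mp hp _ (not_lt.mp h)]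
    exact hz

/-- Division steps need a nonzero constant coefficient, so X^v is split off the denominator first
and restored in the final row. Both polynomials have degree less than N = 2^k, hence 2N = 2^(k+1)
steps suffice. The entries of the matrix have degree at most 2·2^k and v < 2^k, which is why arrays
of length 2^(k+2) hold the result. -/
theorem spec_reduce {mul : ℕ → (ℕ → ℕ) → (ℕ → ℕ) → Code (ℕ → ℕ)} {A : ℕ}
    (hmul : ∀ k, Multiplies.{u} k (A * 2 ^ k * (k + 1) ^ 6) (mul k)) {K : Type u} [Field K]
    [CharZero K] (k : ℕ) {mem : List K} {ra rb : ℕ → ℕ} {a b : K[X]} (hb0 : b ≠ 0)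
    (ha : a.degree < (2 ^ k : ℕ)) (hb : b.degree < (2 ^ k : ℕ)) (hra : Arr mem (2 ^ k) ra a.coeff)
    (hrb : Arr mem (2 ^ k) rb b.coeff) :
    Spec (reduce mul k ra rb) mem (2 ^ k * ((24 * A + 64) * (k + 2) ^ 7)) fun o mem' =>
      (o.1.map (fetch mem'), o.2.map (fetch mem')) =
        dense (algebraMap K[X] (RatFunc K) a / algebraMap K[X] (RatFunc K) b) := by
  have hpos : 0 < 2 ^ k := by positivity
  have h4 : 2 ^ (k + 2) = 4 * 2 ^ k := by ring
  have h2 : 2 ^ (k + 1) = 2 * 2 ^ k := by ring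
  have h4' : 2 ^ (k + 1 + 1) = 2 ^ (k + 2) := rfl
  apply Spec.le
  case h =>
    apply Spec.bind
    · exact spec_const _ 0
    intro z e1 hz
    rw [Int.cast_zero] at hz
    apply Spec.bind
    · exact spec_search (good := fun i => b.coeff i ≠ 0) (t := 1) (2 ^ k) 0 _
        fun j _ hj ext => spec_nonzero (((hrb j (by omega)).append e1).append ext)
    rintro v e2 ⟨_, hv1, hv2, hv3⟩
    have hvk : v < 2 ^ k := by
      by_contra h
      refine hb0 ?_
      ext i
      rcases lt_or_ge i (2 ^ k) with hi | hi
      · exact not_not.mp (hv2 i (by omega) (by omega))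
      · exact (degree_lt_iff_coeff_zero _ _).mp hb i hi
    obtain ⟨f, rfl⟩ := X_pow_dvd_iff.mpr fun i hi => not_not.mp (hv2 i (Nat.zero_le _) hi)
    have hf0 : f.coeff 0 ≠ 0 := by
      have := hv3 (by omega)
      have e : (X ^ v * f).coeff v = f.coeff 0 := by simpa using coeff_X_pow_mul f v 0
      rwa [e] at this
    have hfc : ∀ i, (X ^ v * f).coeff (i + v) = f.coeff i := fun i => coeff_X_pow_mul _ _ _
    have hf : f.degree < (2 ^ k : ℕ) := by
      rw [degree_lt_iff_coeff_zero]
      intro i hi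
      rw [← hfc]
      exact (degree_lt_iff_coeff_zero _ _).mp hb _ (by omega)
    have hz2 := hz.append e2
    apply Spec.bind
    · refine spec_jump hmul (k + 1) 1 _ _ _ f a (fun i hi => ?_) ?_
      · rw [← hfc]
        exact arr_pad ((hrb.append e1).append e2) hz2 hb _ _ (Nat.lt_succ_self _)
      · exact arr_pad ((hra.append e1).append e2) hz2 ha _
    rintro ⟨δ, P⟩ e3 ⟨-, hP⟩
    dsimp only
    rw [h4', h2] at hP
    set M := transition (2 * 2 ^ k) (1, f, a) with hM
    have hz3 := hz2.append e3
    have hpB : Arr (mem ++ e1 ++ e2 ++ e3) (2 ^ (k + 2)) (shiftUp v z (P 1 1))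
        (X ^ v * M 1 1).coeff := by
      intro i hi
      rw [coeff_X_pow_mul', shiftUp]
      split_ifs with h1 h2
      · omega
      · exact hz3
      · exact hP 1 1 _ (by omega)
      · omega
    have hdM : ∀ i j, (M i j).natDegree ≤ 2 * 2 ^ k := natDegree_transition_le _ _
    have hdA : (M 1 0).degree < (2 ^ (k + 2) : ℕ) := degree_le_natDegree.trans_lt (by
      have := hdM 1 0
      exact_mod_cast (by omega))
    have hdB : (X ^ v * M 1 1).degree < ((2 ^ (k + 2) : ℕ) : WithBot ℕ) :=
      degree_le_natDegree.trans_lt (by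
        have := hdM 1 1
        have h' := natDegree_mul_le (p := (X ^ v : K[X])) (q := M 1 1)
        rw [natDegree_X_pow] at h'
        exact_mod_cast (by omega))
    have hB0 : X ^ v * M 1 1 ≠ 0 :=
      mul_ne_zero (pow_ne_zero _ X_ne_zero) (transition_one_one_ne_zero ha hf hf0)
    refine (spec_finish hB0 hdA hdB (hP 1 0) hpB).mono le_rfl ?_
    rintro o e4 ⟨w, A, B, hA, hB, hAB, h1, h2⟩
    obtain ⟨-, hnum, hden⟩ := num_denom_of_transition ha hf hf0 hA hB hAB
    rw [h1, h2, dense, hnum, hden]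
  case hT =>
    have e1 : 1 ≤ (k + 2) ^ 7 := Nat.one_le_pow _ _ (by omega)
    have e2 : (k + 1) * (k + 1 + 1) ^ 6 ≤ (k + 2) ^ 7 := by
      rw [pow_succ (k + 2) 6, mul_comm]
      exact Nat.mul_le_mul_left _ (by omega)
    calc _ = 1 + 2 ^ k * (2 * (12 * A + 10) * ((k + 1) * (k + 1 + 1) ^ 6) + 43) := by
          rw [h4, h2]; ring
      _ ≤ 2 ^ k * (2 * (12 * A + 10) * (k + 2) ^ 7 + 43) + 2 ^ k := by
          rw [add_comm]
          gcongr
          omega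
      _ = 2 ^ k * (2 * (12 * A + 10) * (k + 2) ^ 7 + 44 * 1) := by ring
      _ ≤ 2 ^ k * (2 * (12 * A + 10) * (k + 2) ^ 7 + 44 * (k + 2) ^ 7) := by gcongr
      _ = _ := by ring

end Code

end AZ

/-! ### The arithmetic of rational functions in dense representation -/

namespace AZ

theorem coeffList_length_le {K : Type u} [Field K] (p : K[X]) :
    p.coeffList.length ≤ p.natDegree + 1 := by
  rcases eq_or_ne p 0 with rfl | h
  · simp
  · rw [length_coeffList_eq_withBotSucc_degree, withBotSucc_degree_eq_natDegree_add_one h]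

theorem degree_lt_coeffList_length {K : Type u} [Field K] (p : K[X]) :
    p.degree < (p.coeffList.length : ℕ) := by
  rcases eq_or_ne p 0 with rfl | h
  · simp
  · rw [length_coeffList_eq_withBotSucc_degree, withBotSucc_degree_eq_natDegree_add_one h,
      degree_eq_natDegree h]
    exact_mod_cast Nat.lt_succ_self _

namespace Code

/-- The array of the coefficients of a polynomial, the coefficient list of which has length `len` and
starts at the position `off`. -/
def input (off len z : ℕ) : ℕ → ℕ := pad len z fun i => off + (len - 1 - i)

theorem arr_input {K : Type u} [Field K] {mem pre post : List K} {p : K[X]} {z : ℕ}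
    (hmem : mem = pre ++ p.coeffList ++ post) (hz : Has mem z 0) (N : ℕ) :
    Arr mem N (input pre.length p.coeffList.length z) p.coeff := by
  refine arr_pad (fun i hi => ?_) hz (degree_lt_coeffList_length p) N
  subst hmem
  unfold Has
  rw [List.append_assoc, List.getElem?_append_right (by omega), Nat.add_sub_cancel_left,
    List.getElem?_append_left (by omega), List.getElem?_eq_getElem (by omega)]
  simp only [coeffList, List.length_map, List.length_reverse, List.length_range, List.getElem_map,
    List.getElem_reverse, List.getElem_range] at hi ⊢
  congr 2
  omega

/-- The negatives of the elements of an array. -/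
def negArray (N : ℕ) (r : ℕ → ℕ) : Code (ℕ → ℕ) := array N fun i => neg (r i)

/-- The coefficients of the derivative of a polynomial. -/
def derivArray (N : ℕ) (r : ℕ → ℕ) : Code (ℕ → ℕ) := array N fun i => do
  let c ← const (i + 1 : ℕ)
  op .mul (r (i + 1)) c

/-- The numerator and the denominator of the result of an operation on two fractions. The numerator
of the second operand has `len` coefficients. -/
def fraction (mul : (ℕ → ℕ) → (ℕ → ℕ) → Code (ℕ → ℕ)) (k len z : ℕ) (a b c d : ℕ → ℕ) :
    RatOp → Code ((ℕ → ℕ) × (ℕ → ℕ))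
  | .add => do
    let x ← dot mul 0 (2 ^ (k + 1)) a d c b
    let y ← mul b d
    return (x, y)
  | .sub => do
    let c' ← negArray (2 ^ k) c
    let x ← dot mul 0 (2 ^ (k + 1)) a d c' b
    let y ← mul b d
    return (x, y)
  | .mul => do
    let x ← mul a c
    let y ← mul b d
    return (x, y)
  | .div =>
    if len = 0 then do
      let one ← const 1
      return (fun _ => z, single 0 one z)
    else do
      let x ← mul a d
      let y ← mul b c
      return (x, y)
  | .deriv => do
    let a' ← derivArray (2 ^ k) a
    let b' ← derivArray (2 ^ k) b
    let b'' ← negArray (2 ^ k) b'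
    let x ← dot mul 0 (2 ^ (k + 1)) a' b b'' a
    let y ← mul b b
    return (x, y)

section

variable {K : Type u} [Field K]

theorem spec_negArray {N : ℕ} {mem : List K} {r : ℕ → ℕ} {p : K[X]} (hr : Arr mem N r p.coeff) :
    Spec (negArray N r) mem (N * 2) fun q mem' => Arr mem' N q (-p).coeff :=
  spec_arr fun i hi ext => by
    rw [coeff_neg]
    exact spec_neg ((hr i hi).append ext)

theorem spec_derivArray {N : ℕ} {mem : List K} {r : ℕ → ℕ} {p : K[X]}
    (hr : Arr mem (N + 1) r p.coeff) :
    Spec (derivArray N r) mem (N * 2) fun q mem' => Arr mem' N q (derivative p).coeff :=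
  spec_arr fun i hi ext => by
    rw [coeff_derivative]
    refine (Spec.bind (spec_const _ _) fun c e1 hc =>
      spec_op .mul (((hr (i + 1) (by omega)).append ext).append e1) hc).mono le_rfl
      fun r e2 h => ?_
    simpa [FieldOp.eval] using h

theorem degree_derivative_lt_of_lt {p : K[X]} {N : ℕ} (hp : p.degree < (N : ℕ)) :
    (derivative p).degree < (N : ℕ) :=
  degree_derivative_le.trans_lt hp

end

/-- The textbook formulas without any cancellation: at most three products of polynomials of degree
less than 2^k, plus linear work, so that both parts of the fraction have degree less than 2^(k+1).
-/
theorem spec_fraction {mul : (ℕ → ℕ) → (ℕ → ℕ) → Code (ℕ → ℕ)} {k T : ℕ}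
    (hmul : Multiplies.{u} k T mul) {K : Type u} [Field K] [CharZero K] (o : RatOp)
    {mem : List K} {z len : ℕ} {a b c d : ℕ → ℕ} {f g : RatFunc K}
    (hlen : len = 0 ↔ g.num = 0) (hz : Has mem z 0)
    (ha : ∀ N, Arr mem N a f.num.coeff) (hb : ∀ N, Arr mem N b f.denom.coeff)
    (hc : ∀ N, Arr mem N c g.num.coeff) (hd : ∀ N, Arr mem N d g.denom.coeff)
    (hda : f.num.degree < (2 ^ k : ℕ)) (hdb : f.denom.degree < (2 ^ k : ℕ))
    (hdc : g.num.degree < (2 ^ k : ℕ)) (hdd : g.denom.degree < (2 ^ k : ℕ)) :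
    Spec (fraction mul k len z a b c d o) mem (3 * T + 8 * 2 ^ k) fun r mem' => ∃ A B : K[X],
      B ≠ 0 ∧ A.degree < (2 ^ (k + 1) : ℕ) ∧ B.degree < (2 ^ (k + 1) : ℕ) ∧
      Arr mem' (2 ^ (k + 1)) r.1 A.coeff ∧ Arr mem' (2 ^ (k + 1)) r.2 B.coeff ∧
      algebraMap K[X] (RatFunc K) A / algebraMap K[X] (RatFunc K) B = o.eval f g := by
  have h2 : 2 ^ (k + 1) = 2 ^ k + 2 ^ k := by ring
  have h1 : 1 ≤ 2 ^ k := Nat.one_le_two_pow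
  have hm : ∀ {p q : K[X]}, p.degree < (2 ^ k : ℕ) → q.degree < (2 ^ k : ℕ) →
      (p * q).degree < ((2 ^ (k + 1) : ℕ) : WithBot ℕ) := fun hp hq => by
    rw [h2]; exact degree_mul_lt_of_lt hp hq
  have hadd : ∀ {p q : K[X]}, p.degree < (2 ^ (k + 1) : ℕ) → q.degree < (2 ^ (k + 1) : ℕ) →
      (p + q).degree < ((2 ^ (k + 1) : ℕ) : WithBot ℕ) := fun hp hq =>
    (degree_add_le _ _).trans_lt (max_lt hp hq)
  have hf0 := f.denom_ne_zero
  have hg0 := g.denom_ne_zero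
  have hf : algebraMap K[X] (RatFunc K) f.num / algebraMap K[X] (RatFunc K) f.denom = f :=
    f.num_div_denom
  have hg : algebraMap K[X] (RatFunc K) g.num / algebraMap K[X] (RatFunc K) g.denom = g :=
    g.num_div_denom
  have hfa := RatFunc.algebraMap_ne_zero (K := K) hf0
  have hga := RatFunc.algebraMap_ne_zero (K := K) hg0
  cases o with
  | add =>
    apply Spec.le
    case h =>
      apply Spec.bind
      · exact spec_dot hmul (off := 0) (N := 2 ^ (k + 1)) le_rfl hda hdd hdc hdb (ha _) (hd _) (hc _) (hb _)
      intro x e1 hx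
      apply Spec.bind
      · exact hmul K _ b d _ _ hdb hdd ((hb _).append e1) ((hd _).append e1)
      intro y e2 hy
      refine Spec.pure 0 ⟨_, _, mul_ne_zero hf0 hg0, hadd (hm hda hdd) (hm hdc hdb), hm hdb hdd,
        hx.append e2, hy, ?_⟩
      conv_rhs => rw [RatOp.eval, ← hf, ← hg, div_add_div _ _ hfa hga]
      simp only [map_add, map_mul]
      ring
    case hT => omega
  | sub =>
    apply Spec.le
    case h =>
      apply Spec.bind
      · exact spec_negArray (hc _)
      intro c' e0 hc'
      apply Spec.bind
      · exact spec_dot hmul (off := 0) (N := 2 ^ (k + 1)) le_rfl hda hdd (by rwa [degree_neg]) hdb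
          ((ha _).append e0) ((hd _).append e0) hc' ((hb _).append e0)
      intro x e1 hx
      apply Spec.bind
      · exact hmul K _ b d _ _ hdb hdd (((hb _).append e0).append e1) (((hd _).append e0).append e1)
      intro y e2 hy
      refine Spec.pure 0 ⟨_, _, mul_ne_zero hf0 hg0,
        hadd (hm hda hdd) (hm (by rwa [degree_neg]) hdb), hm hdb hdd, hx.append e2, hy, ?_⟩
      conv_rhs => rw [RatOp.eval, ← hf, ← hg, div_sub_div _ _ hfa hga]
      simp only [map_add, map_mul, map_neg]
      ring
    case hT => omega
  | mul =>
    apply Spec.le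
    case h =>
      apply Spec.bind
      · exact hmul K _ a c _ _ hda hdc (ha _) (hc _)
      intro x e1 hx
      apply Spec.bind
      · exact hmul K _ b d _ _ hdb hdd ((hb _).append e1) ((hd _).append e1)
      intro y e2 hy
      refine Spec.pure 0 ⟨_, _, mul_ne_zero hf0 hg0, hm hda hdc, hm hdb hdd,
        hx.append e2, hy, ?_⟩
      conv_rhs => rw [RatOp.eval, ← hf, ← hg, div_mul_div_comm]
      simp only [map_mul]
    case hT => omega
  | div =>
    unfold fraction
    -- Division by zero has the value 0 = 0/1. Zero is the only operand with an empty numerator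
    -- list, so this case is settled by the size of the operand, when the tree is built.
    split_ifs with hl
    · apply Spec.le
      case h =>
        apply Spec.bind
        · exact spec_const _ 1
        intro one e1 hone
        rw [Int.cast_one] at hone
        refine Spec.pure 0 ⟨0, 1, one_ne_zero, ?_, ?_, fun i _ => ?_,
          arr_single (hz.append e1) hone _ fun i => by simp [coeff_one], ?_⟩
        · rw [degree_zero]; exact WithBot.bot_lt_coe _
        · rw [degree_one]; exact_mod_cast (by omega)
        · simpa using hz.append e1
        · rw [RatOp.eval, RatFunc.num_eq_zero_iff.mp (hlen.mp hl)]
          simp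
      case hT => omega
    · have hgn : g.num ≠ 0 := fun h => hl (hlen.mpr h)
      apply Spec.le
      case h =>
        apply Spec.bind
        · exact hmul K _ a d _ _ hda hdd (ha _) (hd _)
        intro x e1 hx
        apply Spec.bind
        · exact hmul K _ b c _ _ hdb hdc ((hb _).append e1) ((hc _).append e1)
        intro y e2 hy
        refine Spec.pure 0 ⟨_, _, mul_ne_zero hf0 hgn, hm hda hdd, hm hdb hdc,
          hx.append e2, hy, ?_⟩
        conv_rhs => rw [RatOp.eval, ← hf, ← hg, div_div_div_eq]
        simp only [map_mul]
      case hT => omega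
  | deriv =>
    apply Spec.le
    case h =>
      apply Spec.bind
      · exact spec_derivArray (ha _)
      intro a' e1 ha'
      apply Spec.bind
      · exact spec_derivArray ((hb _).append e1)
      intro b' e2 hb'
      apply Spec.bind
      · exact spec_negArray hb'
      intro b'' e3 hb''
      have hdb'' : (-derivative f.denom).degree < (2 ^ k : ℕ) := by
        rw [degree_neg]; exact degree_derivative_lt_of_lt hdb
      apply Spec.bind
      · exact spec_dot hmul (off := 0) (N := 2 ^ (k + 1)) le_rfl (degree_derivative_lt_of_lt hda) hdb
          hdb'' hda ((ha'.append e2).append e3)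
          ((((hb _).append e1).append e2).append e3) hb'' ((((ha _).append e1).append e2).append e3)
      intro x e4 hx
      have hb4 := ((((hb (2 ^ k)).append e1).append e2).append e3).append e4
      apply Spec.bind
      · exact hmul K _ b b _ _ hdb hdb hb4 hb4
      intro y e5 hy
      refine Spec.pure 0 ⟨_, _, mul_ne_zero hf0 hf0,
        hadd (hm (degree_derivative_lt_of_lt hda) hdb) (hm hdb'' hda), hm hdb hdb,
        hx.append e5, hy, ?_⟩
      simp only [RatOp.eval, ratDeriv]
      congr 2 <;> ring
    case hT => omega

/-- One operation on rational functions in dense representation. -/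
def ratOp (mul : ℕ → (ℕ → ℕ) → (ℕ → ℕ) → Code (ℕ → ℕ)) (o : RatOp) (s t : ℕ × ℕ) :
    Code (List ℕ × List ℕ) := do
  let z ← const 0
  let r ← fraction (mul (Nat.clog 2 (s.1 + s.2 + t.1 + t.2))) (Nat.clog 2 (s.1 + s.2 + t.1 + t.2))
    t.1 z (input 0 s.1 z) (input s.1 s.2 z) (input (s.1 + s.2) t.1 z)
    (input (s.1 + s.2 + t.1) t.2 z) o
  reduce mul (Nat.clog 2 (s.1 + s.2 + t.1 + t.2) + 1) r.1 r.2

/-- With 2^k at least the total input size, the unreduced fraction has degree less than 2^(k+1), so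
the reduction runs at level k + 1. The constants add up as 51 = 3 + 2·24 and 137 = 1 + 8 + 2·64. -/
theorem spec_ratOp {mul : ℕ → (ℕ → ℕ) → (ℕ → ℕ) → Code (ℕ → ℕ)} {A : ℕ}
    (hmul : ∀ k, Multiplies.{u} k (A * 2 ^ k * (k + 1) ^ 6) (mul k)) {K : Type u} [Field K]
    [CharZero K] (o : RatOp) (f g : RatFunc K) {k : ℕ}
    (hk : k = Nat.clog 2 ((denseSize f).1 + (denseSize f).2 + (denseSize g).1 + (denseSize g).2)) :
    Spec (ratOp mul o (denseSize f) (denseSize g)) (operands f g)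
      (2 ^ k * ((51 * A + 137) * (k + 3) ^ 7)) fun r mem' =>
        (r.1.map (fetch mem'), r.2.map (fetch mem')) = dense (o.eval f g) := by
  have hle : ∀ n, n ≤ (denseSize f).1 + (denseSize f).2 + (denseSize g).1 + (denseSize g).2 →
      ((n : ℕ) : WithBot ℕ) ≤ ((2 ^ k : ℕ) : WithBot ℕ) := fun n hn => by
    rw [hk]
    exact_mod_cast hn.trans (Nat.le_pow_clog one_lt_two _)
  unfold ratOp
  rw [← hk]
  apply Spec.le
  case h =>
    apply Spec.bind
    · exact spec_const _ 0
    intro z e1 hz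
    rw [Int.cast_zero] at hz
    apply Spec.bind
    · refine spec_fraction (f := f) (g := g) (hmul k) o ?_ hz (fun N => ?_) (fun N => ?_)
        (fun N => ?_) (fun N => ?_) ?_ ?_ ?_ ?_
      · simp [denseSize, dense]
      · exact arr_input (pre := []) (post := f.denom.coeffList ++ g.num.coeffList ++
          g.denom.coeffList ++ e1) (by simp [operands, dense]) hz N
      · exact arr_input (pre := f.num.coeffList) (post := g.num.coeffList ++
          g.denom.coeffList ++ e1) (by simp [operands, dense]) hz N
      · have := arr_input (p := g.num) (pre := f.num.coeffList ++ f.denom.coeffList)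
          (post := g.denom.coeffList ++ e1) (by simp [operands, dense]) hz N
        rwa [List.length_append] at this
      · have := arr_input (p := g.denom) (pre := f.num.coeffList ++ f.denom.coeffList ++
          g.num.coeffList) (post := e1) (by simp [operands, dense]) hz N
        rwa [List.length_append, List.length_append] at this
      · exact (degree_lt_coeffList_length _).trans_le (hle _ (by simp only [denseSize, dense]; omega))
      · exact (degree_lt_coeffList_length _).trans_le (hle _ (by simp only [denseSize, dense]; omega))
      · exact (degree_lt_coeffList_length _).trans_le (hle _ (by simp only [denseSize, dense]; omega))
      · exact (degree_lt_coeffList_length _).trans_le (hle _ (by simp only [denseSize, dense]; omega))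
    rintro r e2 ⟨P, Q, hQ, hdP, hdQ, hrP, hrQ, heval⟩
    rw [← heval]
    exact spec_reduce hmul (k + 1) hQ hdP hdQ hrP hrQ
  case hT =>
    have e1 : (k + 1) ^ 6 ≤ (k + 3) ^ 7 :=
      (Nat.pow_le_pow_left (by omega) 6).trans (Nat.pow_le_pow_right (by omega) (by norm_num))
    have e2 : 1 ≤ (k + 3) ^ 7 := Nat.one_le_pow _ _ (by omega)
    have e3 : 1 ≤ 2 ^ k := Nat.one_le_two_pow
    calc _ = 1 + 2 ^ k * (3 * A * (k + 1) ^ 6 + 8 * 1 + 2 * ((24 * A + 64) * (k + 3) ^ 7)) := by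
          ring
      _ ≤ 2 ^ k * (1 * 1) +
          2 ^ k * (3 * A * (k + 3) ^ 7 + 8 * (k + 3) ^ 7 + 2 * ((24 * A + 64) * (k + 3) ^ 7)) := by
          gcongr
          omega
      _ ≤ 2 ^ k * (1 * (k + 3) ^ 7) +
          2 ^ k * (3 * A * (k + 3) ^ 7 + 8 * (k + 3) ^ 7 + 2 * ((24 * A + 64) * (k + 3) ^ 7)) := by
          gcongr
      _ = _ := by ring

end Code

/-- The operands of a step have degree at most `D`. -/
def Step.DegLE {K : Type u} [Field K] (D : ℕ) : Step K → Prop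
  | .arith _ f g => ratDegree f ≤ D ∧ ratDegree g ≤ D
  | .zeroTest _ => True

/-- There is a correct arithmetic of rational functions of quasi-linear complexity. -/
theorem exists_ratArith : ∃ (A : RatArith) (B : ℕ), ∀ (K : Type u) [Field K] [CharZero K],
    A.Correct K ∧ ∀ (D : ℕ) (st : Step K), st.DegLE D →
      A.stepCost st ≤ B * (D + 1) * (Nat.clog 2 (4 * (D + 1)) + 3) ^ 7 := by
  choose mul hmul using Code.exists_multiplies.{u}
  -- The initial memory length is the sum of the sizes, so the tree depends on the operation and the
  -- sizes only, and not on the field. The factor 8 comes from 2^⌈log₂ S⌉ ≤ 8(D + 1), where S ≤ 4(D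
  -- + 1) is the total size.
  refine ⟨fun o s t => Code.ratOp mul o s t (s.1 + s.2 + t.1 + t.2) fun _ r => .out r.1 r.2,
    (51 * 5000 + 137) * 8, fun K _ _ => ⟨fun o f g => ?_, fun D st hst => ?_⟩⟩
  · obtain ⟨a, ext, t, -, hQ, h⟩ := Code.spec_ratOp hmul o f g rfl
    have hlen : (operands f g).length =
        (denseSize f).1 + (denseSize f).2 + (denseSize g).1 + (denseSize g).2 := by
      simp [operands, denseSize]
      omega
    have := (h fun _ r => .out r.1 r.2).1
    rw [hlen] at this
    rw [this, ArithTree.result]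
    exact hQ
  · cases st with
    | arith o f g =>
      obtain ⟨a, ext, t, ht, -, h⟩ := Code.spec_ratOp hmul o f g rfl
      have hlen : (operands f g).length =
          (denseSize f).1 + (denseSize f).2 + (denseSize g).1 + (denseSize g).2 := by
        simp [operands, denseSize]
        omega
      have := (h fun _ r => .out r.1 r.2).2
      rw [hlen, ArithTree.cost, zero_add] at this
      refine (le_of_eq this).trans (ht.trans ?_)
      set S := (denseSize f).1 + (denseSize f).2 + (denseSize g).1 + (denseSize g).2 with hS
      have hsize : ∀ x : RatFunc K, ratDegree x ≤ D →
          (denseSize x).1 ≤ D + 1 ∧ (denseSize x).2 ≤ D + 1 := fun x hx =>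
        ⟨(coeffList_length_le _).trans (Nat.succ_le_succ ((le_max_left _ _).trans hx)),
          (coeffList_length_le _).trans (Nat.succ_le_succ ((le_max_right _ _).trans hx))⟩
      have h1 := hsize f hst.1
      have h2 := hsize g hst.2
      have hSle : S ≤ 4 * (D + 1) := by omega
      have hpow : 2 ^ Nat.clog 2 S ≤ 8 * (D + 1) := by
        rcases lt_or_ge 1 S with h1S | h1S
        · have h3 := Nat.pow_pred_clog_lt_self one_lt_two h1S
          have h4 : 0 < Nat.clog 2 S := Nat.clog_pos one_lt_two h1S
          obtain ⟨m, hm⟩ := Nat.exists_eq_succ_of_ne_zero h4.ne'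
          rw [hm] at h3 ⊢
          rw [Nat.pred_succ] at h3
          rw [Nat.succ_eq_add_one, pow_succ]
          omega
        · rw [Nat.clog_of_right_le_one h1S]
          omega
      have hclog : Nat.clog 2 S ≤ Nat.clog 2 (4 * (D + 1)) := Nat.clog_mono_right 2 hSle
      calc _ ≤ 8 * (D + 1) * ((51 * 5000 + 137) * (Nat.clog 2 (4 * (D + 1)) + 3) ^ 7) := by gcongr
        _ = _ := by ring
    | zeroTest f =>
      exact Nat.one_le_iff_ne_zero.mpr (by positivity)

end AZ

namespace AZ

/-! ## Derivatives and degrees of rational functions -/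

section Derivative

variable {K : Type u} [Field K]

/-- The quotient rule does not depend on the representative: this is the derivative of the
cross-multiplied identity between the reduced fraction and the given one. It frees later
computations from lowest terms. -/
theorem ratDeriv_div (a : K[X]) {b : K[X]} (hb : b ≠ 0) :
    ratDeriv (algebraMap K[X] (RatFunc K) a / algebraMap K[X] (RatFunc K) b) =
      algebraMap K[X] (RatFunc K) (derivative a * b - a * derivative b) /
        algebraMap K[X] (RatFunc K) (b ^ 2) := by
  set x := algebraMap K[X] (RatFunc K) a / algebraMap K[X] (RatFunc K) b with hx
  have hd := x.denom_ne_zero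
  have e : x.num * b = a * x.denom := (RatFunc.num_mul_eq_mul_denom_iff hb).mpr hx
  have e' := congrArg derivative e
  rw [derivative_mul, derivative_mul] at e'
  rw [ratDeriv, div_eq_div_iff (RatFunc.algebraMap_ne_zero (pow_ne_zero 2 hd))
    (RatFunc.algebraMap_ne_zero (pow_ne_zero 2 hb)), ← map_mul, ← map_mul]
  congr 1
  linear_combination b * x.denom * e' - (b * derivative x.denom + x.denom * derivative b) * e

theorem ratDeriv_algebraMap (a : K[X]) :
    ratDeriv (algebraMap K[X] (RatFunc K) a) = algebraMap K[X] (RatFunc K) (derivative a) := by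
  have := ratDeriv_div a (one_ne_zero (α := K[X]))
  simpa using this

@[simp]
theorem ratDeriv_zero : ratDeriv (0 : RatFunc K) = 0 := by
  simpa using ratDeriv_algebraMap (0 : K[X])

@[simp]
theorem ratDeriv_one : ratDeriv (1 : RatFunc K) = 0 := by
  simpa using ratDeriv_algebraMap (1 : K[X])

theorem exists_eq_div (f : RatFunc K) : ∃ a b : K[X], b ≠ 0 ∧
    f = algebraMap K[X] (RatFunc K) a / algebraMap K[X] (RatFunc K) b :=
  ⟨f.num, f.denom, f.denom_ne_zero, f.num_div_denom.symm⟩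

theorem ratDeriv_add (f g : RatFunc K) : ratDeriv (f + g) = ratDeriv f + ratDeriv g := by
  obtain ⟨a, b, hb, rfl⟩ := exists_eq_div f
  obtain ⟨c, d, hd, rfl⟩ := exists_eq_div g
  have hb' := RatFunc.algebraMap_ne_zero (K := K) hb
  have hd' := RatFunc.algebraMap_ne_zero (K := K) hd
  rw [div_add_div _ _ hb' hd', ← map_mul, ← map_mul, ← map_mul, ← map_add,
    ratDeriv_div _ (mul_ne_zero hb hd), ratDeriv_div _ hb, ratDeriv_div _ hd]
  simp only [derivative_mul, map_sub, map_add, map_mul, map_pow]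
  field_simp
  ring

theorem ratDeriv_mul (f g : RatFunc K) : ratDeriv (f * g) = ratDeriv f * g + f * ratDeriv g := by
  obtain ⟨a, b, hb, rfl⟩ := exists_eq_div f
  obtain ⟨c, d, hd, rfl⟩ := exists_eq_div g
  have hb' := RatFunc.algebraMap_ne_zero (K := K) hb
  have hd' := RatFunc.algebraMap_ne_zero (K := K) hd
  rw [div_mul_div_comm, ← map_mul, ← map_mul,
    ratDeriv_div _ (mul_ne_zero hb hd), ratDeriv_div _ hb, ratDeriv_div _ hd]
  simp only [derivative_mul, map_sub, map_add, map_mul, map_pow]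
  field_simp
  ring

theorem ratDeriv_sum {ι : Type*} (s : Finset ι) (f : ι → RatFunc K) :
    ratDeriv (∑ i ∈ s, f i) = ∑ i ∈ s, ratDeriv (f i) := by
  classical
  induction s using Finset.induction_on with
  | empty => simp
  | insert i s hi ih => rw [Finset.sum_insert hi, Finset.sum_insert hi, ratDeriv_add, ih]

theorem map_ratDeriv_mul {n : ℕ} (A B : Mat n K) :
    (A * B).map ratDeriv = A.map ratDeriv * B + A * B.map ratDeriv := by
  ext i j
  simp [Matrix.mul_apply, ratDeriv_sum, ratDeriv_mul, Finset.sum_add_distrib]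

end Derivative

section Degree

variable {K : Type u} [Field K]

theorem ratDegree_div_le {a b : K[X]} {N : ℕ} (hb : b ≠ 0) (ha : a.natDegree ≤ N)
    (hbN : b.natDegree ≤ N) :
    ratDegree (algebraMap K[X] (RatFunc K) a / algebraMap K[X] (RatFunc K) b) ≤ N := by
  refine max_le ?_ ((natDegree_le_of_dvd (RatFunc.denom_div_dvd a b) hb).trans hbN)
  rcases eq_or_ne a 0 with rfl | ha0
  · simp
  · exact (natDegree_le_of_dvd (RatFunc.num_div_dvd a hb) ha0).trans ha

theorem exists_eq_div_of_ratDegree_le {f : RatFunc K} {N : ℕ} (hf : ratDegree f ≤ N) :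
    ∃ a b : K[X], b ≠ 0 ∧ a.natDegree ≤ N ∧ b.natDegree ≤ N ∧
      f = algebraMap K[X] (RatFunc K) a / algebraMap K[X] (RatFunc K) b :=
  ⟨f.num, f.denom, f.denom_ne_zero, (le_max_left _ _).trans hf, (le_max_right _ _).trans hf,
    f.num_div_denom.symm⟩

@[simp]
theorem ratDegree_zero : ratDegree (0 : RatFunc K) = 0 := by simp [ratDegree]

theorem ratDegree_mul_le {f g : RatFunc K} {m n : ℕ} (hf : ratDegree f ≤ m) (hg : ratDegree g ≤ n) :
    ratDegree (f * g) ≤ m + n := by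
  obtain ⟨a, b, hb, ha', hb', rfl⟩ := exists_eq_div_of_ratDegree_le hf
  obtain ⟨c, d, hd, hc', hd', rfl⟩ := exists_eq_div_of_ratDegree_le hg
  rw [div_mul_div_comm, ← map_mul, ← map_mul]
  exact ratDegree_div_le (mul_ne_zero hb hd) (natDegree_mul_le.trans (add_le_add ha' hc'))
    (natDegree_mul_le.trans (add_le_add hb' hd'))

theorem ratDegree_add_le {f g : RatFunc K} {m n : ℕ} (hf : ratDegree f ≤ m) (hg : ratDegree g ≤ n) :
    ratDegree (f + g) ≤ m + n := by
  obtain ⟨a, b, hb, ha', hb', rfl⟩ := exists_eq_div_of_ratDegree_le hf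
  obtain ⟨c, d, hd, hc', hd', rfl⟩ := exists_eq_div_of_ratDegree_le hg
  rw [div_add_div _ _ (RatFunc.algebraMap_ne_zero hb) (RatFunc.algebraMap_ne_zero hd), ← map_mul,
    ← map_mul, ← map_mul, ← map_add]
  exact ratDegree_div_le (mul_ne_zero hb hd) (natDegree_add_le_of_degree_le
    (natDegree_mul_le.trans (add_le_add ha' hd')) (natDegree_mul_le.trans (add_le_add hb' hc')))
    (natDegree_mul_le.trans (add_le_add hb' hd'))

theorem ratDegree_neg_le {f : RatFunc K} {m : ℕ} (hf : ratDegree f ≤ m) : ratDegree (-f) ≤ m := by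
  obtain ⟨a, b, hb, ha', hb', rfl⟩ := exists_eq_div_of_ratDegree_le hf
  rw [← neg_div, ← map_neg]
  exact ratDegree_div_le hb (by rwa [natDegree_neg]) hb'

theorem ratDegree_sub_le {f g : RatFunc K} {m n : ℕ} (hf : ratDegree f ≤ m) (hg : ratDegree g ≤ n) :
    ratDegree (f - g) ≤ m + n := by
  rw [sub_eq_add_neg]
  exact ratDegree_add_le hf (ratDegree_neg_le hg)

theorem ratDegree_div_le_add {f g : RatFunc K} {m n : ℕ} (hf : ratDegree f ≤ m)
    (hg : ratDegree g ≤ n) : ratDegree (f / g) ≤ m + n := by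
  obtain ⟨a, b, hb, ha', hb', rfl⟩ := exists_eq_div_of_ratDegree_le hf
  obtain ⟨c, d, hd, hc', hd', rfl⟩ := exists_eq_div_of_ratDegree_le hg
  rcases eq_or_ne c 0 with rfl | hc
  · simp
  rw [div_div_div_eq, ← map_mul, ← map_mul]
  exact ratDegree_div_le (mul_ne_zero hb hc) (natDegree_mul_le.trans (add_le_add ha' hd'))
    (natDegree_mul_le.trans (add_le_add hb' hc'))

theorem ratDegree_ratDeriv_le {f : RatFunc K} {m : ℕ} (hf : ratDegree f ≤ m) :
    ratDegree (ratDeriv f) ≤ m + m := by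
  obtain ⟨a, b, hb, ha', hb', rfl⟩ := exists_eq_div_of_ratDegree_le hf
  rw [ratDeriv_div _ hb]
  have h : ∀ p : K[X], (derivative p).natDegree ≤ p.natDegree := fun p =>
    (natDegree_derivative_le p).trans (Nat.sub_le _ _)
  refine ratDegree_div_le (pow_ne_zero 2 hb) ?_ (natDegree_pow_le.trans (by omega))
  exact (natDegree_sub_le _ _).trans (max_le
    (natDegree_mul_le.trans (add_le_add ((h a).trans ha') hb'))
    (natDegree_mul_le.trans (add_le_add ha' ((h b).trans hb'))))

end Degree

/-! ## Degrees of vectors of rational functions -/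

section VecDegree

variable {K : Type u} [Field K] {n : ℕ}

/-- The vector has a common denominator such that this and the numerators have degree at most
`N`. -/
def VecDegLE (N : ℕ) (x : Fin n → RatFunc K) : Prop :=
  ∃ (y : Fin n → K[X]) (q : K[X]), q ≠ 0 ∧ (∀ i, (y i).natDegree ≤ N) ∧ q.natDegree ≤ N ∧
    ∀ i, x i = algebraMap K[X] (RatFunc K) (y i) / algebraMap K[X] (RatFunc K) q

theorem VecDegLE.apply {N : ℕ} {x : Fin n → RatFunc K} (h : VecDegLE N x) (i : Fin n) :
    ratDegree (x i) ≤ N := by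
  obtain ⟨y, q, hq, hy, hqN, hx⟩ := h
  rw [hx]
  exact ratDegree_div_le hq (hy i) hqN

theorem VecDegLE.mono {N N' : ℕ} {x : Fin n → RatFunc K} (h : VecDegLE N x) (hN : N ≤ N') :
    VecDegLE N' x := by
  obtain ⟨y, q, hq, hy, hqN, hx⟩ := h
  exact ⟨y, q, hq, fun i => (hy i).trans hN, hqN.trans hN, hx⟩

theorem vecDegLE_algebraMap {N : ℕ} {y : Fin n → K[X]} (hy : ∀ i, (y i).natDegree ≤ N) :
    VecDegLE N fun i => algebraMap K[X] (RatFunc K) (y i) :=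
  ⟨y, 1, one_ne_zero, hy, by simp, fun i => by simp⟩

theorem vecDegLE_single (k : Fin n) (N : ℕ) : VecDegLE N (Pi.single k (1 : RatFunc K)) := by
  have := vecDegLE_algebraMap (K := K) (N := N) (y := Pi.single k 1) fun i => by
    rw [Pi.single_apply]
    split_ifs <;> simp
  convert this using 1
  ext i
  rw [Pi.single_apply, Pi.single_apply]
  split_ifs <;> simp

theorem VecDegLE.ite {N : ℕ} {x : Fin n → RatFunc K} (h : VecDegLE N x) (P : Fin n → Prop)
    [DecidablePred P] :
    VecDegLE N fun i => if P i then x i else 0 := by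
  obtain ⟨y, q, hq, hy, hqN, hx⟩ := h
  refine ⟨fun i => if P i then y i else 0, q, hq, fun i => ?_, hqN, fun i => ?_⟩
  · dsimp only
    split_ifs
    · exact hy i
    · simp
  · dsimp only
    split_ifs
    · exact hx i
    · simp

theorem natDegree_vecMul_le {R : Type*} [CommRing R] {N B : ℕ} {y : Fin n → R[X]} (hy : ∀ i, (y i).natDegree ≤ N)
    {A : Matrix (Fin n) (Fin n) R[X]} (hA : ∀ i j, (A i j).natDegree ≤ B) (j : Fin n) :
    (Matrix.vecMul y A j).natDegree ≤ N + B := by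
  simp only [Matrix.vecMul, dotProduct]
  exact natDegree_sum_le_of_forall_le _ _ fun i _ =>
    natDegree_mul_le.trans (add_le_add (hy i) (hA i j))

theorem VecDegLE.vecMul {N B : ℕ} {x : Fin n → RatFunc K} (h : VecDegLE N x)
    {A : Matrix (Fin n) (Fin n) K[X]} (hA : ∀ i j, (A i j).natDegree ≤ B) :
    VecDegLE (N + B) (Matrix.vecMul x (A.map (algebraMap K[X] (RatFunc K)))) := by
  obtain ⟨y, q, hq, hy, hqN, hx⟩ := h
  refine ⟨Matrix.vecMul y A, q, hq, fun j => ?_, hqN.trans (Nat.le_add_right _ _), fun j => ?_⟩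
  · exact natDegree_vecMul_le hy hA j
  · simp only [Matrix.vecMul, dotProduct, Matrix.map_apply, map_sum, map_mul, Finset.sum_div]
    refine Finset.sum_congr rfl fun i _ => ?_
    rw [hx]
    ring

theorem VecDegLE.div {N B : ℕ} {x : Fin n → RatFunc K} (h : VecDegLE N x) {c : K[X]} (hc : c ≠ 0)
    (hcB : c.natDegree ≤ B) :
    VecDegLE (N + B) fun i => x i / algebraMap K[X] (RatFunc K) c := by
  obtain ⟨y, q, hq, hy, hqN, hx⟩ := h
  refine ⟨y, q * c, mul_ne_zero hq hc, fun i => (hy i).trans (Nat.le_add_right _ _),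
    natDegree_mul_le.trans (add_le_add hqN hcB), fun i => ?_⟩
  dsimp only
  rw [hx, map_mul, div_div]

/-- By the quotient rule the common denominator q becomes q² for the whole vector, independently of
n; adding up separate denominators would cost a factor n in the degree. -/
theorem VecDegLE.delta {N d : ℕ} {x : Fin n → RatFunc K} (h : VecDegLE N x)
    {A : Matrix (Fin n) (Fin n) K[X]} (hA : ∀ i j, (A i j).natDegree ≤ d) :
    VecDegLE (2 * N + d) (AZ.delta (A.map (algebraMap K[X] (RatFunc K))) x) := by
  obtain ⟨y, q, hq, hy, hqN, hx⟩ := h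
  have hder : ∀ p : K[X], (derivative p).natDegree ≤ p.natDegree := fun p =>
    (natDegree_derivative_le p).trans (Nat.sub_le _ _)
  refine ⟨fun j => q * Matrix.vecMul y A j + (derivative (y j) * q - y j * derivative q), q ^ 2,
    pow_ne_zero 2 hq, fun j => ?_, natDegree_pow_le.trans (by omega), fun j => ?_⟩
  · refine (natDegree_add_le _ _).trans (max_le ?_ ((natDegree_sub_le _ _).trans (max_le ?_ ?_)))
    · have : (Matrix.vecMul y A j).natDegree ≤ N + d :=
        natDegree_vecMul_le hy hA j
      exact natDegree_mul_le.trans (by omega)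
    · have h1 := hder (y j)
      have h2 := hy j
      exact natDegree_mul_le.trans (by omega)
    · have h1 := hder q
      have h2 := hy j
      exact natDegree_mul_le.trans (by omega)
  · have hq' := RatFunc.algebraMap_ne_zero (K := K) hq
    have hsum : Matrix.vecMul x (A.map (algebraMap K[X] (RatFunc K))) j =
        algebraMap K[X] (RatFunc K) (Matrix.vecMul y A j) / algebraMap K[X] (RatFunc K) q := by
      simp only [Matrix.vecMul, dotProduct, Matrix.map_apply, map_sum, map_mul, Finset.sum_div]
      refine Finset.sum_congr rfl fun i _ => ?_
      rw [hx]
      ring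
    simp only [AZ.delta, Pi.add_apply]
    rw [hsum, hx, ratDeriv_div _ hq, map_add, map_mul, map_pow, add_div]
    congr 1
    field_simp

end VecDegree

end AZ

namespace AZ

/-! ## Krylov vectors of polynomial matrices -/

section MatrixDegree

variable {R : Type*} [CommRing R] {n : ℕ}

theorem natDegree_det_le_of_forall_le {A : Matrix (Fin n) (Fin n) R[X]} {B : ℕ}
    (hA : ∀ i j, (A i j).natDegree ≤ B) : A.det.natDegree ≤ n * B := by
  rw [Matrix.det_apply]
  refine natDegree_sum_le_of_forall_le _ _ fun σ _ => ?_
  have h : (∏ i, A (σ i) i).natDegree ≤ n * B := by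
    refine (natDegree_prod_le _ _).trans ((Finset.sum_le_sum fun i _ => hA (σ i) i).trans ?_)
    simp
  rcases Int.units_eq_one_or (Equiv.Perm.sign σ) with hs | hs <;> rw [hs]
  · simpa using h
  · simpa using h

theorem natDegree_adjugate_le {A : Matrix (Fin n) (Fin n) R[X]} {B : ℕ}
    (hA : ∀ i j, (A i j).natDegree ≤ B) (i j : Fin n) : (A.adjugate i j).natDegree ≤ n * B := by
  rw [Matrix.adjugate_apply]
  refine natDegree_det_le_of_forall_le fun k l => ?_
  rw [Matrix.updateRow_apply]
  split_ifs
  · rw [Pi.single_apply]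
    split_ifs <;> simp
  · exact hA k l

end MatrixDegree

section PolyKrylov

variable {R S : Type*} [CommRing R] [CommRing S] {n : ℕ} [NeZero n]

/-- The iterates of the first unit vector under `v ↦ v A + v'`. -/
noncomputable def polyKrylov (A : Matrix (Fin n) (Fin n) R[X]) : ℕ → Fin n → R[X]
  | 0 => Pi.single 0 1
  | k + 1 => Matrix.vecMul (polyKrylov A k) A + fun j => derivative (polyKrylov A k j)

/-- The matrix whose first `a` rows are the first `a` iterates, and whose other rows are unit
vectors. -/
noncomputable def krylovBasis (A : Matrix (Fin n) (Fin n) R[X]) (a : ℕ) : Matrix (Fin n) (Fin n) R[X] :=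
  Matrix.of fun i => if (i : ℕ) < a then polyKrylov A i else Pi.single i 1

theorem map_polyKrylov (f : R →+* S) (A : Matrix (Fin n) (Fin n) R[X]) (k : ℕ) (j : Fin n) :
    (polyKrylov A k j).map f = polyKrylov (A.map (Polynomial.map f)) k j := by
  induction k generalizing j with
  | zero =>
    simp only [polyKrylov, Pi.single_apply]
    split_ifs <;> simp
  | succ k ih =>
    simp only [polyKrylov, Pi.add_apply, Polynomial.map_add, Matrix.vecMul, dotProduct,
      Polynomial.map_sum, Polynomial.map_mul, Matrix.map_apply, ← derivative_map, ih]

theorem map_krylovBasis (f : R →+* S) (A : Matrix (Fin n) (Fin n) R[X]) (a : ℕ) :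
    (krylovBasis A a).map (Polynomial.map f) = krylovBasis (A.map (Polynomial.map f)) a := by
  ext1 i j
  simp only [krylovBasis, Matrix.map_apply, Matrix.of_apply]
  split_ifs
  · exact map_polyKrylov f A i j
  · simp only [Pi.single_apply]
    split_ifs <;> simp

theorem map_det_krylovBasis (f : R →+* S) (A : Matrix (Fin n) (Fin n) R[X]) (a : ℕ) :
    (krylovBasis A a).det.map f = (krylovBasis (A.map (Polynomial.map f)) a).det := by
  rw [← map_krylovBasis, ← coe_mapRingHom, RingHom.map_det]
  rfl

theorem natDegree_polyKrylov_le {A : Matrix (Fin n) (Fin n) R[X]} {d : ℕ}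
    (hA : ∀ i j, (A i j).natDegree ≤ d) (k : ℕ) (j : Fin n) :
    (polyKrylov A k j).natDegree ≤ k * d := by
  induction k generalizing j with
  | zero =>
    simp only [polyKrylov, Pi.single_apply]
    split_ifs <;> simp
  | succ k ih =>
    refine (natDegree_add_le _ _).trans (max_le ?_ ?_)
    · rw [Nat.succ_mul]
      exact natDegree_vecMul_le ih hA j
    · refine (natDegree_derivative_le _).trans ?_
      rw [Nat.succ_mul]
      have := ih j
      omega

theorem natDegree_krylovBasis_le {A : Matrix (Fin n) (Fin n) R[X]} {d : ℕ}
    (hA : ∀ i j, (A i j).natDegree ≤ d) (a : ℕ) (i j : Fin n) :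
    (krylovBasis A a i j).natDegree ≤ n * d := by
  simp only [krylovBasis, Matrix.of_apply]
  split_ifs
  · exact (natDegree_polyKrylov_le hA i j).trans (Nat.mul_le_mul_right d i.2.le)
  · simp only [Pi.single_apply]
    split_ifs <;> simp

/-- For the shift matrix, the iterates are the unit vectors. -/
theorem polyKrylov_shift (k : Fin n) :
    polyKrylov (Matrix.of fun i j : Fin n => if (j : ℕ) = i + 1 then (1 : R[X]) else 0) k =
      Pi.single k 1 := by
  obtain ⟨k, hk⟩ := k
  induction k with
  | zero => rfl
  | succ k ih =>
    have ih := ih (by omega)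
    ext1 j
    simp only [polyKrylov] at ih ⊢
    simp only [ih, Pi.add_apply, Matrix.single_one_vecMul, Matrix.row, Matrix.of_apply,
      Pi.single_apply, Fin.ext_iff]
    split_ifs <;> simp

theorem krylovBasis_shift (a : ℕ) :
    krylovBasis (Matrix.of fun i j : Fin n => if (j : ℕ) = i + 1 then (1 : R[X]) else 0) a = 1 := by
  ext1 i j
  simp only [krylovBasis, Matrix.of_apply]
  rw [polyKrylov_shift, ite_self, Matrix.one_eq_pi_single]

end PolyKrylov

/-! ### Genericity -/

section Generic

variable {n d : ℕ}

/-- The matrix of polynomials of degree at most `d` with the given coefficients. -/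
noncomputable def coeffMatrix {R : Type*} [CommRing R] (m : Fin n × Fin n × Fin (d + 1) → R) :
    Matrix (Fin n) (Fin n) R[X] :=
  Matrix.of fun i j => ∑ k : Fin (d + 1), C (m (i, j, k)) * X ^ (k : ℕ)

theorem polyMatrix_eq_map {K : Type u} [Field K] (m : Fin n × Fin n × Fin (d + 1) → K) :
    polyMatrix m = (coeffMatrix m).map (algebraMap K[X] (RatFunc K)) := rfl

theorem natDegree_coeffMatrix_le {R : Type*} [CommRing R] (m : Fin n × Fin n × Fin (d + 1) → R)
    (i j : Fin n) : (coeffMatrix m i j).natDegree ≤ d := by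
  simp only [coeffMatrix, Matrix.of_apply]
  exact natDegree_sum_le_of_forall_le _ _ fun k _ =>
    (natDegree_C_mul_X_pow_le _ _).trans (Nat.lt_succ_iff.mp k.2)

theorem map_coeffMatrix {R S : Type*} [CommRing R] [CommRing S] (f : R →+* S)
    (m : Fin n × Fin n × Fin (d + 1) → R) :
    (coeffMatrix m).map (Polynomial.map f) = coeffMatrix (fun x => f (m x)) := by
  ext1 i j
  simp [coeffMatrix, Polynomial.map_sum]

theorem coeffMatrix_shift {R : Type*} [CommRing R] :
    coeffMatrix (fun x : Fin n × Fin n × Fin (d + 1) =>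
      if x.2.2 = 0 ∧ (x.2.1 : ℕ) = x.1 + 1 then (1 : R) else 0) =
    Matrix.of fun i j : Fin n => if (j : ℕ) = i + 1 then (1 : R[X]) else 0 := by
  ext1 i j
  simp only [coeffMatrix, Matrix.of_apply]
  rw [Fin.sum_univ_succ]
  by_cases h : (j : ℕ) = i + 1 <;> simp [h, Fin.succ_ne_zero]

variable (n d) [NeZero n] in
/-- Generically, the first iterates of the first unit vector and the last unit vectors form a
basis. -/
theorem isGeneric_det_krylovBasis_ne_zero (K : Type u) [Field K] :
    IsGeneric fun m : Fin n × Fin n × Fin (d + 1) → K =>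
      ∀ a ≤ n, (krylovBasis (coeffMatrix m) a).det ≠ 0 := by
  -- The matrix with indeterminate coefficients; evaluation commutes with iterates, determinants and
  -- constant coefficients.
  set G := coeffMatrix (n := n) (d := d)
    (MvPolynomial.X : Fin n × Fin n × Fin (d + 1) → MvPolynomial _ K) with hG
  have key : ∀ (m : Fin n × Fin n × Fin (d + 1) → K) (a : ℕ),
      MvPolynomial.eval m ((krylovBasis G a).det.coeff 0) =
        (krylovBasis (coeffMatrix m) a).det.coeff 0 := fun m a => by
    rw [← coeff_map, map_det_krylovBasis, hG, map_coeffMatrix]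
    simp
  -- One polynomial for all a at once. A nonzero constant coefficient is enough for the determinant
  -- to be nonzero, and the shift matrix, for which every determinant is 1, shows that each factor
  -- is nonzero.
  refine ⟨∏ a ∈ Finset.range (n + 1), (krylovBasis G a).det.coeff 0, ?_, fun m hm a ha h => ?_⟩
  · refine Finset.prod_ne_zero_iff.mpr fun a _ h => ?_
    have := key (fun x => if x.2.2 = 0 ∧ (x.2.1 : ℕ) = x.1 + 1 then 1 else 0) a
    rw [coeffMatrix_shift, krylovBasis_shift, h] at this
    simp at this
  · rw [map_prod] at hm
    refine Finset.prod_ne_zero_iff.mp hm a (Finset.mem_range.mpr (by omega)) ?_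
    rw [key, h, coeff_zero]

end Generic

end AZ

namespace AZ

/-! ## Coordinates with respect to Krylov vectors -/

section Delta

variable {K : Type u} [Field K] {n : ℕ} (M : Mat n K)

theorem delta_add (x y : Fin n → RatFunc K) : delta M (x + y) = delta M x + delta M y := by
  ext j
  simp only [delta, Matrix.add_vecMul, Pi.add_apply, ratDeriv_add]
  ring

theorem delta_smul (c : RatFunc K) (x : Fin n → RatFunc K) :
    delta M (c • x) = c • delta M x + ratDeriv c • x := by
  ext j
  simp only [delta, Matrix.smul_vecMul, Pi.add_apply, Pi.smul_apply, smul_eq_mul, ratDeriv_mul]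
  ring

theorem delta_zero : delta M 0 = 0 := by
  have := delta_smul M 0 0
  simpa using this

theorem delta_sub (x y : Fin n → RatFunc K) : delta M (x - y) = delta M x - delta M y := by
  have := delta_add M (x - y) y
  rw [sub_add_cancel] at this
  rw [this, add_sub_cancel_right]

theorem mul_add_map_ratDeriv_apply (T : Mat n K) (i : Fin n) :
    (T * M + T.map ratDeriv) i = delta M (T i) := by
  ext j
  simp [delta, Matrix.mul_apply, Matrix.vecMul, dotProduct]

end Delta

section Coord

variable {K : Type u} [Field K] {n : ℕ}

/-- A matrix of polynomials as a matrix of rational functions. -/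
noncomputable abbrev toRat (A : Matrix (Fin n) (Fin n) K[X]) : Mat n K :=
  A.map (algebraMap K[X] (RatFunc K))

theorem det_toRat (A : Matrix (Fin n) (Fin n) K[X]) :
    (toRat A).det = algebraMap K[X] (RatFunc K) A.det :=
  (RingHom.map_det _ _).symm

theorem adjugate_toRat (A : Matrix (Fin n) (Fin n) K[X]) :
    (toRat A).adjugate = toRat A.adjugate :=
  (RingHom.map_adjugate (algebraMap K[X] (RatFunc K)) A).symm

variable [NeZero n] (A : Matrix (Fin n) (Fin n) K[X])

/-- The iterates of the first unit vector under `δ`. -/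
noncomputable def krylovVec (k : ℕ) : Fin n → RatFunc K :=
  fun j => algebraMap K[X] (RatFunc K) (polyKrylov A k j)

theorem krylovVec_zero : krylovVec A 0 = Pi.single 0 1 := by
  ext j
  simp only [krylovVec, polyKrylov, Pi.single_apply]
  split_ifs <;> simp

theorem delta_krylovVec (k : ℕ) : delta (toRat A) (krylovVec A k) = krylovVec A (k + 1) := by
  ext j
  simp [delta, krylovVec, polyKrylov, Matrix.vecMul, dotProduct, ratDeriv_algebraMap]

theorem krylov_toRat_apply (i : Fin n) : krylov (toRat A) (Pi.single 0 1) i = krylovVec A i := by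
  have h : ∀ k, (delta (toRat A))^[k] (Pi.single 0 1) = krylovVec A k := fun k => by
    induction k with
    | zero => exact (krylovVec_zero A).symm
    | succ k ih => rw [Function.iterate_succ_apply', ih, delta_krylovVec]
  exact h i

theorem toRat_krylovBasis_of_lt {a : ℕ} {i : Fin n} (h : (i : ℕ) < a) :
    toRat (krylovBasis A a) i = krylovVec A i := by
  ext j
  simp [krylovBasis, h, krylovVec]

theorem toRat_krylovBasis_of_le {a : ℕ} {i : Fin n} (h : a ≤ i) :
    toRat (krylovBasis A a) i = Pi.single i 1 := by
  ext j
  simp only [krylovBasis, Matrix.map_apply, Matrix.of_apply, not_lt.mpr h, if_false,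
    Pi.single_apply]
  split_ifs <;> simp

/-- Extends genericity from a ≤ n to all a, so that no range condition has to be carried along. -/
theorem krylovBasis_of_le {a : ℕ} (h : n ≤ a) : krylovBasis A a = krylovBasis A n := by
  ext1 i j
  simp [krylovBasis, i.2.trans_le h]

/-- The span of the first `a` iterates. -/
noncomputable def krylovSpan (a : ℕ) : Submodule (RatFunc K) (Fin n → RatFunc K) :=
  Submodule.span (RatFunc K) (krylovVec A '' Set.Iio a)

theorem krylovSpan_mono {a b : ℕ} (h : a ≤ b) : krylovSpan A a ≤ krylovSpan A b :=
  Submodule.span_mono (Set.image_mono (Set.Iio_subset_Iio h))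

theorem krylovVec_mem_krylovSpan {k a : ℕ} (h : k < a) : krylovVec A k ∈ krylovSpan A a :=
  Submodule.subset_span ⟨k, h, rfl⟩

/-- Although δ is not linear, δ(cx) = cδ(x) + c'x, and the additional term stays in the span that
contained x. -/
theorem delta_mem_krylovSpan {a : ℕ} {x : Fin n → RatFunc K} (hx : x ∈ krylovSpan A a) :
    delta (toRat A) x ∈ krylovSpan A (a + 1) := by
  induction hx using Submodule.span_induction with
  | mem x hx =>
    obtain ⟨k, hk, rfl⟩ := hx
    rw [delta_krylovVec]
    exact krylovVec_mem_krylovSpan A (Nat.succ_lt_succ hk)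
  | zero =>
    rw [delta_zero]
    exact zero_mem _
  | add x y _ _ hx hy =>
    rw [delta_add]
    exact add_mem hx hy
  | smul c x hx' hx =>
    rw [delta_smul]
    exact add_mem (Submodule.smul_mem _ _ hx)
      (Submodule.smul_mem _ _ (krylovSpan_mono A a.le_succ hx'))

/-- The coordinates with respect to the first `a` iterates and the last unit vectors. -/
noncomputable def coord (a : ℕ) : (Fin n → RatFunc K) →ₗ[RatFunc K] (Fin n → RatFunc K) :=
  ((toRat (krylovBasis A a))⁻¹).vecMulLinear

/-- The part in the span of the last unit vectors of the iterate of index `a`. -/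
noncomputable def auxVec (a : ℕ) : Fin n → RatFunc K :=
  fun k => if (k : ℕ) < a then 0 else coord A a (krylovVec A a) k

theorem auxVec_of_lt {a : ℕ} {k : Fin n} (h : (k : ℕ) < a) : auxVec A a k = 0 := if_pos h

theorem auxVec_of_le {a : ℕ} {k : Fin n} (h : a ≤ k) :
    auxVec A a k = coord A a (krylovVec A a) k := if_neg (not_lt.mpr h)

variable {A}

theorem vecMul_mem_krylovSpan {a : ℕ} {z : Fin n → RatFunc K}
    (hz : ∀ k : Fin n, a ≤ k → z k = 0) :
    Matrix.vecMul z (toRat (krylovBasis A a)) ∈ krylovSpan A a := by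
  rw [Matrix.vecMul_eq_sum]
  refine Submodule.sum_mem _ fun k _ => ?_
  rcases lt_or_ge (k : ℕ) a with h | h
  · rw [toRat_krylovBasis_of_lt A h]
    exact Submodule.smul_mem _ _ (krylovVec_mem_krylovSpan A h)
  · rw [hz k h, zero_smul]
    exact zero_mem _

theorem vecMul_krylovBasis_of_support {a : ℕ} {x : Fin n → RatFunc K}
    (hx : ∀ k : Fin n, (k : ℕ) < a → x k = 0) :
    Matrix.vecMul x (toRat (krylovBasis A a)) = x := by
  have h : ∀ k, x k • toRat (krylovBasis A a) k = Pi.single k (x k) := fun k => by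
    rcases lt_or_ge (k : ℕ) a with h | h
    · rw [hx k h, zero_smul, Pi.single_zero]
    · rw [toRat_krylovBasis_of_le A h, ← Pi.single_smul, smul_eq_mul, mul_one]
  rw [Matrix.vecMul_eq_sum, Finset.sum_congr rfl fun k _ => h k, Finset.univ_sum_single]

variable (hA : ∀ a, (krylovBasis A a).det ≠ 0)
include hA

theorem isUnit_det_toRat_krylovBasis (a : ℕ) : IsUnit (toRat (krylovBasis A a)).det := by
  rw [det_toRat, isUnit_iff_ne_zero]
  exact RatFunc.algebraMap_ne_zero (hA a)

theorem vecMul_coord (a : ℕ) (x : Fin n → RatFunc K) :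
    Matrix.vecMul (coord A a x) (toRat (krylovBasis A a)) = x := by
  simp only [coord, Matrix.vecMulLinear_apply, Matrix.vecMul_vecMul,
    Matrix.nonsing_inv_mul _ (isUnit_det_toRat_krylovBasis hA a), Matrix.vecMul_one]

theorem coord_vecMul (a : ℕ) (z : Fin n → RatFunc K) :
    coord A a (Matrix.vecMul z (toRat (krylovBasis A a))) = z := by
  simp only [coord, Matrix.vecMulLinear_apply, Matrix.vecMul_vecMul,
    Matrix.mul_nonsing_inv _ (isUnit_det_toRat_krylovBasis hA a), Matrix.vecMul_one]

theorem coord_krylovVec {a : ℕ} {j : Fin n} (h : (j : ℕ) < a) :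
    coord A a (krylovVec A j) = Pi.single j 1 := by
  rw [← toRat_krylovBasis_of_lt A h, ← coord_vecMul hA a (Pi.single j 1),
    Matrix.single_one_vecMul]
  rfl

theorem coord_of_support {a : ℕ} {x : Fin n → RatFunc K}
    (hx : ∀ k : Fin n, (k : ℕ) < a → x k = 0) : coord A a x = x := by
  conv_lhs => rw [← vecMul_krylovBasis_of_support (A := A) hx]
  exact coord_vecMul hA a x

theorem coord_apply_of_mem_krylovSpan {a : ℕ} {x : Fin n → RatFunc K} (hx : x ∈ krylovSpan A a)
    {l : Fin n} (hl : a ≤ l) : coord A a x l = 0 := by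
  induction hx using Submodule.span_induction with
  | mem x hx =>
    obtain ⟨k, hk, rfl⟩ := hx
    have hk : k < a := hk
    have := coord_krylovVec hA (j := ⟨k, by omega⟩) hk
    rw [this, Pi.single_apply, if_neg]
    intro h
    rw [h] at hl
    exact absurd hl (not_le.mpr hk)
  | zero => simp
  | add x y _ _ hx hy => simp [hx, hy]
  | smul c x _ hx => simp [hx]

theorem krylovVec_sub_auxVec_mem (a : ℕ) : krylovVec A a - auxVec A a ∈ krylovSpan A a := by
  have h := vecMul_mem_krylovSpan (A := A) (a := a) (z := coord A a (krylovVec A a) - auxVec A a)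
    fun k hk => by rw [Pi.sub_apply, auxVec_of_le A hk, sub_self]
  rwa [Matrix.sub_vecMul, vecMul_coord hA,
    vecMul_krylovBasis_of_support fun k hk => auxVec_of_lt A hk] at h

theorem auxVec_mem_krylovSpan (a : ℕ) : auxVec A a ∈ krylovSpan A (a + 1) := by
  rw [← sub_sub_cancel (krylovVec A a) (auxVec A a)]
  exact sub_mem (krylovVec_mem_krylovSpan A a.lt_succ_self)
    (krylovSpan_mono A a.le_succ (krylovVec_sub_auxVec_mem hA a))

/-- Modulo K_{a+1}, both vectors are congruent to δ^{a+1}(e). This congruence is why Step 1, which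
drops the known unknowns from a derivative, produces the projections u_a. -/
theorem delta_auxVec_sub_mem (a : ℕ) :
    delta (toRat A) (auxVec A a) - auxVec A (a + 1) ∈ krylovSpan A (a + 1) := by
  have h1 := delta_mem_krylovSpan A (krylovVec_sub_auxVec_mem hA a)
  have h2 := krylovVec_sub_auxVec_mem hA (a + 1)
  rw [delta_sub, delta_krylovVec] at h1
  have := sub_mem h2 h1
  rwa [sub_sub_sub_cancel_left] at this

theorem coord_auxVec_of_le {a b : ℕ} (h : b ≤ a) : coord A b (auxVec A a) = auxVec A a :=
  coord_of_support hA fun _ hk => auxVec_of_lt A (hk.trans_le h)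

theorem coord_auxVec_of_lt {a b : ℕ} (h : a < b) {l : Fin n} (hl : b ≤ l) :
    coord A b (auxVec A a) l = 0 :=
  coord_apply_of_mem_krylovSpan hA (krylovSpan_mono A h (auxVec_mem_krylovSpan hA a)) hl

theorem auxVec_zero : auxVec A 0 = Pi.single 0 1 := by
  have h := krylovVec_sub_auxVec_mem hA 0
  have h0 : krylovSpan A 0 = ⊥ := by simp [krylovSpan]
  rw [h0, Submodule.mem_bot, sub_eq_zero, krylovVec_zero] at h
  exact h.symm

/-- P_{a+1} arises from P_a by replacing row a by δ^a(e), which multiplies the determinant by the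
coordinate of δ^a(e) at a. So this entry is det P_{a+1} / det P_a. -/
theorem auxVec_diag_ne_zero (a : Fin n) : auxVec A a a ≠ 0 := by
  have h : toRat (krylovBasis A (a + 1)) = (toRat (krylovBasis A a)).updateRow a
      (∑ k, coord A a (krylovVec A a) k • toRat (krylovBasis A a) k) := by
    rw [← Matrix.vecMul_eq_sum, vecMul_coord hA]
    refine funext fun i => ?_
    rcases lt_trichotomy i a with hi | rfl | hi
    · rw [Matrix.updateRow_ne hi.ne, toRat_krylovBasis_of_lt A (Nat.lt_succ_of_lt hi),
        toRat_krylovBasis_of_lt A hi]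
    · rw [Matrix.updateRow_self, toRat_krylovBasis_of_lt A (Nat.lt_succ_self _)]
    · rw [Matrix.updateRow_ne hi.ne', toRat_krylovBasis_of_le A hi,
        toRat_krylovBasis_of_le A hi.le]
  have hdet := congrArg Matrix.det h
  rw [Matrix.det_updateRow_sum] at hdet
  intro h0
  rw [auxVec_of_le A le_rfl] at h0
  rw [h0, zero_smul] at hdet
  exact (isUnit_det_toRat_krylovBasis hA _).ne_zero hdet

end Coord

end AZ

namespace AZ

/-! ## The bases in the course of the algorithm -/

section Bases

variable {K : Type u} [Field K] {n : ℕ} [NeZero n] (A : Matrix (Fin n) (Fin n) K[X])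

/-- The first rows are the vectors `auxVec A k` for `k < a`, then comes `v`, and then unit
vectors. -/
noncomputable def auxBasis (a : ℕ) (v : Fin n → RatFunc K) : Mat n K :=
  Matrix.of fun k => if (k : ℕ) < a then auxVec A k else if (k : ℕ) = a then v else Pi.single k 1

/-- The first rows are the iterates of index `k < a`, then comes `w`, and then the vectors
`auxVec A k` for `k > a`. -/
noncomputable def mixedBasis (a : ℕ) (w : Fin n → RatFunc K) : Mat n K :=
  Matrix.of fun k => if (k : ℕ) < a then krylovVec A k else if (k : ℕ) = a then w else auxVec A k

/-- The unit vector of index `m`, or zero if there is none. -/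
noncomputable def unitVec (m : ℕ) : Fin n → RatFunc K := fun c => if (c : ℕ) = m then 1 else 0

omit [NeZero n] in
theorem unitVec_coe (k : Fin n) : (unitVec k : Fin n → RatFunc K) = Pi.single k 1 := by
  funext c
  simp [unitVec, Pi.single_apply, Fin.ext_iff]

variable {A}

theorem auxBasis_of_lt {a : ℕ} {v : Fin n → RatFunc K} {k : Fin n} (h : (k : ℕ) < a) :
    auxBasis A a v k = auxVec A k := by
  funext j
  simp [auxBasis, h]

theorem auxBasis_self {a : Fin n} {v : Fin n → RatFunc K} : auxBasis A a v a = v := by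
  funext j
  simp [auxBasis]

theorem auxBasis_of_gt {a : ℕ} {v : Fin n → RatFunc K} {k : Fin n} (h : a < k) :
    auxBasis A a v k = Pi.single k 1 := by
  funext j
  simp [auxBasis, h.not_gt, h.ne']

theorem mixedBasis_of_lt {a : ℕ} {w : Fin n → RatFunc K} {k : Fin n} (h : (k : ℕ) < a) :
    mixedBasis A a w k = krylovVec A k := by
  funext j
  simp [mixedBasis, h]

theorem mixedBasis_self {a : Fin n} {w : Fin n → RatFunc K} : mixedBasis A a w a = w := by
  funext j
  simp [mixedBasis]

theorem mixedBasis_of_gt {a : ℕ} {w : Fin n → RatFunc K} {k : Fin n} (h : a < k) :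
    mixedBasis A a w k = auxVec A k := by
  funext j
  simp [mixedBasis, h.not_gt, h.ne']

theorem auxBasis_succ (a : Fin n) :
    auxBasis A a (auxVec A a) = auxBasis A (a + 1) (unitVec (a + 1)) := by
  refine funext fun k => ?_
  rcases lt_trichotomy k a with h | rfl | h
  · rw [auxBasis_of_lt h, auxBasis_of_lt (Nat.lt_succ_of_lt h)]
  · rw [auxBasis_self, auxBasis_of_lt (Nat.lt_succ_self _)]
  · rw [auxBasis_of_gt h]
    rcases Nat.lt_or_eq_of_le (Nat.succ_le_of_lt h) with h' | h'
    · rw [auxBasis_of_gt h']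
    · have := auxBasis_self (A := A) (a := k) (v := unitVec k)
      rw [← show (a : ℕ) + 1 = k from h'] at this
      rw [this, show (a : ℕ) + 1 = k from h', unitVec_coe]

theorem auxBasis_last (v w : Fin n → RatFunc K) : auxBasis A n v = auxBasis A n w :=
  funext fun k => by rw [auxBasis_of_lt k.2, auxBasis_of_lt k.2]

theorem mixedBasis_succ (a : Fin n) :
    mixedBasis A a (krylovVec A a) = mixedBasis A (a + 1) (auxVec A (a + 1)) := by
  refine funext fun k => ?_
  rcases lt_trichotomy k a with h | rfl | h
  · rw [mixedBasis_of_lt h, mixedBasis_of_lt (Nat.lt_succ_of_lt h)]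
  · rw [mixedBasis_self, mixedBasis_of_lt (Nat.lt_succ_self _)]
  · rw [mixedBasis_of_gt h]
    rcases Nat.lt_or_eq_of_le (Nat.succ_le_of_lt h) with h' | h'
    · rw [mixedBasis_of_gt h']
    · have := mixedBasis_self (A := A) (a := k) (w := auxVec A k)
      rw [← show (a : ℕ) + 1 = k from h'] at this ⊢
      exact this.symm

theorem mixedBasis_last (w : Fin n → RatFunc K) :
    mixedBasis A n w = krylov (toRat A) (Pi.single 0 1) :=
  funext fun k => by rw [mixedBasis_of_lt k.2, krylov_toRat_apply]

theorem coord_vecMul_apply (b : ℕ) (x : Fin n → RatFunc K) (T : Mat n K) (l : Fin n) :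
    coord A b (Matrix.vecMul x T) l = ∑ k, x k * coord A b (T k) l := by
  rw [Matrix.vecMul_eq_sum, map_sum, Finset.sum_apply]
  simp

variable (hA : ∀ a, (krylovBasis A a).det ≠ 0)
include hA

theorem auxBasis_one : auxBasis A 1 (unitVec 1) = (1 : Mat n K) := by
  refine funext fun k => ?_
  have h1 : (1 : Mat n K) k = Pi.single k 1 := funext fun j => Matrix.one_eq_pi_single
  rw [h1]
  rcases lt_trichotomy (k : ℕ) 1 with h | h | h
  · have h0 : k = 0 := Fin.ext (by simpa using h)
    rw [auxBasis_of_lt h, show (k : ℕ) = 0 by omega, auxVec_zero hA, h0]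
  · have := auxBasis_self (A := A) (a := k) (v := unitVec k)
    rw [h] at this
    rw [this, ← h, unitVec_coe]
  · rw [auxBasis_of_gt h]

theorem mixedBasis_one (v : Fin n → RatFunc K) :
    mixedBasis A 1 (auxVec A 1) = auxBasis A n v := by
  refine funext fun k => ?_
  rw [auxBasis_of_lt k.2]
  rcases lt_trichotomy (k : ℕ) 1 with h | h | h
  · rw [mixedBasis_of_lt h, show (k : ℕ) = 0 by omega, auxVec_zero hA, krylovVec_zero]
  · have := mixedBasis_self (A := A) (a := k) (w := auxVec A k)
    rw [show (k : ℕ) = 1 from h] at this ⊢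
    exact this
  · rw [mixedBasis_of_gt h]

/-- Take the coordinate l with respect to P_l. The rows u_k with k < l lie in K_l, while all other
rows except u_l have support away from l; only x l survives. Each entry is thus isolated at once,
without back substitution. -/
theorem coord_vecMul_auxBasis_of_lt {a : ℕ} {v : Fin n → RatFunc K}
    (hv : ∀ c : Fin n, (c : ℕ) < a → v c = 0) (x : Fin n → RatFunc K) {l : Fin n}
    (hl : (l : ℕ) < a) :
    coord A l (Matrix.vecMul x (auxBasis A a v)) l = x l * auxVec A l l := by
  rw [coord_vecMul_apply, Finset.sum_eq_single l]
  · rw [auxBasis_of_lt hl, coord_auxVec_of_le hA le_rfl]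
  · intro k _ hk
    rcases lt_trichotomy (k : ℕ) a with h | rfl | h
    · rw [auxBasis_of_lt h]
      rcases lt_or_gt_of_ne hk with h' | h'
      · rw [coord_auxVec_of_lt hA h' le_rfl, mul_zero]
      · rw [coord_auxVec_of_le hA (le_of_lt h'), auxVec_of_lt A h', mul_zero]
    · rw [auxBasis_self, coord_of_support hA fun c hc => hv c (hc.trans hl), hv l hl, mul_zero]
    · rw [auxBasis_of_gt h, coord_of_support hA, Pi.single_eq_of_ne hk.symm, mul_zero]
      intro c hc
      exact Pi.single_eq_of_ne (by rintro rfl; omega) _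
  · simp

theorem coord_auxBasis_of_ge {a : Fin n} {v : Fin n → RatFunc K}
    (hv : ∀ c : Fin n, c < a → v c = 0) {l : Fin n} (hl : a ≤ l) (k : Fin n) :
    coord A a (auxBasis A a v k) l =
      if k < a then 0 else if k = a then v l else (Pi.single k 1 : Fin n → RatFunc K) l := by
  rcases lt_trichotomy k a with h | rfl | h
  · rw [auxBasis_of_lt h, coord_auxVec_of_lt hA h hl, if_pos h]
  · rw [auxBasis_self, coord_of_support hA hv, if_neg (lt_irrefl _), if_pos rfl]
  · rw [auxBasis_of_gt h, coord_of_support hA, if_neg h.not_gt, if_neg h.ne']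
    intro c hc
    exact Pi.single_eq_of_ne (ne_of_lt (lt_trans (show c < a from hc) h)) _

theorem coord_vecMul_auxBasis_self {a : Fin n} {v : Fin n → RatFunc K}
    (hv : ∀ c : Fin n, c < a → v c = 0) (x : Fin n → RatFunc K) :
    coord A a (Matrix.vecMul x (auxBasis A a v)) a = x a * v a := by
  rw [coord_vecMul_apply, Finset.sum_eq_single a]
  · rw [coord_auxBasis_of_ge hA hv le_rfl, if_neg (lt_irrefl _), if_pos rfl]
  · intro k _ hk
    rw [coord_auxBasis_of_ge hA hv le_rfl, if_neg hk, Pi.single_eq_of_ne hk.symm, ite_self,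
      mul_zero]
  · simp

/-- With respect to P_a, the rows before a have no coordinates from a on and those after a are unit
vectors, so besides the row v only row l is visible at l. -/
theorem coord_vecMul_auxBasis_of_gt {a : Fin n} {v : Fin n → RatFunc K}
    (hv : ∀ c : Fin n, c < a → v c = 0) (x : Fin n → RatFunc K) {l : Fin n} (hl : a < l) :
    coord A a (Matrix.vecMul x (auxBasis A a v)) l = x a * v l + x l := by
  rw [coord_vecMul_apply, Fintype.sum_eq_add a l hl.ne]
  · rw [coord_auxBasis_of_ge hA hv hl.le, coord_auxBasis_of_ge hA hv hl.le, if_neg (lt_irrefl _),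
      if_pos rfl, if_neg hl.not_gt, if_neg hl.ne', Pi.single_eq_same, mul_one]
  · rintro k ⟨hka, hkl⟩
    rw [coord_auxBasis_of_ge hA hv hl.le, if_neg hka, Pi.single_eq_of_ne hkl.symm, ite_self,
      mul_zero]

/-- The u_k form a triangular system with nonzero diagonal: in a vanishing combination the
coordinate formula kills each coefficient. -/
theorem isUnit_det_auxBasis_last (v : Fin n → RatFunc K) : IsUnit (auxBasis A n v).det := by
  rw [isUnit_iff_ne_zero]
  intro h
  obtain ⟨x, hx, hx0⟩ := Matrix.exists_vecMul_eq_zero_iff.mpr h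
  refine hx (funext fun l => ?_)
  rw [auxBasis_last v 0] at hx0
  have := coord_vecMul_auxBasis_of_lt hA (v := 0) (fun c _ => rfl) x l.2
  rw [hx0, map_zero, Pi.zero_apply, eq_comm, mul_eq_zero] at this
  exact this.resolve_right (auxVec_diag_ne_zero hA l)

/-- Again the coordinate l with respect to P_l: earlier rows lie in K_l and later ones have support
beyond l. The condition on z says that the row being replaced still equals u_a modulo K_a, hence has
the same leading coordinate. -/
theorem coord_vecMul_mixedBasis_of_ge {a : Fin n} {z : Fin n → RatFunc K}
    (hz : ∀ c : Fin n, a ≤ c → z c = auxVec A a c) (x : Fin n → RatFunc K) {l : Fin n}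
    (hl : a ≤ l) :
    coord A l (Matrix.vecMul x
      (mixedBasis A a (Matrix.vecMul z (toRat (krylovBasis A a))))) l = x l * auxVec A l l := by
  have hw : Matrix.vecMul z (toRat (krylovBasis A a)) ∈ krylovSpan A (a + 1) := by
    have h1 := vecMul_mem_krylovSpan (A := A) (a := a) (z := z - auxVec A a)
      fun k hk => by rw [Pi.sub_apply, hz k hk, sub_self]
    rw [Matrix.sub_vecMul,
      vecMul_krylovBasis_of_support fun k hk => auxVec_of_lt A hk] at h1
    have := add_mem (krylovSpan_mono A (Nat.le_succ _) h1) (auxVec_mem_krylovSpan hA (a : ℕ))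
    rwa [sub_add_cancel] at this
  rw [coord_vecMul_apply, Finset.sum_eq_single l]
  · rcases eq_or_lt_of_le hl with rfl | hl
    · rw [mixedBasis_self, coord_vecMul hA, hz _ le_rfl]
    · rw [mixedBasis_of_gt hl, coord_auxVec_of_le hA le_rfl]
  · intro k _ hk
    rcases lt_trichotomy k a with h | rfl | h
    · rw [mixedBasis_of_lt h, coord_apply_of_mem_krylovSpan hA
        (krylovVec_mem_krylovSpan A (lt_of_lt_of_le h hl)) le_rfl, mul_zero]
    · have hl : k < l := lt_of_le_of_ne hl hk
      rw [mixedBasis_self, coord_apply_of_mem_krylovSpan hA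
        (krylovSpan_mono A (Nat.succ_le_of_lt hl) hw) le_rfl, mul_zero]
    · rw [mixedBasis_of_gt h]
      rcases lt_or_gt_of_ne hk with h' | h'
      · rw [coord_auxVec_of_lt hA h' le_rfl, mul_zero]
      · rw [coord_auxVec_of_le hA (le_of_lt h'), auxVec_of_lt A h', mul_zero]
  · simp

/-- The first a rows are basis vectors of P_a, and the rows after a are supported beyond a; only row
l and the row under replacement contribute. -/
theorem coord_vecMul_mixedBasis_of_lt {a : Fin n} (z : Fin n → RatFunc K)
    (x : Fin n → RatFunc K) {l : Fin n} (hl : l < a) :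
    coord A a (Matrix.vecMul x
      (mixedBasis A a (Matrix.vecMul z (toRat (krylovBasis A a))))) l = x l + x a * z l := by
  rw [coord_vecMul_apply, Fintype.sum_eq_add l a hl.ne]
  · rw [mixedBasis_of_lt hl, coord_krylovVec hA hl, Pi.single_eq_same, mul_one, mixedBasis_self,
      coord_vecMul hA]
  · rintro k ⟨hkl, hka⟩
    rcases lt_or_gt_of_ne hka with h | h
    · rw [mixedBasis_of_lt h, coord_krylovVec hA h, Pi.single_eq_of_ne hkl.symm, mul_zero]
    · rw [mixedBasis_of_gt h, coord_auxVec_of_le hA (le_of_lt h),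
        auxVec_of_lt A (lt_trans hl h), mul_zero]

theorem isUnit_det_krylov : IsUnit (krylov (toRat A) (Pi.single 0 1)).det := by
  have h : krylov (toRat A) (Pi.single 0 1) = toRat (krylovBasis A n) :=
    funext fun k => by rw [krylov_toRat_apply, toRat_krylovBasis_of_lt A k.2]
  rw [h]
  exact isUnit_det_toRat_krylovBasis hA n

end Bases

/-! ## Degrees of the coordinates -/

section CoordDegree

variable {K : Type u} [Field K] {n : ℕ} [NeZero n] {A : Matrix (Fin n) (Fin n) K[X]} {d : ℕ}
  (hd : ∀ i j, (A i j).natDegree ≤ d)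
include hd

theorem vecDegLE_krylovVec {k : ℕ} (hk : k ≤ n) : VecDegLE (n * (n * d)) (krylovVec A k) :=
  vecDegLE_algebraMap fun j => (natDegree_polyKrylov_le hd k j).trans
    ((Nat.mul_le_mul_right d hk).trans (Nat.le_mul_of_pos_left _ (NeZero.pos n)))

variable (hA : ∀ a, (krylovBasis A a).det ≠ 0)
include hA

/-- Cramer's rule: the adjugate raises the numerators, and the determinant the common denominator,
by at most n · nd. -/
theorem VecDegLE.coord {N : ℕ} {x : Fin n → RatFunc K} (hx : VecDegLE N x) (a : ℕ) :
    VecDegLE (N + 2 * (n * (n * d))) (coord A a x) := by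
  have h1 := hx.vecMul (natDegree_adjugate_le (natDegree_krylovBasis_le hd a))
  have h2 := h1.div (hA a) (natDegree_det_le_of_forall_le (natDegree_krylovBasis_le hd a))
  convert h2 using 1
  · ring
  · funext j
    rw [AZ.coord, Matrix.vecMulLinear_apply, Matrix.inv_def, Matrix.vecMul_smul, det_toRat,
      adjugate_toRat, Ring.inverse_eq_inv', Pi.smul_apply, smul_eq_mul, div_eq_inv_mul]

theorem vecDegLE_auxVec {a : ℕ} (ha : a ≤ n) : VecDegLE (3 * (n * (n * d))) (auxVec A a) := by
  have h := ((vecDegLE_krylovVec hd ha).coord hd hA a).ite fun k => a ≤ (k : ℕ)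
  convert h using 1
  · ring
  · funext k
    rcases lt_or_ge (k : ℕ) a with h | h
    · rw [auxVec_of_lt A h, if_neg (not_le.mpr h)]
    · rw [auxVec_of_le A h, if_pos h]

/-- The entry at a is a quotient, the entries before a are quotients by the diagonal entries of U,
and those after a equal a coordinate minus (x a)(v l). Write H = n²d: the last case is the worst,
with (N + 2H) + (N + 5H) + 3H. -/
theorem ratDegree_le_of_vecMul_auxBasis {a : Fin n} {v : Fin n → RatFunc K}
    (hv : ∀ c : Fin n, c < a → v c = 0) (hva : v a ≠ 0) (hvd : VecDegLE (3 * (n * (n * d))) v)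
    {N : ℕ} {x y : Fin n → RatFunc K} (hy : VecDegLE N y)
    (h : Matrix.vecMul x (auxBasis A a v) = y) (l : Fin n) :
    ratDegree (x l) ≤ 2 * N + 10 * (n * (n * d)) := by
  have ha := coord_vecMul_auxBasis_self hA hv x
  rw [h, ← div_eq_iff hva] at ha
  have hax := ratDegree_div_le_add ((hy.coord hd hA a).apply a) (hvd.apply a)
  rw [ha] at hax
  rcases lt_trichotomy l a with hl | rfl | hl
  · have := coord_vecMul_auxBasis_of_lt hA hv x hl
    rw [h, ← div_eq_iff (auxVec_diag_ne_zero hA l)] at this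
    rw [← this]
    exact (ratDegree_div_le_add ((hy.coord hd hA l).apply l)
      ((vecDegLE_auxVec hd hA l.2.le).apply l)).trans (by omega)
  · exact hax.trans (by omega)
  · have := coord_vecMul_auxBasis_of_gt hA hv x hl
    rw [h, ← sub_eq_iff_eq_add'] at this
    rw [← this]
    exact (ratDegree_sub_le ((hy.coord hd hA a).apply l)
      (ratDegree_mul_le hax (hvd.apply l))).trans (by omega)

/-- Here the entries from a on are quotients of degree N + 5H, where H = n²d, and those before a
equal a coordinate minus (x a)(z l). -/
theorem ratDegree_le_of_vecMul_mixedBasis {a : Fin n} {z : Fin n → RatFunc K}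
    (hz : ∀ c : Fin n, a ≤ c → z c = auxVec A a c) (hzd : VecDegLE (3 * (n * (n * d))) z)
    {N : ℕ} {x y : Fin n → RatFunc K} (hy : VecDegLE N y)
    (h : Matrix.vecMul x
      (mixedBasis A a (Matrix.vecMul z (toRat (krylovBasis A a)))) = y) (l : Fin n) :
    ratDegree (x l) ≤ 2 * N + 10 * (n * (n * d)) := by
  have hge : ∀ l, a ≤ l → ratDegree (x l) ≤ N + 5 * (n * (n * d)) := fun l hl => by
    have := coord_vecMul_mixedBasis_of_ge hA hz x hl
    rw [h, ← div_eq_iff (auxVec_diag_ne_zero hA l)] at this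
    rw [← this]
    exact (ratDegree_div_le_add ((hy.coord hd hA l).apply l)
      ((vecDegLE_auxVec hd hA l.2.le).apply l)).trans (by omega)
  rcases lt_or_ge l a with hl | hl
  · have := coord_vecMul_mixedBasis_of_lt hA z x hl
    rw [h, ← sub_eq_iff_eq_add] at this
    rw [← this]
    exact (ratDegree_sub_le ((hy.coord hd hA a).apply l)
      (ratDegree_mul_le (hge a le_rfl) (hzd.apply l))).trans (by omega)
  · exact (hge l hl).trans (by omega)

theorem ratDegree_le_of_vecMul_auxBasis_last {N : ℕ} {v x y : Fin n → RatFunc K}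
    (hy : VecDegLE N y) (h : Matrix.vecMul x (auxBasis A n v) = y) (l : Fin n) :
    ratDegree (x l) ≤ N + 5 * (n * (n * d)) := by
  have := coord_vecMul_auxBasis_of_lt hA (v := 0) (fun c _ => rfl) x l.2
  rw [auxBasis_last 0 v, h, ← div_eq_iff (auxVec_diag_ne_zero hA l)] at this
  rw [← this]
  exact (ratDegree_div_le_add ((hy.coord hd hA l).apply l)
    ((vecDegLE_auxVec hd hA l.2.le).apply l)).trans (by omega)

end CoordDegree

end AZ

namespace AZ

/-! ## Specifications of computations with rational functions -/

namespace Traced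

variable {K : Type u} [Field K] {α β : Type u}

/-- The computation executes at most `N` steps, all with operands of degree at most `D`, and
its value has the property `P`. -/
def Spec (x : Traced K α) (N D : ℕ) (P : α → Prop) : Prop :=
  x.trace.length ≤ N ∧ (∀ st ∈ x.trace, st.DegLE D) ∧ P x.val

theorem Spec.pure {a : α} {N D : ℕ} {P : α → Prop} (h : P a) :
    Spec (Pure.pure a : Traced K α) N D P :=
  ⟨Nat.zero_le _, fun _ hst => absurd hst List.not_mem_nil, h⟩

theorem Spec.bind {x : Traced K α} {f : α → Traced K β} {N₁ N₂ D : ℕ} {P : α → Prop}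
    {Q : β → Prop} (hx : Spec x N₁ D P) (hf : ∀ a, P a → Spec (f a) N₂ D Q) :
    Spec (x >>= f) (N₁ + N₂) D Q := by
  obtain ⟨h1, h2, h3⟩ := hx
  obtain ⟨h4, h5, h6⟩ := hf x.val h3
  refine ⟨?_, fun st hst => ?_, h6⟩
  · exact (List.length_append).trans_le (add_le_add h1 h4)
  · exact (List.mem_append.mp hst).elim (h2 st) (h5 st)

theorem Spec.mono {x : Traced K α} {N N' D : ℕ} {P Q : α → Prop} (hx : Spec x N D P)
    (hN : N ≤ N') (hPQ : ∀ a, P a → Q a) : Spec x N' D Q :=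
  ⟨hx.1.trans hN, hx.2.1, hPQ _ hx.2.2⟩

theorem Spec.exec {o : RatOp} {f g : RatFunc K} {D : ℕ} (hf : ratDegree f ≤ D)
    (hg : ratDegree g ≤ D) : Spec (exec o f g) 1 D fun x => x = o.eval f g :=
  ⟨le_rfl, fun st hst => by
    rw [List.mem_singleton.mp hst]
    exact ⟨hf, hg⟩, rfl⟩

theorem Spec.isZero (f : RatFunc K) (D : ℕ) :
    Spec (isZero f) 1 D fun b => b.down = true ↔ f = 0 :=
  ⟨le_rfl, fun st hst => by
    rw [List.mem_singleton.mp hst]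
    trivial, by simp [AZ.isZero]⟩

/-- The invariant refers to the part of the list already processed, which allows half-finished rows
and columns to be described. -/
theorem Spec.foldlM {ι : Type*} {f : α → ι → Traced K α} {N D : ℕ} {Inv : List ι → α → Prop}
    {l : List ι} {a : α} (h0 : Inv [] a)
    (hf : ∀ l₁ i l₂ a, l = l₁ ++ i :: l₂ → Inv l₁ a → Spec (f a i) N D (Inv (l₁ ++ [i]))) :
    Spec (l.foldlM f a) (l.length * N) D (Inv l) := by
  have key : ∀ (l₂ l₁ : List ι) (a : α), l = l₁ ++ l₂ → Inv l₁ a →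
      Spec (l₂.foldlM f a) (l₂.length * N) D (Inv l) := by
    intro l₂
    induction l₂ with
    | nil =>
      intro l₁ a hl ha
      rw [List.append_nil] at hl
      rw [hl]
      exact Spec.pure ha
    | cons i l₂ ih =>
      intro l₁ a hl ha
      rw [List.foldlM_cons, List.length_cons, Nat.succ_mul, add_comm]
      exact Spec.bind (hf l₁ i l₂ a hl ha) fun b hb =>
        ih (l₁ ++ [i]) b (by rw [hl, List.append_assoc]; rfl) hb
  exact key l [] a rfl h0

end Traced

open Traced

section RowOperations

variable {K : Type u} [Field K] {n : ℕ}

theorem setEntry_apply (B : Mat n K) (i j : Fin n) (x : RatFunc K) (r c : Fin n) :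
    setEntry B i j x r c = if r = i ∧ c = j then x else B r c := by
  rw [setEntry, Matrix.updateRow_apply]
  by_cases hr : r = i
  · subst hr
    simp [Function.update_apply]
  · simp [hr]

theorem not_mem_of_finRange_eq {l₁ l₂ : List (Fin n)} {c : Fin n}
    (h : List.finRange n = l₁ ++ c :: l₂) : c ∉ l₁ := by
  have := List.nodup_finRange n
  rw [h, List.nodup_append] at this
  exact fun hc => this.2.2 c hc c List.mem_cons_self rfl

/-- Overwriting in place is harmless: row j is never touched since i ≠ j, and each column is visited
once. -/
theorem spec_addRow {B : Mat n K} {i j : Fin n} (hij : i ≠ j) {t : RatFunc K} {a b D : ℕ}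
    (ht : ratDegree t ≤ a) (hB : ∀ r c, ratDegree (B r c) ≤ b) (hD : a + b ≤ D) :
    Spec (addRow B i j t) (n * 2) D fun B' =>
      ∀ r c, B' r c = if r = i then B i c + t * B j c else B r c := by
  have := Spec.foldlM (K := K) (N := 2) (D := D) (l := List.finRange n) (a := B)
    (f := fun B c => do
      let x ← exec .mul t (B j c)
      let y ← exec .add (B i c) x
      return setEntry B i c y)
    (Inv := fun l B' => ∀ r c, B' r c = if r = i ∧ c ∈ l then B i c + t * B j c else B r c)
    (by simp) ?_
  · refine Spec.mono this (by rw [List.length_finRange]) fun B' h r c => ?_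
    simpa using h r c
  · intro l₁ c₀ l₂ B' hl hB'
    have hc := not_mem_of_finRange_eq hl
    have h1 : B' j c₀ = B j c₀ := by rw [hB', if_neg fun h => hij h.1.symm]
    have h2 : B' i c₀ = B i c₀ := by rw [hB', if_neg fun h => hc h.2]
    refine Spec.bind (N₁ := 1) (N₂ := 1) (Spec.exec (ht.trans (by omega)) ?_) fun x hx =>
      Spec.bind (N₁ := 1) (N₂ := 0) (Spec.exec ?_ ?_) fun y hy => Spec.pure fun r c => ?_
    · rw [h1]
      exact (hB _ _).trans (by omega)
    · rw [h2]
      exact (hB _ _).trans (by omega)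
    · rw [hx, h1]
      exact (ratDegree_mul_le ht (hB _ _)).trans hD
    · rw [setEntry_apply, hy, hx, h1, h2, hB']
      by_cases hr : r = i
      · subst hr
        by_cases hcc : c = c₀
        · simp [hcc, RatOp.eval]
        · simp [hcc]
      · simp [hr]

theorem spec_subCol {B : Mat n K} {i j : Fin n} (hij : i ≠ j) {t : RatFunc K} {a b D : ℕ}
    (ht : ratDegree t ≤ a) (hB : ∀ r c, ratDegree (B r c) ≤ b) (hD : b + a ≤ D) :
    Spec (subCol B i j t) (n * 2) D fun B' =>
      ∀ r c, B' r c = if c = j then B r j - B r i * t else B r c := by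
  have := Spec.foldlM (K := K) (N := 2) (D := D) (l := List.finRange n) (a := B)
    (f := fun B r => do
      let x ← exec .mul (B r i) t
      let y ← exec .sub (B r j) x
      return setEntry B r j y)
    (Inv := fun l B' => ∀ r c, B' r c = if c = j ∧ r ∈ l then B r j - B r i * t else B r c)
    (by simp) ?_
  · refine Spec.mono this (by rw [List.length_finRange]) fun B' h r c => ?_
    simpa using h r c
  · intro l₁ r₀ l₂ B' hl hB'
    have hc := not_mem_of_finRange_eq hl
    have h1 : B' r₀ i = B r₀ i := by rw [hB', if_neg fun h => hij h.1]
    have h2 : B' r₀ j = B r₀ j := by rw [hB', if_neg fun h => hc h.2]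
    refine Spec.bind (N₁ := 1) (N₂ := 1) (Spec.exec ?_ (ht.trans (by omega))) fun x hx =>
      Spec.bind (N₁ := 1) (N₂ := 0) (Spec.exec ?_ ?_) fun y hy => Spec.pure fun r c => ?_
    · rw [h1]
      exact (hB _ _).trans (by omega)
    · rw [h2]
      exact (hB _ _).trans (by omega)
    · rw [hx, h1]
      exact (ratDegree_mul_le (hB _ _) ht).trans hD
    · rw [setEntry_apply, hy, hx, h1, h2, hB']
      by_cases hr : c = j
      · subst hr
        by_cases hcc : r = r₀
        · simp [hcc, RatOp.eval]
        · simp [hcc]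
      · simp [hr]

theorem spec_scaleRow {B : Mat n K} {i : Fin n} {p : RatFunc K} {a b D : ℕ}
    (hp : ratDegree p ≤ a) (hB : ∀ r c, ratDegree (B r c) ≤ b) (hD : a + b ≤ D) :
    Spec (scaleRow B i p) n D fun B' => ∀ r c, B' r c = if r = i then p * B i c else B r c := by
  have := Spec.foldlM (K := K) (N := 1) (D := D) (l := List.finRange n) (a := B)
    (f := fun B c => do
      let x ← exec .mul p (B i c)
      return setEntry B i c x)
    (Inv := fun l B' => ∀ r c, B' r c = if r = i ∧ c ∈ l then p * B i c else B r c)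
    (by simp) ?_
  · refine Spec.mono this (by rw [List.length_finRange, mul_one]) fun B' h r c => ?_
    simpa using h r c
  · intro l₁ c₀ l₂ B' hl hB'
    have hc := not_mem_of_finRange_eq hl
    have h2 : B' i c₀ = B i c₀ := by rw [hB', if_neg fun h => hc h.2]
    refine Spec.bind (N₁ := 1) (N₂ := 0) (Spec.exec (hp.trans (by omega)) ?_) fun x hx =>
      Spec.pure fun r c => ?_
    · rw [h2]
      exact (hB _ _).trans (by omega)
    · rw [setEntry_apply, hx, h2, hB']
      by_cases hr : r = i
      · subst hr
        by_cases hcc : c = c₀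
        · simp [hcc, RatOp.eval]
        · simp [hcc]
      · simp [hr]

theorem spec_divCol {B : Mat n K} {i : Fin n} {p : RatFunc K} {a b D : ℕ}
    (hp : ratDegree p ≤ a) (hB : ∀ r c, ratDegree (B r c) ≤ b) (hD : a + b ≤ D) :
    Spec (divCol B i p) n D fun B' => ∀ r c, B' r c = if c = i then B r i / p else B r c := by
  have := Spec.foldlM (K := K) (N := 1) (D := D) (l := List.finRange n) (a := B)
    (f := fun B r => do
      let x ← exec .div (B r i) p
      return setEntry B r i x)
    (Inv := fun l B' => ∀ r c, B' r c = if c = i ∧ r ∈ l then B r i / p else B r c)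
    (by simp) ?_
  · refine Spec.mono this (by rw [List.length_finRange, mul_one]) fun B' h r c => ?_
    simpa using h r c
  · intro l₁ r₀ l₂ B' hl hB'
    have hc := not_mem_of_finRange_eq hl
    have h2 : B' r₀ i = B r₀ i := by rw [hB', if_neg fun h => hc h.2]
    refine Spec.bind (N₁ := 1) (N₂ := 0) (Spec.exec ?_ (hp.trans (by omega))) fun x hx =>
      Spec.pure fun r c => ?_
    · rw [h2]
      exact (hB _ _).trans (by omega)
    · rw [setEntry_apply, hx, h2, hB']
      by_cases hr : c = i
      · subst hr
        by_cases hcc : r = r₀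
        · simp [hcc, RatOp.eval]
        · simp [hcc]
      · simp [hr]

end RowOperations

/-! ### Pivot operations as gauge transformations -/

section Pivots

variable {K : Type u} [Field K] {n : ℕ}

/-- The system is the one for the unknowns given by the rows of `T`, and `trans` leads to these
from those given by the rows of `U`. -/
structure State.IsGauge (s : State n K) (M U T : Mat n K) : Prop where
  trans_mul : s.trans * U = T
  sys_mul : s.sys * T = T * M + T.map ratDeriv

/-- Composition of gauge transformations in a form without inverses: (B'E)T = (EB + E')T = E(TM +
T') + E'T = (ET)M + (ET)'. -/
theorem mul_gauge {M B B' E T : Mat n K} (hB : B * T = T * M + T.map ratDeriv)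
    (hE : B' * E = E * B + E.map ratDeriv) :
    B' * (E * T) = E * T * M + (E * T).map ratDeriv := by
  rw [← Matrix.mul_assoc, hE, map_ratDeriv_mul, Matrix.add_mul, Matrix.mul_assoc, hB,
    Matrix.mul_add, Matrix.mul_assoc]
  abel

theorem transvection_mul_row (i j : Fin n) (t : RatFunc K) (T : Mat n K) :
    Matrix.transvection i j t * T = T.updateRow i (T i + t • T j) := by
  ext r c
  by_cases hr : r = i
  · subst hr
    simp
  · rw [Matrix.transvection_mul_apply_of_ne _ _ _ _ hr, Matrix.updateRow_ne hr]

/-- For E = 1 + t·E_ij with i ≠ j one has E' = t'·E_ij and E'E = E', hence E[B] = EBE⁻¹ + E': the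
derivative of t may be added after both the row and the column operation. Degrees grow from D to 3D
and 7D within one pivot operation. -/
theorem spec_pivotAdd {s : State n K} {M U T : Mat n K} (hs : s.IsGauge M U T) {i j : Fin n}
    (hij : i ≠ j) {t : RatFunc K} {D : ℕ} (ht : ratDegree t ≤ D)
    (hsys : ∀ r c, ratDegree (s.sys r c) ≤ D) (htrans : ∀ r c, ratDegree (s.trans r c) ≤ D) :
    Spec (pivotAdd s i j t) (6 * n + 2) (8 * D) fun s' =>
      s'.len = s.len ∧ s'.IsGauge M U (T.updateRow i (T i + t • T j)) := by
  refine Spec.mono (N := n * 2 + (n * 2 + (1 + (1 + (n * 2 + 0))))) (?_ : Spec _ _ _ fun s' =>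
      s'.len = s.len ∧ s'.IsGauge M U (T.updateRow i (T i + t • T j)))
    (by omega) fun _ h => h
  rw [pivotAdd]
  refine Spec.bind (spec_addRow hij ht hsys (by omega)) fun B₁ hB₁ => ?_
  have hd₁ : ∀ r c, ratDegree (B₁ r c) ≤ 3 * D := fun r c => by
    rw [hB₁]
    split_ifs
    · exact (ratDegree_add_le (hsys _ _) (ratDegree_mul_le ht (hsys _ _))).trans (by omega)
    · exact (hsys _ _).trans (by omega)
  refine Spec.bind (spec_subCol hij ht hd₁ (by omega)) fun B₂ hB₂ => ?_
  refine Spec.bind (Spec.exec (ht.trans (by omega)) (by simp)) fun t' ht' => ?_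
  have hd₂ : ratDegree (B₂ i j) ≤ 7 * D := by
    rw [hB₂, if_pos rfl]
    exact (ratDegree_sub_le (hd₁ _ _) (ratDegree_mul_le (hd₁ _ _) ht)).trans (by omega)
  have hdt : ratDegree t' ≤ 2 * D := by
    rw [ht']
    exact (ratDegree_ratDeriv_le ht).trans (by omega)
  refine Spec.bind (Spec.exec (hd₂.trans (by omega)) (hdt.trans (by omega))) fun b hb => ?_
  refine Spec.bind (spec_addRow hij ht htrans (by omega)) fun T' hT' => Spec.pure ⟨rfl, ?_, ?_⟩
  · have h : T' = Matrix.transvection i j t * s.trans := by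
      ext r c
      rw [transvection_mul_row, Matrix.updateRow_apply, hT']
      split_ifs <;> simp
    dsimp only
    rw [h, Matrix.mul_assoc, hs.trans_mul, transvection_mul_row]
  · rw [← transvection_mul_row]
    refine mul_gauge hs.sys_mul ?_
    have h : setEntry B₂ i j b = Matrix.transvection i j t * s.sys * Matrix.transvection i j (-t) +
        Matrix.single i j (ratDeriv t) := by
      ext r c
      have hone : ∀ r c, (Matrix.transvection i j t * s.sys) r c = B₁ r c := fun r c => by
        rw [transvection_mul_row, Matrix.updateRow_apply, hB₁]
        split_ifs <;> simp
      rw [setEntry_apply, hb, ht', Matrix.add_apply]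
      have htwo : (Matrix.transvection i j t * s.sys * Matrix.transvection i j (-t)) r c =
          B₂ r c := by
        rw [hB₂]
        split_ifs with hc
        · subst hc
          rw [Matrix.mul_transvection_apply_same, hone, hone]
          ring
        · rw [Matrix.mul_transvection_apply_of_ne _ _ _ _ hc, hone]
      rw [htwo, Matrix.single_apply]
      by_cases h : r = i ∧ c = j
      · obtain ⟨rfl, rfl⟩ := h
        simp [RatOp.eval]
      · rw [if_neg h, if_neg fun h' => h ⟨h'.1.symm, h'.2.symm⟩, add_zero]
    have h2 : (Matrix.transvection i j t).map ratDeriv = Matrix.single i j (ratDeriv t) := by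
      ext r c
      rw [Matrix.map_apply, Matrix.transvection, Matrix.add_apply, ratDeriv_add, Matrix.one_apply,
        Matrix.single_apply, Matrix.single_apply]
      split_ifs <;> simp
    have h3 : Matrix.single i j (ratDeriv t) * Matrix.transvection i j t =
        Matrix.single i j (ratDeriv t) := by
      rw [Matrix.transvection, Matrix.mul_add, Matrix.mul_one,
        Matrix.single_mul_single_of_ne _ _ _ _ hij.symm, add_zero]
    dsimp only
    rw [h, h2, Matrix.add_mul, Matrix.mul_assoc, h3,
      Matrix.transvection_mul_transvection_same _ _ hij, neg_add_cancel, Matrix.transvection_zero,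
      Matrix.mul_one]

/-- Here E'E⁻¹ has the diagonal entry p'/p, so p' is added before the column is divided by p. -/
theorem spec_pivotScale {s : State n K} {M U T : Mat n K} (hs : s.IsGauge M U T) {i : Fin n}
    {p : RatFunc K} (hp0 : p ≠ 0) {D : ℕ} (hp : ratDegree p ≤ D)
    (hsys : ∀ r c, ratDegree (s.sys r c) ≤ D) (htrans : ∀ r c, ratDegree (s.trans r c) ≤ D) :
    Spec (pivotScale s i p) (3 * n + 2) (8 * D) fun s' =>
      s'.len = s.len ∧ s'.IsGauge M U (T.updateRow i (p • T i)) := by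
  refine Spec.mono (N := n + (1 + (1 + (n + (n + 0))))) (?_ : Spec _ _ _ fun s' =>
      s'.len = s.len ∧ s'.IsGauge M U (T.updateRow i (p • T i)))
    (by omega) fun _ h => h
  have hrow : ∀ T : Mat n K, Matrix.diagonal (Function.update 1 i p) * T =
      T.updateRow i (p • T i) := fun T => by
    ext r c
    rw [Matrix.diagonal_mul, Matrix.updateRow_apply, Function.update_apply]
    split_ifs with h
    · rw [h]
      rfl
    · rw [Pi.one_apply, one_mul]
  rw [pivotScale]
  refine Spec.bind (spec_scaleRow hp hsys (by omega)) fun B₁ hB₁ => ?_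
  have hd₁ : ∀ r c, ratDegree (B₁ r c) ≤ 2 * D := fun r c => by
    rw [hB₁]
    split_ifs
    · exact (ratDegree_mul_le hp (hsys _ _)).trans (by omega)
    · exact (hsys _ _).trans (by omega)
  refine Spec.bind (Spec.exec (hp.trans (by omega)) (by simp)) fun p' hp' => ?_
  have hdp : ratDegree p' ≤ 2 * D := by
    rw [hp']
    exact (ratDegree_ratDeriv_le hp).trans (by omega)
  refine Spec.bind (Spec.exec ((hd₁ _ _).trans (by omega)) (hdp.trans (by omega))) fun b hb => ?_
  have hdb : ratDegree b ≤ 4 * D := by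
    rw [hb]
    exact (ratDegree_add_le (hd₁ _ _) hdp).trans (by omega)
  have hd₂ : ∀ r c, ratDegree (setEntry B₁ i i b r c) ≤ 4 * D := fun r c => by
    rw [setEntry_apply]
    split_ifs
    · exact hdb
    · exact (hd₁ _ _).trans (by omega)
  refine Spec.bind (spec_divCol hp hd₂ (by omega)) fun B₂ hB₂ => ?_
  refine Spec.bind (spec_scaleRow hp htrans (by omega)) fun T' hT' => Spec.pure ⟨rfl, ?_, ?_⟩
  · have h : T' = Matrix.diagonal (Function.update 1 i p) * s.trans := by
      ext r c
      rw [hrow, Matrix.updateRow_apply, hT']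
      rfl
    dsimp only
    rw [h, Matrix.mul_assoc, hs.trans_mul, hrow]
  · rw [← hrow]
    refine mul_gauge hs.sys_mul ?_
    ext r c
    dsimp only
    rw [hrow, Matrix.mul_diagonal, Matrix.add_apply, Matrix.updateRow_apply, Matrix.map_apply,
      Matrix.diagonal_apply, hB₂, setEntry_apply, setEntry_apply, hB₁, hB₁, hb, hp',
      Function.update_apply, Function.update_apply]
    simp only [RatOp.eval, hB₁, Pi.one_apply, Pi.smul_apply, smul_eq_mul]
    by_cases hc : c = i
    · subst hc
      by_cases hr : r = c
      · subst hr
        simp [hp0]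
      · simp [hr, hp0]
    · by_cases hr : r = i
      · subst hr
        simp [hc, Ne.symm hc]
      · by_cases hrc : r = c
        · simp [hc, hrc]
        · simp [hr, hc, hrc]

theorem pivotSwap_self (s : State n K) (i : Fin n) : pivotSwap s i i = s := by
  simp [pivotSwap]

/-- In an increasing list the index j, being minimal, comes first, so the search ends after a single
zero test and the exchange is trivial. -/
theorem spec_findPivot {B : Mat n K} {i j : Fin n} (hij : B i j ≠ 0) {l : List (Fin n)}
    (hj : j ∈ l) (hl : l.Pairwise (· < ·)) (hle : ∀ c ∈ l, j ≤ c) (D : ℕ) :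
    Spec (findPivot B i l) 1 D fun o => o = ⟨some j⟩ := by
  cases l with
  | nil => exact absurd hj List.not_mem_nil
  | cons c l =>
    have hc : j = c := by
      rcases List.mem_cons.mp hj with h | h
      · exact h
      · exact absurd (hle c List.mem_cons_self)
          (not_le.mpr ((List.pairwise_cons.mp hl).1 j h))
    subst hc
    rw [findPivot]
    refine Spec.bind (N₁ := 1) (N₂ := 0) (Spec.isZero _ _) fun b hb => ?_
    rw [if_neg fun h => hij (hb.mp h)]
    exact Spec.pure rfl

end Pivots

end AZ

namespace AZ

open Traced

/-! ## The first step -/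

section StepOne

variable {K : Type u} [Field K] {n : ℕ} [NeZero n] {A : Matrix (Fin n) (Fin n) K[X]} {d : ℕ}

/-- The restriction of `auxVec A a` to the index `a` and the indices in `S`. -/
noncomputable def auxPart (A : Matrix (Fin n) (Fin n) K[X]) (a : Fin n) (S : List (Fin n)) :
    Fin n → RatFunc K :=
  fun c => if c = a ∨ c ∈ S then auxVec A a c else 0

theorem auxPart_of_lt (a : Fin n) (S : List (Fin n)) (c : Fin n) (hc : c < a) :
    auxPart A a S c = 0 := by
  rw [auxPart]
  split_ifs
  · exact auxVec_of_lt A hc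
  · rfl

theorem auxPart_self (a : Fin n) (S : List (Fin n)) : auxPart A a S a = auxVec A a a :=
  if_pos (Or.inl rfl)

theorem auxPart_nil (a : Fin n) : auxPart A a [] = auxVec A a a • Pi.single a 1 := by
  funext c
  by_cases hc : c = a
  · subst hc
    simp [auxPart]
  · simp [auxPart, hc]

theorem auxPart_append {a c : Fin n} {S : List (Fin n)} (hca : c ≠ a) (hc : c ∉ S) :
    auxPart A a (S ++ [c]) = auxPart A a S + auxVec A a c • Pi.single c 1 := by
  funext l
  by_cases hl : l = c
  · subst hl
    simp [auxPart, hca, hc]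
  · simp [auxPart, hl]

theorem auxPart_filter (a : Fin n) :
    auxPart A a ((List.finRange n).filter (a < ·)) = auxVec A a := by
  funext c
  rw [auxPart]
  split_ifs with h
  · rfl
  · have h : c < a := by
      simp only [List.mem_filter, List.mem_finRange, true_and, decide_eq_true_eq, not_or] at h
      exact lt_of_le_of_ne (not_lt.mp h.2) h.1
    exact (auxVec_of_lt A h).symm

omit [NeZero n] in
theorem map_ratDeriv_one : (1 : Mat n K).map ratDeriv = 0 := by
  ext i j
  rw [Matrix.map_apply, Matrix.one_apply]
  split_ifs <;> simp

omit [NeZero n] in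
theorem State.IsGauge.vecMul_sys {s : State n K} {M U T : Mat n K} (hs : s.IsGauge M U T)
    (r : Fin n) : Matrix.vecMul (s.sys r) T = delta M (T r) := by
  rw [← mul_add_map_ratDeriv_apply, ← hs.sys_mul]
  rfl

theorem updateRow_auxBasis (a : Fin n) (v w : Fin n → RatFunc K) :
    (auxBasis A a v).updateRow a w = auxBasis A a w := by
  refine funext fun k => ?_
  rcases lt_trichotomy k a with h | rfl | h
  · rw [Matrix.updateRow_ne h.ne, auxBasis_of_lt h, auxBasis_of_lt h]
  · rw [Matrix.updateRow_self, auxBasis_self]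
  · rw [Matrix.updateRow_ne h.ne', auxBasis_of_gt h, auxBasis_of_gt h]

variable (hd : ∀ i j, (A i j).natDegree ≤ d) (hA : ∀ a, (krylovBasis A a).det ≠ 0)
include hA

theorem coord_delta_auxVec {i a : Fin n} (hia : (i : ℕ) + 1 = a) {l : Fin n} (hl : a ≤ l) :
    coord A a (delta (toRat A) (auxVec A i)) l = auxVec A a l := by
  have h := coord_apply_of_mem_krylovSpan hA (delta_auxVec_sub_mem hA i)
    (l := l) (hia.trans_le hl)
  rwa [map_sub, hia, coord_auxVec_of_le hA le_rfl, Pi.sub_apply, sub_eq_zero] at h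

/-- Row i of the system expresses δ(u_i) in the current unknowns, and δ(u_i) ≡ u_a modulo K_a;
comparison of coordinates with respect to P_a shows that the entries used as pivots are entries of
u_a. -/
theorem sys_mul_of_auxBasis {s : State n K} {U : Mat n K} {i a : Fin n} (hia : (i : ℕ) + 1 = a)
    {v : Fin n → RatFunc K} (hv : ∀ c : Fin n, c < a → v c = 0)
    (hs : s.IsGauge (toRat A) U (auxBasis A a v)) : s.sys i a * v a = auxVec A a a := by
  rw [← coord_vecMul_auxBasis_self hA hv, hs.vecMul_sys, auxBasis_of_lt (hia ▸ Nat.lt_succ_self _),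
    coord_delta_auxVec hA hia le_rfl]

theorem sys_apply_of_auxBasis {s : State n K} {U : Mat n K} {i a : Fin n} (hia : (i : ℕ) + 1 = a)
    {v : Fin n → RatFunc K} (hv : ∀ c : Fin n, c < a → v c = 0)
    (hs : s.IsGauge (toRat A) U (auxBasis A a v)) {l : Fin n} (hl : a < l) :
    s.sys i a * v l + s.sys i l = auxVec A a l := by
  rw [← coord_vecMul_auxBasis_of_gt hA hv _ hl, hs.vecMul_sys,
    auxBasis_of_lt (hia ▸ Nat.lt_succ_self _), coord_delta_auxVec hA hia hl.le]

include hd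

theorem vecDegLE_auxBasis {a : Fin n} {v : Fin n → RatFunc K}
    (hvd : VecDegLE (3 * (n * (n * d))) v) (k : Fin n) :
    VecDegLE (3 * (n * (n * d))) (auxBasis A a v k) := by
  rcases lt_trichotomy k a with h | rfl | h
  · rw [auxBasis_of_lt h]
    exact vecDegLE_auxVec hd hA k.2.le
  · rwa [auxBasis_self]
  · rw [auxBasis_of_gt h]
    exact vecDegLE_single k _

omit hA hd in
theorem le_mul_mul_self (n d : ℕ) [NeZero n] : d ≤ n * (n * d) :=
  (Nat.le_mul_of_pos_left _ (NeZero.pos n)).trans (Nat.le_mul_of_pos_left _ (NeZero.pos n))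

/-- With H = n²d, rows of degree 3H have images under δ of degree 6H + d, so the system has degree
2(6H + d) + 10H ≤ 24H. The bound 28H is the one that Step 2 requires, where rows have degree 4H. -/
theorem ratDegree_of_auxBasis {s : State n K} {a : Fin n}
    {v : Fin n → RatFunc K} (hv : ∀ c : Fin n, c < a → v c = 0) (hva : v a ≠ 0)
    (hvd : VecDegLE (3 * (n * (n * d))) v)
    (hs : s.IsGauge (toRat A) 1 (auxBasis A a v)) :
    (∀ r c, ratDegree (s.sys r c) ≤ 28 * (n * (n * d))) ∧
      ∀ r c, ratDegree (s.trans r c) ≤ 28 * (n * (n * d)) := by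
  refine ⟨fun r c => ?_, fun r c => ?_⟩
  · have h := ratDegree_le_of_vecMul_auxBasis hd hA hv hva hvd
      ((vecDegLE_auxBasis hd hA hvd r).delta hd) (hs.vecMul_sys r) c
    have := le_mul_mul_self n d
    exact h.trans (by omega)
  · rw [← Matrix.mul_one s.trans, hs.trans_mul]
    exact ((vecDegLE_auxBasis hd hA hvd r).apply c).trans (by omega)

theorem vecDegLE_auxPart (a : Fin n) (S : List (Fin n)) :
    VecDegLE (3 * (n * (n * d))) (auxPart A a S) :=
  (vecDegLE_auxVec hd hA a.2.le).ite _

/-- Scaling by the pivot makes the new row the entry of u_a at a times the unit vector, and each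
further pivot operation adds one more entry of u_a. The steps number 1 + (3n + 2) + n(6n + 2) ≤
14n²; the operand bound is 8 · 28 = 224 times n²d. -/
theorem spec_introduce {s : State n K} {i a : Fin n} (hia : (i : ℕ) + 1 = a) (hlen : s.len = a)
    (hs : s.IsGauge (toRat A) 1 (auxBasis A a (unitVec a))) :
    Spec (introduce s i) (14 * n ^ 2) (224 * (n * (n * d))) fun s' =>
      s'.len = (a : ℕ) + 1 ∧ s'.IsGauge (toRat A) 1 (auxBasis A (a + 1) (unitVec (a + 1))) := by
  have hi : (i : ℕ) + 1 < n := hia ▸ a.2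
  have hnext : (⟨i + 1, hi⟩ : Fin n) = a := Fin.ext hia
  have hn := NeZero.pos n
  have hia' : i < a := Fin.lt_def.mpr (by omega)
  have hv : ∀ c : Fin n, c < a → (unitVec a : Fin n → RatFunc K) c = 0 := fun c hc =>
    if_neg (Fin.val_ne_of_ne hc.ne)
  have hva : (unitVec a : Fin n → RatFunc K) a = 1 := if_pos rfl
  have hpiv := sys_mul_of_auxBasis hA hia hv hs
  rw [hva, mul_one] at hpiv
  have hpiv0 := auxVec_diag_ne_zero hA a
  obtain ⟨hdeg, hdegt⟩ := ratDegree_of_auxBasis hd hA hv (by rw [hva]; exact one_ne_zero)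
    (by rw [unitVec_coe]; exact vecDegLE_single a _) hs
  rw [introduce, dif_pos hi, if_pos (hlen.trans hia.symm)]
  dsimp only
  rw [hnext]
  refine Spec.mono (N := 1 + ((3 * n + 2) + (n * (6 * n + 2) + 0))) (P := fun s' =>
      s'.len = (a : ℕ) + 1 ∧ s'.IsGauge (toRat A) 1 (auxBasis A (a + 1) (unitVec (a + 1))))
      ?_ (by nlinarith) fun _ h => h
  refine Spec.bind (spec_findPivot (j := a) (by rw [hpiv]; exact hpiv0) ?_ ?_ ?_ _) fun o ho => ?_
  · simpa using hia'
  · exact (List.pairwise_lt_finRange n).filter _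
  · intro c hc
    simp only [List.mem_filter, List.mem_finRange, true_and, decide_eq_true_eq] at hc
    exact Fin.le_def.mpr (hia ▸ Nat.succ_le_of_lt hc)
  subst ho
  dsimp only
  rw [pivotSwap_self]
  refine Spec.bind (P := fun s' : State n K => s'.len = a ∧
    s'.IsGauge (toRat A) 1 (auxBasis A a (auxPart A a []))) ?_ fun s₁ hs₁ => ?_
  · have h := spec_pivotScale hs (i := a) (p := s.sys i a) (by rw [hpiv]; exact hpiv0)
      (hdeg i a) hdeg hdegt
    rw [← mul_assoc] at h
    refine h.mono le_rfl fun s' hs' => ⟨hs'.1.trans hlen, ?_⟩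
    have h2 := hs'.2
    rwa [updateRow_auxBasis, auxBasis_self, hpiv, unitVec_coe, ← auxPart_nil] at h2
  refine Spec.bind (P := fun s' : State n K => s'.len = a ∧
    s'.IsGauge (toRat A) 1 (auxBasis A a (auxVec A a))) ?_ fun s₂ hs₂ => Spec.pure ⟨?_, ?_⟩
  · have h := Spec.foldlM (K := K) (N := 6 * n + 2) (D := 224 * (n * (n * d)))
      (l := (List.finRange n).filter (a < ·)) (a := s₁)
      (f := fun s j => pivotAdd s a j (s.sys i j))
      (Inv := fun l s' => s'.len = a ∧ s'.IsGauge (toRat A) 1 (auxBasis A a (auxPart A a l)))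
      hs₁ ?_
    · rw [auxPart_filter] at h
      exact h.mono (Nat.mul_le_mul_right _ ((List.length_filter_le _ _).trans_eq
        List.length_finRange)) fun _ h => h
    · intro l₁ j l₂ s' hl hs'
      have haj : a < j := by
        have hj : j ∈ (List.finRange n).filter (a < ·) := by simp [hl]
        simpa using hj
      have hj : j ∉ l₁ := by
        have hnd := (List.nodup_finRange n).filter (a < ·)
        rw [hl, List.nodup_append] at hnd
        exact fun hj => hnd.2.2 j hj j List.mem_cons_self rfl
      have h1 := sys_mul_of_auxBasis hA hia (auxPart_of_lt a l₁) hs'.2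
      have h2 := sys_apply_of_auxBasis hA hia (auxPart_of_lt a l₁) hs'.2 haj
      -- The entry at j has not been added yet, so the correction term vanishes and the system
      -- contains precisely the entry of u_a at j.
      rw [auxPart, if_neg (by simp [haj.ne', hj]), mul_zero, zero_add] at h2
      obtain ⟨hdeg, hdegt⟩ := ratDegree_of_auxBasis hd hA (auxPart_of_lt a l₁)
        (by rw [auxPart_self]; exact hpiv0) (vecDegLE_auxPart hd hA a l₁) hs'.2
      have h := spec_pivotAdd hs'.2 haj.ne (hdeg i j) hdeg hdegt
      rw [← mul_assoc] at h
      refine h.mono le_rfl fun s'' hs'' => ⟨hs''.1.trans hs'.1, ?_⟩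
      have h3 := hs''.2
      rwa [updateRow_auxBasis, auxBasis_self, auxBasis_of_gt haj, h2,
        ← auxPart_append haj.ne' hj] at h3
  · exact congrArg (· + 1) hs₂.1
  · rw [← auxBasis_succ]
    exact ⟨hs₂.2.1, hs₂.2.2⟩

theorem spec_stepOne :
    Spec (stepOne (toRat A)) (n * (14 * n ^ 2)) (224 * (n * (n * d))) fun s =>
      s.len = n ∧ s.IsGauge (toRat A) 1 (auxBasis A n 0) := by
  have hn := NeZero.pos n
  have h := Spec.foldlM (K := K) (N := 14 * n ^ 2) (D := 224 * (n * (n * d)))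
    (l := List.finRange n) (a := (⟨toRat A, 1, 1⟩ : State n K)) (f := introduce)
    -- The first unknown is there from the start, so after the iterations for l there are l + 1 of
    -- them; the minimum accounts for the last iteration, which introduces nothing.
    (Inv := fun l s => s.len = min (l.length + 1) n ∧
      s.IsGauge (toRat A) 1 (auxBasis A (min (l.length + 1) n) (unitVec (l.length + 1)))) ?_ ?_
  · rw [List.length_finRange, min_eq_right (Nat.le_succ n)] at h
    refine h.mono le_rfl fun s hs => ⟨hs.1, ?_⟩
    rw [auxBasis_last 0 (unitVec (n + 1))]
    exact hs.2
  · have h1 : min (([] : List (Fin n)).length + 1) n = 1 := min_eq_left hn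
    rw [h1]
    refine ⟨rfl, ?_⟩
    rw [List.length_nil, zero_add, auxBasis_one hA]
    exact ⟨Matrix.one_mul _, by simp [map_ratDeriv_one]⟩
  · intro l₁ i l₂ s hl hs
    have hi : (i : ℕ) = l₁.length := by
      have h1 : (List.finRange n)[l₁.length]? = some i := by simp [hl]
      rw [List.getElem?_eq_some_iff] at h1
      obtain ⟨_, h1⟩ := h1
      rw [← h1]
      simp
    rw [List.length_append, List.length_singleton, ← hi]
    rw [← hi] at hs
    by_cases hin : (i : ℕ) + 1 < n
    · rw [min_eq_left hin.le] at hs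
      rw [min_eq_left (Nat.succ_le_of_lt hin)]
      exact spec_introduce hd hA (a := ⟨i + 1, hin⟩) rfl hs.1 hs.2
    · have h1 : n = i + 1 := by omega
      rw [introduce, dif_neg hin]
      refine Spec.pure ?_
      rw [min_eq_right (by omega)] at hs ⊢
      refine ⟨hs.1, ?_⟩
      rw [auxBasis_last _ (unitVec ((i : ℕ) + 1))]
      exact hs.2

end StepOne

end AZ

namespace AZ

open Traced

/-! ## The second step -/

section StepTwo

variable {K : Type u} [Field K] {n : ℕ} [NeZero n] {A : Matrix (Fin n) (Fin n) K[X]} {d : ℕ}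

/-- The coordinates of the iterate of index `a` from the index `a` on and at the indices in `S`. -/
noncomputable def coordPart (A : Matrix (Fin n) (Fin n) K[X]) (a : Fin n) (S : List (Fin n)) :
    Fin n → RatFunc K :=
  fun c => if c ∈ S ∨ a ≤ c then coord A a (krylovVec A a) c else 0

theorem coordPart_of_le (a : Fin n) (S : List (Fin n)) (c : Fin n) (hc : a ≤ c) :
    coordPart A a S c = auxVec A a c := by
  rw [coordPart, if_pos (Or.inr hc), auxVec_of_le A hc]

theorem coordPart_nil (a : Fin n) : coordPart A a [] = auxVec A a := by
  funext c
  rcases lt_or_ge c a with hc | hc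
  · rw [auxVec_of_lt A hc, coordPart, if_neg (by simp [hc])]
  · exact coordPart_of_le a [] c hc

theorem coordPart_append {a c : Fin n} {S : List (Fin n)} (hca : c < a) (hc : c ∉ S) :
    coordPart A a (S ++ [c]) =
      coordPart A a S + coord A a (krylovVec A a) c • Pi.single c 1 := by
  funext l
  by_cases hl : l = c
  · subst hl
    simp [coordPart, hca.not_ge, hc]
  · simp [coordPart, hl]

theorem coordPart_filter {i a : Fin n} (hia : (i : ℕ) + 1 = a) :
    coordPart A a ((List.finRange n).filter (· ≤ i)) = coord A a (krylovVec A a) := by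
  funext c
  refine if_pos ?_
  rcases lt_or_ge c a with hc | hc
  · refine Or.inl ?_
    simp only [List.mem_filter, List.mem_finRange, true_and, decide_eq_true_eq]
    exact Fin.le_def.mpr (by have := Fin.lt_def.mp hc; omega)
  · exact Or.inr hc

theorem updateRow_mixedBasis (a : Fin n) (v w : Fin n → RatFunc K) :
    (mixedBasis A a v).updateRow a w = mixedBasis A a w := by
  refine funext fun k => ?_
  rcases lt_trichotomy k a with h | rfl | h
  · rw [Matrix.updateRow_ne h.ne, mixedBasis_of_lt h, mixedBasis_of_lt h]
  · rw [Matrix.updateRow_self, mixedBasis_self]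
  · rw [Matrix.updateRow_ne h.ne', mixedBasis_of_gt h, mixedBasis_of_gt h]

/-- The state of the second step in which the unknown of index `a` is being replaced. -/
noncomputable abbrev mixedPart (A : Matrix (Fin n) (Fin n) K[X]) (a : Fin n) (S : List (Fin n)) :
    Mat n K :=
  mixedBasis A a (Matrix.vecMul (coordPart A a S) (toRat (krylovBasis A a)))

theorem mixedPart_of_lt {a k : Fin n} (S : List (Fin n)) (h : k < a) :
    mixedPart A a S k = krylovVec A k :=
  mixedBasis_of_lt h

theorem mixedPart_self (a : Fin n) (S : List (Fin n)) :
    mixedPart A a S a = Matrix.vecMul (coordPart A a S) (toRat (krylovBasis A a)) :=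
  mixedBasis_self

theorem mixedPart_of_gt {a k : Fin n} (S : List (Fin n)) (h : a < k) :
    mixedPart A a S k = auxVec A k :=
  mixedBasis_of_gt h

variable (hd : ∀ i j, (A i j).natDegree ≤ d) (hA : ∀ a, (krylovBasis A a).det ≠ 0)
include hA

/-- The row i belongs to δ^i(e), whose image under δ is δ^a(e). Its entry at l is therefore the
missing coordinate of δ^a(e), as long as that coordinate has not been added to row a. -/
theorem sys_apply_of_mixedPart {s : State n K} {U : Mat n K} {i a : Fin n}
    (hia : (i : ℕ) + 1 = a) {S : List (Fin n)}
    (hs : s.IsGauge (toRat A) U (mixedPart A a S)) {l : Fin n} (hl : l < a) (hlS : l ∉ S) :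
    s.sys i l = coord A a (krylovVec A a) l := by
  have h := coord_vecMul_mixedBasis_of_lt hA (coordPart A a S) (s.sys i) hl
  rw [hs.vecMul_sys, mixedPart_of_lt S (Fin.lt_def.mpr (hia ▸ Nat.lt_succ_self _)), delta_krylovVec, hia,
    coordPart, if_neg (by simp [hl, hlS]), mul_zero, add_zero] at h
  exact h.symm

include hd

theorem vecDegLE_mixedPart (a : Fin n) (S : List (Fin n)) (k : Fin n) :
    VecDegLE (4 * (n * (n * d))) (mixedPart A a S k) := by
  rcases lt_trichotomy k a with h | rfl | h
  · rw [mixedPart_of_lt S h]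
    exact (vecDegLE_krylovVec hd k.2.le).mono (by omega)
  · rw [mixedPart_self]
    have h1 : VecDegLE (3 * (n * (n * d))) (coordPart A k S) :=
      (((vecDegLE_krylovVec hd k.2.le).coord hd hA k).ite _).mono (by omega)
    refine (h1.vecMul (natDegree_krylovBasis_le hd k)).mono ?_
    have := Nat.le_mul_of_pos_left (n * d) (NeZero.pos n)
    omega
  · rw [mixedPart_of_gt S h]
    exact (vecDegLE_auxVec hd hA k.2.le).mono (by omega)

/-- The bound 2(8n²d + d) + 10n²d ≤ 28n²d for the system is the source of the constant 28. -/
theorem ratDegree_of_mixedPart {s : State n K} {a : Fin n} {S : List (Fin n)}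
    (hs : s.IsGauge (toRat A) (auxBasis A n 0) (mixedPart A a S)) :
    (∀ r c, ratDegree (s.sys r c) ≤ 28 * (n * (n * d))) ∧
      ∀ r c, ratDegree (s.trans r c) ≤ 28 * (n * (n * d)) := by
  refine ⟨fun r c => ?_, fun r c => ?_⟩
  · have h1 : VecDegLE (3 * (n * (n * d))) (coordPart A a S) :=
      (((vecDegLE_krylovVec hd a.2.le).coord hd hA a).ite _).mono (by omega)
    have h := ratDegree_le_of_vecMul_mixedBasis hd hA (coordPart_of_le a S) h1
      ((vecDegLE_mixedPart hd hA a S r).delta hd) (hs.vecMul_sys r) c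
    have := le_mul_mul_self n d
    exact h.trans (by omega)
  · have h := ratDegree_le_of_vecMul_auxBasis_last hd hA (vecDegLE_mixedPart hd hA a S r)
      (congrFun hs.trans_mul r) c
    exact h.trans (by omega)

theorem spec_eliminate {s : State n K} {i a : Fin n} (hia : (i : ℕ) + 1 = a) (hlen : s.len = n)
    (hs : s.IsGauge (toRat A) (auxBasis A n 0) (mixedBasis A a (auxVec A a))) :
    Spec (eliminate s i) (8 * n ^ 2) (224 * (n * (n * d))) fun s' =>
      s'.len = n ∧ s'.IsGauge (toRat A) (auxBasis A n 0)
        (mixedBasis A (a + 1) (auxVec A (a + 1))) := by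
  have hi : (i : ℕ) + 1 < n := hia ▸ a.2
  have hnext : (⟨i + 1, hi⟩ : Fin n) = a := Fin.ext hia
  have hn := NeZero.pos n
  rw [eliminate, dif_pos hi, if_pos (by rwa [hlen])]
  rw [hnext]
  have h := Spec.foldlM (K := K) (N := 6 * n + 2) (D := 224 * (n * (n * d)))
    (l := (List.finRange n).filter (· ≤ i)) (a := s)
    (f := fun s j => pivotAdd s a j (s.sys i j))
    (Inv := fun l s' => s'.len = n ∧ s'.IsGauge (toRat A) (auxBasis A n 0) (mixedPart A a l))
    ⟨hlen, ?_⟩ ?_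
  · refine h.mono ((Nat.mul_le_mul_right _ ((List.length_filter_le _ _).trans_eq
      List.length_finRange)).trans (by nlinarith)) fun s' hs' => ⟨hs'.1, ?_⟩
    have h2 := hs'.2
    rwa [mixedPart, coordPart_filter hia, vecMul_coord hA, mixedBasis_succ] at h2
  · rwa [mixedPart, coordPart_nil, vecMul_krylovBasis_of_support fun k hk => auxVec_of_lt A hk]
  · intro l₁ j l₂ s' hl hs'
    have hja : j < a := by
      have hj : j ∈ (List.finRange n).filter (· ≤ i) := by simp [hl]
      have hji : j ≤ i := by simpa using hj
      exact Fin.lt_def.mpr (by have := Fin.le_def.mp hji; omega)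
    have hj : j ∉ l₁ := by
      have hnd := (List.nodup_finRange n).filter (· ≤ i)
      rw [hl, List.nodup_append] at hnd
      exact fun hj => hnd.2.2 j hj j List.mem_cons_self rfl
    have h1 := sys_apply_of_mixedPart hA hia hs'.2 hja hj
    obtain ⟨hdeg, hdegt⟩ := ratDegree_of_mixedPart hd hA hs'.2
    have h := spec_pivotAdd hs'.2 hja.ne' (hdeg i j) hdeg hdegt
    rw [← mul_assoc] at h
    refine h.mono le_rfl fun s'' hs'' => ⟨hs''.1.trans hs'.1, ?_⟩
    have h3 := hs''.2
    -- As the row j of P_a, this iterate can be added inside the coordinates.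
    have h4 : krylovVec A j =
        Matrix.vecMul (Pi.single j 1) (toRat (krylovBasis A a)) := by
      rw [Matrix.single_one_vecMul, ← toRat_krylovBasis_of_lt A hja]
      rfl
    rwa [updateRow_mixedBasis, mixedPart_self, mixedPart_of_lt _ hja, h1, h4,
      ← Matrix.smul_vecMul, ← Matrix.add_vecMul, ← coordPart_append hja hj] at h3

theorem spec_stepTwo {s : State n K} (hlen : s.len = n)
    (hs : s.IsGauge (toRat A) 1 (auxBasis A n 0)) :
    Spec (stepTwo s.sys s.len) (n * (8 * n ^ 2)) (224 * (n * (n * d))) fun s' =>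
      s'.IsGauge (toRat A) (auxBasis A n 0) (krylov (toRat A) (Pi.single 0 1)) := by
  have hn := NeZero.pos n
  have h := Spec.foldlM (K := K) (N := 8 * n ^ 2) (D := 224 * (n * (n * d)))
    (l := List.finRange n) (a := (⟨s.sys, 1, s.len⟩ : State n K)) (f := eliminate)
    (Inv := fun l s => s.len = n ∧ s.IsGauge (toRat A) (auxBasis A n 0)
      (mixedBasis A (min (l.length + 1) n) (auxVec A (l.length + 1)))) ?_ ?_
  · rw [List.length_finRange, min_eq_right (Nat.le_succ n), mixedBasis_last] at h
    exact h.mono le_rfl fun s hs => hs.2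
  · have h1 : min (([] : List (Fin n)).length + 1) n = 1 := min_eq_left hn
    rw [h1, List.length_nil, zero_add, mixedBasis_one hA 0]
    exact ⟨hlen, Matrix.one_mul _, hs.sys_mul⟩
  · intro l₁ i l₂ s hl hs
    have hi : (i : ℕ) = l₁.length := by
      have h1 : (List.finRange n)[l₁.length]? = some i := by simp [hl]
      rw [List.getElem?_eq_some_iff] at h1
      obtain ⟨_, h1⟩ := h1
      rw [← h1]
      simp
    rw [List.length_append, List.length_singleton, ← hi]
    rw [← hi] at hs
    by_cases hin : (i : ℕ) + 1 < n
    · rw [min_eq_left hin.le] at hs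
      rw [min_eq_left (Nat.succ_le_of_lt hin)]
      exact spec_eliminate hd hA (a := ⟨i + 1, hin⟩) rfl hs.1 hs.2
    · rw [eliminate, dif_neg hin]
      refine Spec.pure ?_
      rw [min_eq_right (by omega), mixedBasis_last] at hs ⊢
      exact hs

theorem spec_abramovZima :
    Spec (abramovZima (toRat A)) (22 * n ^ 3) (224 * (n * (n * d))) fun R =>
      R.len = n ∧ R.U = auxBasis A n 0 ∧
        R.β * R.U = R.U * toRat A + R.U.map ratDeriv ∧
        R.L * R.U = krylov (toRat A) (Pi.single 0 1) ∧
        R.C * krylov (toRat A) (Pi.single 0 1) =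
          krylov (toRat A) (Pi.single 0 1) * toRat A +
            (krylov (toRat A) (Pi.single 0 1)).map ratDeriv := by
  refine Spec.mono (N := n * (14 * n ^ 2) + (n * (8 * n ^ 2) + 0)) (Spec.bind
    (spec_stepOne hd hA) fun s hs => Spec.bind (spec_stepTwo hd hA hs.1 hs.2) fun t ht =>
    Spec.pure (P := fun R : Output n K => R.len = n ∧ R.U = auxBasis A n 0 ∧
        R.β * R.U = R.U * toRat A + R.U.map ratDeriv ∧
        R.L * R.U = krylov (toRat A) (Pi.single 0 1) ∧
        R.C * krylov (toRat A) (Pi.single 0 1) =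
          krylov (toRat A) (Pi.single 0 1) * toRat A +
            (krylov (toRat A) (Pi.single 0 1)).map ratDeriv) ?_) (by ring_nf; rfl) fun _ h => h
  have hU : s.trans = auxBasis A n 0 := by rw [← hs.2.trans_mul, Matrix.mul_one]
  refine ⟨hs.1, hU, ?_, ?_, ht.sys_mul⟩
  · dsimp only
    rw [hU]
    exact hs.2.sys_mul
  · dsimp only
    rw [hU]
    exact ht.trans_mul

end StepTwo

end AZ

namespace AZ

open Traced

/-! ## Cost -/

section Cost

theorem Traced.Spec.cost_le {K : Type u} [Field K] {α : Type u} {x : Traced K α} {N D : ℕ}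
    {P : α → Prop} (hx : Spec x N D P) {A : RatArith} {B : ℕ}
    (hA : ∀ st : Step K, st.DegLE D → A.stepCost st ≤ B) : x.cost A ≤ N * B := by
  refine (List.sum_le_card_nsmul _ B fun c hc => ?_).trans ?_
  · obtain ⟨st, hst, rfl⟩ := List.mem_map.mp hc
    exact hA st (hx.2.1 st hst)
  · rw [List.length_map, smul_eq_mul]
    exact Nat.mul_le_mul_right B hx.1

/-- With ⌈log₂ y⌉ = m + 1, the bound log 2 > 1/2 gives m ≤ 2 log y, and 1 ≤ log y absorbs the
constant: 2m + 15 ≤ (4 + 15) log y. -/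
theorem clog_le_mul_log {y : ℕ} (hy : 3 ≤ y) :
    (2 * Nat.clog 2 y + 13 : ℝ) ≤ 19 * Real.log y := by
  have hy0 : (0 : ℝ) < y := by exact_mod_cast (by omega : 0 < y)
  have h1 : 1 ≤ Real.log y := by
    rw [Real.le_log_iff_exp_le hy0]
    have h3 : (3 : ℝ) ≤ y := by exact_mod_cast hy
    linarith [Real.exp_one_lt_d9]
  have hpos := Nat.clog_pos one_lt_two (show 1 < y by omega)
  obtain ⟨m, hm⟩ := Nat.exists_eq_succ_of_ne_zero hpos.ne'
  have h2 := Nat.pow_pred_clog_lt_self one_lt_two (show 1 < y by omega)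
  rw [hm, Nat.pred_succ] at h2
  have h3 : (m : ℝ) * Real.log 2 ≤ Real.log y := by
    rw [← Real.log_pow]
    exact Real.log_le_log (by positivity) (by exact_mod_cast h2.le)
  have h4 : (m : ℝ) * (1 / 2) ≤ m * Real.log 2 :=
    mul_le_mul_of_nonneg_left (by linarith [Real.log_two_gt_d9]) (Nat.cast_nonneg m)
  rw [hm]
  push_cast
  linarith

/-- Since n²d ≤ (nd + 2)² and 4 · 225 ≤ 2^10, logarithms of the operand degrees are comparable with
log(nd + 2). -/
theorem clog_le_two_mul_clog {n d : ℕ} (hd : 1 ≤ d) :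
    Nat.clog 2 (4 * (224 * (n * (n * d)) + 1)) ≤ 2 * Nat.clog 2 (n * d + 2) + 10 := by
  refine Nat.clog_le_of_le_pow ?_
  have h := Nat.le_pow_clog one_lt_two (n * d + 2)
  have h1 : n * (n * d) ≤ (n * d + 2) * (n * d + 2) :=
    Nat.mul_le_mul ((Nat.le_mul_of_pos_right n hd).trans (Nat.le_add_right _ _))
      (Nat.le_add_right _ _)
  have h2 : 1 ≤ (n * d + 2) * (n * d + 2) := Nat.mul_pos (by omega) (by omega)
  have h3 := Nat.mul_le_mul h h
  rw [pow_add, two_mul, pow_add]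
  omega

end Cost

/-! ## The shape of the output -/

section Shape

variable {K : Type u} [Field K] {n : ℕ}

theorem eq_gauge {M T B : Mat n K} (hT : IsUnit T.det) (h : B * T = T * M + T.map ratDeriv) :
    B = gauge T M := by
  rw [gauge, ← h, Matrix.mul_assoc, Matrix.mul_nonsing_inv _ hT, Matrix.mul_one]

theorem vecMul_row_of_mul_eq {M T B : Mat n K} (h : B * T = T * M + T.map ratDeriv) (i : Fin n) :
    Matrix.vecMul (B i) T = delta M (T i) := by
  rw [← mul_add_map_ratDeriv_apply, ← h]
  rfl

theorem matDegree_le {A : Mat n K} {N : ℕ} (h : ∀ i j, ratDegree (A i j) ≤ N) :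
    matDegree A ≤ N :=
  Finset.sup_le fun i _ => Finset.sup_le fun j _ => h i j

variable [NeZero n] {A : Matrix (Fin n) (Fin n) K[X]}

theorem isUpperTriangular_auxBasis : (auxBasis A n 0).IsUpperTriangular := fun i j hij => by
  have hij : j < i := hij
  rw [auxBasis_of_lt i.2, auxVec_of_lt A hij]

theorem isCompanion_of_mul_krylov {B : Mat n K}
    (hP : IsUnit (krylov (toRat A) (Pi.single 0 1)).det)
    (h : B * krylov (toRat A) (Pi.single 0 1) = krylov (toRat A) (Pi.single 0 1) * toRat A +
      (krylov (toRat A) (Pi.single 0 1)).map ratDeriv) : IsCompanion B := by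
  intro i j hi
  have h1 := vecMul_row_of_mul_eq h i
  rw [krylov_toRat_apply, delta_krylovVec] at h1
  have h2 : Matrix.vecMul (Pi.single ⟨i + 1, hi⟩ 1) (krylov (toRat A) (Pi.single 0 1)) =
      krylovVec A (i + 1) := by
    rw [Matrix.single_one_vecMul]
    exact krylov_toRat_apply A ⟨i + 1, hi⟩
  have h3 := Matrix.vecMul_injective_of_isUnit ((Matrix.isUnit_iff_isUnit_det _).mpr hP)
    (h1.trans h2.symm)
  rw [h3, Pi.single_apply]
  simp [Fin.ext_iff]

variable (hA : ∀ a, (krylovBasis A a).det ≠ 0)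
include hA

theorem coord_vecMul_auxBasis_last (v x : Fin n → RatFunc K) (l : Fin n) :
    coord A l (Matrix.vecMul x (auxBasis A n v)) l = x l * auxVec A l l := by
  rw [auxBasis_last v 0]
  exact coord_vecMul_auxBasis_of_lt hA (v := 0) (fun _ _ => rfl) x l.2

/-- Row i of B gives δ(u_i) in terms of the u_j. As δ(u_i) ≡ u_{i+1} modulo K_{i+1}, its coordinates
beyond i are those of u_{i+1}. -/
theorem isAugmentedLower_of_mul_auxBasis {B : Mat n K} {v : Fin n → RatFunc K}
    (h : B * auxBasis A n v = auxBasis A n v * toRat A + (auxBasis A n v).map ratDeriv) :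
    IsAugmentedLower B := by
  intro i j hij
  have hij' : (i : ℕ) + 1 ≤ j := hij
  have h1 := coord_vecMul_auxBasis_last hA v (B i) j
  rw [vecMul_row_of_mul_eq h, auxBasis_of_lt i.2] at h1
  have h2 := coord_apply_of_mem_krylovSpan hA
    (krylovSpan_mono A hij' (delta_auxVec_sub_mem hA i)) (le_refl (j : ℕ))
  rw [map_sub, Pi.sub_apply, sub_eq_zero] at h2
  have h0 := auxVec_diag_ne_zero hA j
  rw [h2] at h1
  rcases Nat.lt_or_eq_of_le hij' with hlt | heq
  · rw [coord_auxVec_of_lt hA hlt le_rfl, eq_comm, mul_eq_zero] at h1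
    rw [h1.resolve_right h0, if_neg hlt.ne']
  · rw [heq, coord_auxVec_of_le hA le_rfl] at h1
    rw [if_pos heq.symm]
    exact (mul_eq_right₀ h0).mp h1.symm

/-- Since δ^i(e) lies in u_i + K_i, its leading coordinate is that of u_i and no later u_l occurs.
-/
theorem apply_of_mul_auxBasis {L : Mat n K} {v : Fin n → RatFunc K}
    (h : L * auxBasis A n v = krylov (toRat A) (Pi.single 0 1)) {i l : Fin n} (hil : i ≤ l) :
    L i l = if i = l then 1 else 0 := by
  have h1 := coord_vecMul_auxBasis_last hA v (L i) l
  have h2 : Matrix.vecMul (L i) (auxBasis A n v) = krylovVec A i := by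
    rw [← krylov_toRat_apply, ← h]
    rfl
  have h0 := auxVec_diag_ne_zero hA l
  rw [h2] at h1
  rcases eq_or_lt_of_le hil with rfl | hil
  · rw [if_pos rfl]
    rw [← auxVec_of_le A le_rfl] at h1
    exact (mul_eq_right₀ h0).mp h1.symm
  · rw [coord_apply_of_mem_krylovSpan hA (krylovVec_mem_krylovSpan A hil) le_rfl, eq_comm,
      mul_eq_zero] at h1
    rw [h1.resolve_right h0, if_neg hil.ne]

end Shape

end AZ

/-! ### The main theorem -/

theorem mainTheorem5 :
    ∃ (A : AZ.RatArith) (c k : ℕ),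
      ∀ (K : Type u) [Field K] [CharZero K],
        A.Correct K ∧
        ∀ (n d : ℕ) [NeZero n], 1 ≤ d →
          AZ.IsGeneric fun m : Fin n × Fin n × Fin (d + 1) → K =>
            let M : AZ.Mat n K := AZ.polyMatrix m
            let P : AZ.Mat n K := AZ.krylov M (Pi.single 0 1)
            let R : AZ.Output n K := (AZ.abramovZima M).val
            -- the run goes through: one scalar equation of order `n`
            R.len = n ∧ AZ.Uncouples P M R.C ∧
            -- first step: `Z = U Y`, `Z' = β Z`
            R.U.IsUpperTriangular ∧ R.U 0 = Pi.single 0 1 ∧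
            R.β = AZ.gauge R.U M ∧ AZ.IsAugmentedLower R.β ∧
            -- second step: `W = L Z`, `W' = C W`
            R.L.IsLowerTriangular ∧ (∀ i, R.L i i = 1) ∧ R.C = AZ.gauge R.L R.β ∧
            -- the transformation is the LU decomposition of `P`, with its degrees
            P = R.L * R.U ∧
            AZ.matDegree R.L ≤ c * (n ^ 2 * d) ∧ AZ.matDegree R.U ≤ c * (n ^ 2 * d) ∧
            -- arithmetic complexity
            (((AZ.abramovZima M).cost A : ℕ) : ℝ) ≤
              c * ((n : ℝ) ^ 5 * d) * Real.log (n * d + 2) ^ k := by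
  obtain ⟨Ar, B, hAr⟩ := AZ.exists_ratArith.{u}
  -- The factors are the step count 22n³, the bound 224n²d + 1 ≤ 225n²d, the passage to natural
  -- logarithms, and the constant of the arithmetic. The summand 9 covers the constants 6 and 3 of
  -- the degrees of L and U.
  refine ⟨Ar, 22 * 225 * 19 ^ 7 * B + 9, 7, fun K _ _ => ⟨(hAr K).1, fun n d _ hd1 => ?_⟩⟩
  obtain ⟨F, hF0, hF⟩ := AZ.isGeneric_det_krylovBasis_ne_zero n d K
  refine ⟨F, hF0, fun m hm => ?_⟩
  have hA : ∀ a, (AZ.krylovBasis (AZ.coeffMatrix m) a).det ≠ 0 := fun a => by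
    rcases le_total a n with h | h
    · exact hF m hm a h
    · rw [AZ.krylovBasis_of_le _ h]
      exact hF m hm n le_rfl
  have hd := AZ.natDegree_coeffMatrix_le m
  have hspec := AZ.spec_abramovZima hd hA
  have hn : 1 ≤ n := NeZero.one_le
  have hP := AZ.isUnit_det_krylov hA
  beta_reduce
  rw [AZ.polyMatrix_eq_map]
  obtain ⟨hlen, hU, hβ, hL, hC⟩ := hspec.2.2
  intro M P R
  have hUdet : IsUnit R.U.det := by
    rw [hU]
    exact AZ.isUnit_det_auxBasis_last hA 0
  have hLdet : IsUnit R.L.det := by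
    have h : R.L.det * R.U.det = P.det := by rw [← Matrix.det_mul, hL]
    exact isUnit_of_mul_isUnit_left (h ▸ hP)
  -- After multiplication by U on the right, both sides become PM + P', by P = LU and the product
  -- rule; U is invertible.
  have hCL : R.C * R.L = R.L * R.β + R.L.map AZ.ratDeriv := by
    refine ((Matrix.isUnit_iff_isUnit_det _).mpr hUdet).mul_right_cancel ?_
    rw [Matrix.mul_assoc, hL, hC, ← hL, AZ.map_ratDeriv_mul, Matrix.add_mul, Matrix.mul_assoc R.L R.β,
      hβ, Matrix.mul_add, Matrix.mul_assoc]
    abel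
  have hLU := hL
  rw [hU] at hL hβ
  have hLapply := fun {i l : Fin n} (h : i ≤ l) => AZ.apply_of_mul_auxBasis hA hL h
  have hH : n ^ 2 * d = n * (n * d) := by ring
  refine ⟨hlen, ⟨hP, (AZ.eq_gauge hP hC).symm, AZ.isCompanion_of_mul_krylov hP hC⟩, ?_, ?_,
    AZ.eq_gauge hUdet (by rw [hU]; exact hβ), AZ.isAugmentedLower_of_mul_auxBasis hA hβ,
    fun i j hij => ?_, fun i => (hLapply le_rfl).trans (if_pos rfl), AZ.eq_gauge hLdet hCL,
    hLU.symm, ?_, ?_, ?_⟩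
  · rw [hU]
    exact AZ.isUpperTriangular_auxBasis
  · rw [hU, AZ.auxBasis_of_lt (Fin.is_lt 0), Fin.val_zero, AZ.auxVec_zero hA]
  · have hij : i < j := hij
    rw [hLapply hij.le, if_neg hij.ne]
  · refine AZ.matDegree_le fun i j => ?_
    have h : Matrix.vecMul (R.L i) (AZ.auxBasis (AZ.coeffMatrix m) n 0) =
        AZ.krylovVec (AZ.coeffMatrix m) i := by
      rw [← AZ.krylov_toRat_apply, ← hL]
      rfl
    refine (AZ.ratDegree_le_of_vecMul_auxBasis_last hd hA
      (AZ.vecDegLE_krylovVec hd i.2.le) h j).trans ?_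
    rw [hH]
    nlinarith [Nat.zero_le (22 * 225 * 19 ^ 7 * B * (n * (n * d)))]
  · refine AZ.matDegree_le fun i j => ?_
    rw [hU, AZ.auxBasis_of_lt i.2]
    refine ((AZ.vecDegLE_auxVec hd hA i.2.le).apply j).trans ?_
    rw [hH]
    nlinarith [Nat.zero_le (22 * 225 * 19 ^ 7 * B * (n * (n * d)))]
  · have h1 := hspec.cost_le ((hAr K).2 (224 * (n * (n * d))))
    have hH1 : 1 ≤ n * (n * d) := Nat.mul_pos hn (Nat.mul_pos hn hd1)
    have hnd : 1 ≤ n * d := Nat.mul_pos hn hd1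
    have h2 : (AZ.abramovZima M).cost Ar ≤ 22 * 225 * B * (n ^ 5 * d) *
        (2 * Nat.clog 2 (n * d + 2) + 13) ^ 7 := by
      refine h1.trans ?_
      have h3 := AZ.clog_le_two_mul_clog (n := n) hd1
      calc _ ≤ 22 * n ^ 3 * (B * (225 * (n * (n * d))) *
            (2 * Nat.clog 2 (n * d + 2) + 10 + 3) ^ 7) := by
            gcongr
            omega
        _ = _ := by ring
    have h4 := AZ.clog_le_mul_log (y := n * d + 2) (by omega)
    push_cast at h4
    have h5 : (0 : ℝ) ≤ Real.log (n * d + 2) := by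
      have : (0 : ℝ) ≤ 2 * (Nat.clog 2 (n * d + 2) : ℝ) + 13 := by positivity
      linarith
    calc (((AZ.abramovZima M).cost Ar : ℕ) : ℝ)
        ≤ 22 * 225 * B * ((n : ℝ) ^ 5 * d) * (2 * Nat.clog 2 (n * d + 2) + 13) ^ 7 := by
          exact_mod_cast h2
      _ ≤ 22 * 225 * B * ((n : ℝ) ^ 5 * d) * (19 * Real.log (n * d + 2)) ^ 7 := by
          gcongr
      _ = (22 * 225 * 19 ^ 7 * B) * ((n : ℝ) ^ 5 * d) * Real.log (n * d + 2) ^ 7 := by ring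
      _ ≤ _ := by
          push_cast
          gcongr
          linarith
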